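/- Let $n\ge 0$ be an integer and let $q,p\in\mathbb C\setminus\{0\}$. For $1\le i,j,k,l\le n$ let $R_{ij}^{kl}=0$ unless $i+j=k+l$, and for $i+j=k+l$ let $$pR_{ij}^{kl}=\begin{cases} q\,p^{2(l-i)} & i=k\ge j=l,\\ q^{-1}p^{2(l-i)} & i=k<j=l,\\ (q-q^{-1})p^{2(l-i)} & j\le k<i,\\ (q^{-1}-q)p^{2(l-i)} & i<k<j,\\ 0&\text{otherwise}\end{cases}$$ (the two-parameter Cremmer–Gervais $R$-matrix). Let $A(R)$ be the bialgebra over $\mathbb C$ with generators $T_i^k$, relations $\sum_{u,v}R_{ji}^{uv}T_u^kT_v^l=\sum_{u,v}T_i^uT_j^vR_{vu}^{kl}$, comultiplication $\Delta(T_i^k)=\sum_u T_i^u\otimes T_u^k$ and counit $\epsilon(T_i^k)=\delta_{ik}$. Let $\Lambda(R)$ be the algebra generated by $x_1,\dots,x_n$ with relations $q^{-1}x_jx_i+p\sum_{k,l}R_{ij}^{kl}x_kx_l=0$ and $x_i^2=0$ (the latter being redundant if $q^2\ne-1$), and put $$\mathrm{det}_q=\sum_{\sigma\in S_n}a_\sigma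 T_1^{\sigma(1)}\cdots T_n^{\sigma(n)},\qquad a_\sigma=\prod_{i<j,\ \sigma(i)>\sigma(j)}\bigl(-p^{2(\sigma(i)-\sigma(j))}\bigr),$$ so that $x_{\sigma(1)}\cdots x_{\sigma(n)}=a_\sigma\,x_1\cdots x_n$ in $\Lambda(R)$. A braiding on a bialgebra $A$ is a bilinear form $\langle\ |\ \rangle$ that is invertible in the convolution algebra $(A\otimes A)^*$ and satisfies $\sum\langle a_{(1)}|b_{(1)}\rangle b_{(2)}a_{(2)}=\sum\langle a_{(2)}|b_{(2)}\rangle a_{(1)}b_{(1)}$, $\langle a|bc\rangle=\sum\langle a_{(1)}|b\rangle\langle a_{(2)}|c\rangle$ and $\langle ab|c\rangle=\sum\langle b|c_{(1)}\rangle\langle a|c_{(2)}\rangle$. A braided bialgebra (Hopf algebra) is a bialgebra (Hopf algebra) with a braiding; a morphism of braided bialgebras is a bialgebra map preserving the forms. A braided Hopf ideal is a two-sided ideal $I$ that is a coideal, is stable under the antipode and satisfies $\langle I|H\rangle=\langle H|I\rangle=0$. Theorem. (0) $x_1\cdots x_n\neq0$; there is an algebra map $\rho:\Lambda(R)\to A(R)\otimes\Lambda(R)$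 with $\rho(x_i)=\sum_jT_i^j\otimes x_j$, and $\rho(x_1\cdots x_n)=\mathrm{det}_q\otimes x_1\cdots x_n$. Moreover $A(R)$ has a braiding with $\langle T_i^k|T_j^l\rangle=R_{ji}^{lk}$, and the powers of $\mathrm{det}_q$ form an Ore set in $A(R)$. (1) The localization $\mathbb C_R[GL(n)]=A(R)[\mathrm{det}_q^{-1}]$ has a braided Hopf algebra structure such that the natural map $A(R)\to\mathbb C_R[GL(n)]$ is a morphism of braided bialgebras. (2) Suppose that $p^n=q$. Then the two-sided ideal $(\mathrm{det}_q-1)$ of $\mathbb C_R[GL(n)]$ is a braided Hopf ideal, and $\mathbb C_R[SL(n)]=A(R)/(\mathrm{det}_q-1)$ has a braided Hopf algebra structure such that the natural map $A(R)\to\mathbb C_R[SL(n)]$ is a morphism of braided bialgebras, and this map extends to a surjective morphism of braided Hopf algebras $\mathbb C_R[GL(n)]\to\mathbb C_R[SL(n)]$ with kernel $(\mathrm{det}_q-1)$. -/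

import Mathlib

open scoped TensorProduct

noncomputable section

/-! ### Braided bialgebras -/

/-- A braiding on a bialgebra `A`: a bilinear pairing `⟨a | b⟩` that is convolution invertible in
`(A ⊗ A)^*` and satisfies
`∑ ⟨a₁ | b₁⟩ b₂ a₂ = ∑ ⟨a₂ | b₂⟩ a₁ b₁`, `⟨a | b c⟩ = ∑ ⟨a₁ | b⟩ ⟨a₂ | c⟩` and
`⟨a b | c⟩ = ∑ ⟨b | c₁⟩ ⟨a | c₂⟩`. The Sweedler sums are written with representations of the
comultiplications as sums of pure tensors; such representations exist for every element, and the
sums do not depend on them. -/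
structure Braiding (k : Type*) (A : Type*) [Field k] [Ring A] [Bialgebra k A] where
  /-- the pairing `⟨a | b⟩` -/
  pair : A →ₗ[k] A →ₗ[k] k
  comm : ∀ (a b : A) (ra : Coalgebra.Repr k a (A × A)) (rb : Coalgebra.Repr k b (A × A)),
    ∑ i ∈ ra.index, ∑ j ∈ rb.index,
        pair (ra.left i) (rb.left j) • (rb.right j * ra.right i)
      = ∑ i ∈ ra.index, ∑ j ∈ rb.index,
        pair (ra.right i) (rb.right j) • (ra.left i * rb.left j)
  invertible : ∃ inv : A →ₗ[k] A →ₗ[k] k,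
    ∀ (a b : A) (ra : Coalgebra.Repr k a (A × A)) (rb : Coalgebra.Repr k b (A × A)),
      ∑ i ∈ ra.index, ∑ j ∈ rb.index,
          pair (ra.left i) (rb.left j) * inv (ra.right i) (rb.right j)
        = Coalgebra.counit (R := k) a * Coalgebra.counit (R := k) b ∧
      ∑ i ∈ ra.index, ∑ j ∈ rb.index,
          inv (ra.left i) (rb.left j) * pair (ra.right i) (rb.right j)
        = Coalgebra.counit (R := k) a * Coalgebra.counit (R := k) b
  pair_mul : ∀ (a b c : A) (ra : Coalgebra.Repr k a (A × A)),
    pair a (b * c) = ∑ i ∈ ra.index, pair (ra.left i) b * pair (ra.right i) c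
  mul_pair : ∀ (a b c : A) (rc : Coalgebra.Repr k c (A × A)),
    pair (a * b) c = ∑ i ∈ rc.index, pair b (rc.left i) * pair a (rc.right i)

/-- The bialgebra morphism `f` is a morphism of braided bialgebras: `⟨f a | f b⟩ = ⟨a | b⟩`. -/
def IsBraidedHom {k A B : Type*} [Field k] [Ring A] [Bialgebra k A] [Ring B] [Bialgebra k B]
    (β : Braiding k A) (γ : Braiding k B) (f : A →ₐc[k] B) : Prop :=
  ∀ a b : A, γ.pair (f a) (f b) = β.pair a b

/-- A braided Hopf ideal of a braided Hopf algebra: a two-sided ideal `I` that is a coideal, stable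
under the antipode, and contained in the left and in the right radical of the braiding
(which is exactly what makes the braiding descend to the quotient). -/
def IsBraidedHopfIdeal {k H : Type*} [Field k] [Ring H] [HopfAlgebra k H]
    (γ : Braiding k H) (I : TwoSidedIdeal H) : Prop :=
  I.asIdeal.IsHopfIdeal k ∧ ∀ x ∈ I, ∀ y : H, γ.pair x y = 0 ∧ γ.pair y x = 0

/-! ### The bialgebra `A(R)` -/

/-- The defining relations `∑ R_{ji}^{uv} T_u^k T_v^l = ∑ T_i^u T_j^v R_{vu}^{kl}` of `A(R)`.
Here `R i j k l` is `R_{ij}^{kl}` and the generator `(i, k)` is `T_i^k`. -/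
inductive FRTRel {k : Type*} [Field k] {n : ℕ} (R : Fin n → Fin n → Fin n → Fin n → k) :
    FreeAlgebra k (Fin n × Fin n) → FreeAlgebra k (Fin n × Fin n) → Prop
  | mk (i j a b : Fin n) : FRTRel R
      (∑ u, ∑ v, R j i u v • (FreeAlgebra.ι k (u, a) * FreeAlgebra.ι k (v, b)))
      (∑ u, ∑ v, R v u a b • (FreeAlgebra.ι k (i, u) * FreeAlgebra.ι k (j, v)))

/-- The algebra `A(R)`. -/
def FRT {k : Type*} [Field k] {n : ℕ} (R : Fin n → Fin n → Fin n → Fin n → k) : Type _ :=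
  RingQuot (FRTRel R)

namespace FRT

variable {k : Type*} [Field k] {n : ℕ} (R : Fin n → Fin n → Fin n → Fin n → k)

instance : Ring (FRT R) := inferInstanceAs (Ring (RingQuot (FRTRel R)))

instance : Algebra k (FRT R) := inferInstanceAs (Algebra k (RingQuot (FRTRel R)))

/-- The canonical projection from the free algebra. -/
def proj : FreeAlgebra k (Fin n × Fin n) →ₐ[k] FRT R := RingQuot.mkAlgHom k (FRTRel R)

/-- The standard generators: `T R i j` is `T_i^j`. -/
def T (i j : Fin n) : FRT R := proj R (FreeAlgebra.ι k (i, j))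

theorem rel (i j a b : Fin n) :
    ∑ u, ∑ v, R j i u v • (T R u a * T R v b) = ∑ u, ∑ v, R v u a b • (T R i u * T R j v) := by
  have h := RingQuot.mkAlgHom_rel k (FRTRel.mk (R := R) i j a b)
  change proj R _ = proj R _ at h
  simpa [map_sum, map_smul, map_mul, T] using h

/-- Algebra maps out of `A(R)` are given by matrices satisfying the defining relations. -/
def lift {B : Type*} [Ring B] [Algebra k B] (t : Fin n → Fin n → B)
    (ht : ∀ i j a b, ∑ u, ∑ v, R j i u v • (t u a * t v b)
      = ∑ u, ∑ v, R v u a b • (t i u * t j v)) : FRT R →ₐ[k] B :=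
  RingQuot.liftAlgHom k ⟨FreeAlgebra.lift k (fun x : Fin n × Fin n => t x.1 x.2), by
    rintro _ _ ⟨i, j, a, b⟩
    simpa [map_sum, map_smul, map_mul] using ht i j a b⟩

@[simp] theorem lift_T {B : Type*} [Ring B] [Algebra k B] (t : Fin n → Fin n → B)
    (ht : ∀ i j a b, ∑ u, ∑ v, R j i u v • (t u a * t v b)
      = ∑ u, ∑ v, R v u a b • (t i u * t j v)) (i j : Fin n) :
    lift R t ht (T R i j) = t i j := by
  have h := RingQuot.liftAlgHom_mkAlgHom_apply k
    (FreeAlgebra.lift k (fun x : Fin n × Fin n => t x.1 x.2)) (s := FRTRel R) (by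
      rintro _ _ ⟨i, j, a, b⟩
      simpa [map_sum, map_smul, map_mul] using ht i j a b) (FreeAlgebra.ι k (i, j))
  rw [FreeAlgebra.lift_ι_apply] at h
  exact h

variable {R} in
theorem hom_ext {B : Type*} [Semiring B] [Algebra k B] {f g : FRT R →ₐ[k] B}
    (h : ∀ i j, f (T R i j) = g (T R i j)) : f = g := by
  refine RingQuot.ringQuot_ext' k f g ?_
  refine FreeAlgebra.hom_ext ?_
  funext x
  exact h x.1 x.2

theorem sum_swap₄ {M : Type*} [AddCommMonoid M] (f : Fin n → Fin n → Fin n → Fin n → M) :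
    ∑ u, ∑ v, ∑ c, ∑ d, f u v c d = ∑ c, ∑ d, ∑ u, ∑ v, f u v c d := by
  have h : ∑ x : Fin n × Fin n, ∑ y : Fin n × Fin n, f x.1 x.2 y.1 y.2
      = ∑ y : Fin n × Fin n, ∑ x : Fin n × Fin n, f x.1 x.2 y.1 y.2 := Finset.sum_comm
  simpa only [Fintype.sum_prod_type] using h

/-- The comultiplication `Δ(T_i^j) = ∑ T_i^u ⊗ T_u^j`. -/
def comulHom : FRT R →ₐ[k] FRT R ⊗[k] FRT R :=
  lift R (fun i j => ∑ u, T R i u ⊗ₜ[k] T R u j) (by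
    intro i j a b
    have h1 : ∀ u v, (∑ c, T R u c ⊗ₜ[k] T R c a) * (∑ d, T R v d ⊗ₜ[k] T R d b)
        = ∑ c, ∑ d, (T R u c * T R v d) ⊗ₜ[k] (T R c a * T R d b) := by
      intro u v
      simp only [Finset.sum_mul_sum, Algebra.TensorProduct.tmul_mul_tmul]
    have h2 : ∀ u v, (∑ c, T R i c ⊗ₜ[k] T R c u) * (∑ d, T R j d ⊗ₜ[k] T R d v)
        = ∑ c, ∑ d, (T R i c * T R j d) ⊗ₜ[k] (T R c u * T R d v) := by
      intro u v
      simp only [Finset.sum_mul_sum, Algebra.TensorProduct.tmul_mul_tmul]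
    simp only [h1, h2, Finset.smul_sum]
    calc ∑ u, ∑ v, ∑ c, ∑ d, R j i u v • ((T R u c * T R v d) ⊗ₜ[k] (T R c a * T R d b))
        = ∑ c, ∑ d, (∑ u, ∑ v, R j i u v • (T R u c * T R v d)) ⊗ₜ[k]
            (T R c a * T R d b) := by
          simp only [TensorProduct.sum_tmul, TensorProduct.smul_tmul']
          exact sum_swap₄ _
      _ = ∑ c, ∑ d, (∑ u, ∑ v, R v u c d • (T R i u * T R j v)) ⊗ₜ[k]
            (T R c a * T R d b) := by
          simp only [rel]
      _ = ∑ u, ∑ v, (T R i u * T R j v) ⊗ₜ[k]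
            (∑ c, ∑ d, R v u c d • (T R c a * T R d b)) := by
          simp only [TensorProduct.sum_tmul, TensorProduct.tmul_sum, TensorProduct.tmul_smul,
            TensorProduct.smul_tmul']
          exact sum_swap₄ _
      _ = ∑ u, ∑ v, (T R i u * T R j v) ⊗ₜ[k]
            (∑ c, ∑ d, R d c a b • (T R u c * T R v d)) := by
          simp only [rel]
      _ = _ := by
          simp only [TensorProduct.tmul_sum, TensorProduct.tmul_smul]
          exact sum_swap₄ _)

/-- The counit `ε(T_i^j) = δ_{ij}`. -/
def counitHom : FRT R →ₐ[k] k :=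
  lift R (fun i j => if i = j then 1 else 0) (by
    intro i j a b
    simp)

instance : Bialgebra k (FRT R) :=
  Bialgebra.ofAlgHom (comulHom R) (counitHom R)
    (by
      refine hom_ext fun i j => ?_
      simp only [AlgHom.comp_apply, comulHom, lift_T, map_sum, Algebra.TensorProduct.map_tmul,
        TensorProduct.sum_tmul, TensorProduct.tmul_sum, AlgHom.id_apply]
      exact Finset.sum_comm)
    (by
      refine hom_ext fun i j => ?_
      simp [comulHom, counitHom, TensorProduct.ite_tmul, Finset.sum_ite_eq])
    (by
      refine hom_ext fun i j => ?_
      simp [comulHom, counitHom, TensorProduct.tmul_ite])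

@[simp] theorem comul_T (i j : Fin n) :
    Coalgebra.comul (R := k) (T R i j) = ∑ u, T R i u ⊗ₜ[k] T R u j :=
  lift_T R _ _ i j

@[simp] theorem counit_T (i j : Fin n) :
    Coalgebra.counit (R := k) (T R i j) = if i = j then 1 else 0 :=
  lift_T R _ _ i j

end FRT

/-! ### The Cremmer-Gervais `R`-matrix, the quantum determinant and the quantum groups -/

/-- The entries `R_{ij}^{kl}` (written `cremmerGervais n q p i j k l`) of the two-parameter
Cremmer-Gervais `R`-matrix. Only comparisons and differences of indices occur, so that counting the
indices from `0` instead of `1` makes no difference. -/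
def cremmerGervais (n : ℕ) (q p : ℂ) (i j k l : Fin n) : ℂ :=
  if (i : ℕ) + j = k + l then
    p⁻¹ * p ^ (2 * ((l : ℤ) - (i : ℤ))) *
      (if i = k then (if j ≤ i then q else q⁻¹)
        else if j ≤ k ∧ k < i then q - q⁻¹
        else if i < k ∧ k < j then q⁻¹ - q
        else 0)
  else 0

/-- The braided bialgebra `A(R)` for the Cremmer-Gervais `R`-matrix `R = R_n(q,p)`. -/
abbrev CGA (n : ℕ) (q p : ℂ) : Type := FRT (cremmerGervais n q p)

/-- The generator `T_i^j` of `A(R)`. -/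
abbrev cgT (n : ℕ) (q p : ℂ) (i j : Fin n) : CGA n q p := FRT.T (cremmerGervais n q p) i j

/-- The relations `q⁻¹ x_j x_i + p ∑ R_{ij}^{kl} x_k x_l = 0` and `x_i² = 0` of the exterior algebra
`Λ(R)`. The second family follows from the first one (with `i = j`) unless `q² = -1`. -/
inductive CGExtRel (n : ℕ) (q p : ℂ) : FreeAlgebra ℂ (Fin n) → FreeAlgebra ℂ (Fin n) → Prop
  | quad (i j : Fin n) : CGExtRel n q p
      (q⁻¹ • (FreeAlgebra.ι ℂ j * FreeAlgebra.ι ℂ i)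
        + p • ∑ k, ∑ l, cremmerGervais n q p i j k l • (FreeAlgebra.ι ℂ k * FreeAlgebra.ι ℂ l)) 0
  | sq (i : Fin n) : CGExtRel n q p (FreeAlgebra.ι ℂ i * FreeAlgebra.ι ℂ i) 0

/-- The exterior algebra `Λ(R)`. -/
abbrev CGExt (n : ℕ) (q p : ℂ) : Type := RingQuot (CGExtRel n q p)

/-- The generators `x_i` of `Λ(R)`. -/
def cgX (n : ℕ) (q p : ℂ) (i : Fin n) : CGExt n q p :=
  RingQuot.mkAlgHom ℂ (CGExtRel n q p) (FreeAlgebra.ι ℂ i)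

/-- The top form `x_1 ⋯ x_n` of `Λ(R)`. -/
def cgTop (n : ℕ) (q p : ℂ) : CGExt n q p := (List.ofFn (cgX n q p)).prod

/-- The scalar `a_σ = ∏ (-p^{2(σ(i) - σ(j))})`, over all pairs `i < j` with `σ(j) < σ(i)`.
In `Λ(R)` one has `x_l x_k = -p^{2(l - k)} x_k x_l` for `k < l`, so that
`x_{σ(1)} ⋯ x_{σ(n)} = a_σ x_1 ⋯ x_n`. -/
def cgCoeff {n : ℕ} (p : ℂ) (σ : Equiv.Perm (Fin n)) : ℂ :=
  ∏ i, ∏ j, if i < j ∧ σ j < σ i then -p ^ (2 * ((σ i : ℕ) - (σ j : ℕ))) else 1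

/-- The quantum determinant `det_q = ∑_σ a_σ T_1^{σ(1)} ⋯ T_n^{σ(n)}` in `A(R)`. -/
def cgDet (n : ℕ) (q p : ℂ) : CGA n q p :=
  ∑ σ : Equiv.Perm (Fin n), cgCoeff p σ • (List.ofFn fun i => cgT n q p i (σ i)).prod

/-- The ring `ℂ_R[GL(n)] = A(R)[det_q⁻¹]`, the Ore localization of `A(R)` at the powers of `det_q`.
(Its `ℂ`-algebra structure is the only one for which `cgToGL` is `ℂ`-linear.) -/
def CGGL (n : ℕ) (q p : ℂ) [OreLocalization.OreSet (Submonoid.powers (cgDet n q p))] : Type :=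
  OreLocalization (Submonoid.powers (cgDet n q p)) (CGA n q p)

instance (n : ℕ) (q p : ℂ) [OreLocalization.OreSet (Submonoid.powers (cgDet n q p))] :
    Ring (CGGL n q p) :=
  inferInstanceAs (Ring (OreLocalization (Submonoid.powers (cgDet n q p)) (CGA n q p)))

/-- The natural map `A(R) → ℂ_R[GL(n)]`. -/
def cgToGL (n : ℕ) (q p : ℂ) [OreLocalization.OreSet (Submonoid.powers (cgDet n q p))] :
    CGA n q p →+* CGGL n q p :=
  OreLocalization.numeratorRingHom (S := Submonoid.powers (cgDet n q p))

/-- The ring `ℂ_R[SL(n)] = A(R) / (det_q - 1)`.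
(Its `ℂ`-algebra structure is the only one for which `cgToSL` is `ℂ`-linear.) -/
def CGSL (n : ℕ) (q p : ℂ) : Type :=
  CGA n q p ⧸ (TwoSidedIdeal.span {cgDet n q p - 1}).asIdeal

instance (n : ℕ) (q p : ℂ) : Ring (CGSL n q p) :=
  inferInstanceAs (Ring (CGA n q p ⧸ (TwoSidedIdeal.span {cgDet n q p - 1}).asIdeal))

/-- The natural map `A(R) → ℂ_R[SL(n)]`. -/
def cgToSL (n : ℕ) (q p : ℂ) : CGA n q p →+* CGSL n q p :=
  Ideal.Quotient.mk (TwoSidedIdeal.span {cgDet n q p - 1}).asIdeal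

end

open scoped TensorProduct

noncomputable section


/-! The matrix `R` becomes transparent on polynomials. If `e_k ⊗ e_l` is read as `z^k w^l`, then for
`p = 1` the sum `∑ R_{ij}^{kl} z^k w^l` is a combination, with coefficients rational in `z` and `w`,
of `z^i w^j` and its swap `w^i z^j` (`sum_cgCore_mul_pow'`). The Yang-Baxter and Hecke relations
turn into rational identities tested at distinct points (`cgCore_yangBaxter`, `cgCore_hecke`), and a
general `p` only multiplies all non-zero terms of such an identity by one common power.

The Yang-Baxter equation, used twice, yields the representation `FRT.rep` of `A(R)` and then the
pairing `FRT.pairing`. The axioms are phrased as equalities of algebra maps into convolution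
algebras, or as intertwining relations there, so that they only need checking on generators and
later pass to inverses. Convolution invertibility of the pairing is obtained only at the end.

The relations of `Λ(R)` amount to two-term twisted anticommutation, by induction on the distance of
the indices (`twistedAnticomm_of_quadExpr`). A Fock representation shows that the top form is
non-zero, the coaction multiplies it by `det_q`, and coassociativity makes `det_q` group-like.
Multiplying the letters of the top form in order of their distance from a given index makes the
evaluation of the pairing on `det_q` triangular. The result is diagonal, with entries powers of `κ =
q p^{-n}` (`rep_cgDet`, `corep_cgDet`). The commutation relation of the pairing then shows that
`det_q` commutes with `A(R)` up to an automorphism, which gives the Ore condition.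

The Hecke relation provides skew derivations of `Λ(R)`. Their compatibility with the coaction gives
a cofactor matrix `N` with `N T = T N = D det_q`, where `D` is an invertible diagonal matrix of
scalars (`exists_cofactor`). Hence `T` is invertible as soon as `det_q` is.

The localization and the quotient are treated together as instances of `DetExtension`. The coproduct
extends because `det_q` is group-like, and the antipode is built from `T⁻¹`. The pairing extends one
variable at a time because `⟨· | det_q⟩` and `⟨det_q | ·⟩` are convolution invertible; for the
quotient both must equal the counit, which holds when `κ = 1`, that is `p^n = q`. On a Hopf algebra
the antipode supplies the convolution inverse of the pairing, and restricting it from the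
localization supplies the one on `A(R)`. Finally `(det_q - 1)` is the kernel of a surjective Hopf
algebra map that preserves the forms, hence a braided Hopf ideal. -/

/-! ### The Yang-Baxter and Hecke relations -/

/-- The Cremmer-Gervais matrix for `p = 1`. -/
def cgCore (q : ℂ) (i j k l : ℕ) : ℂ :=
  if i + j = k + l then
    if i = k then (if j ≤ i then q else q⁻¹)
      else if j ≤ k ∧ k < i then q - q⁻¹
      else if i < k ∧ k < j then q⁻¹ - q
      else 0
  else 0

theorem cremmerGervais_eq (n : ℕ) (q p : ℂ) (i j k l : Fin n) :
    cremmerGervais n q p i j k l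
      = p⁻¹ * p ^ (2 * ((l : ℤ) - (i : ℤ))) * cgCore q i j k l := by
  unfold cremmerGervais cgCore
  by_cases h : (i : ℕ) + j = k + l
  · simp only [h, if_true, Fin.ext_iff, Fin.le_def, Fin.lt_def]
  · simp [h]

theorem cgCore_of_ne {q : ℂ} {i j k l : ℕ} (h : i + j ≠ k + l) : cgCore q i j k l = 0 := if_neg h

theorem cremmerGervais_of_ne {n : ℕ} {q p : ℂ} {i j k l : Fin n} (h : (i : ℕ) + j ≠ k + l) :
    cremmerGervais n q p i j k l = 0 := if_neg h

/-- For fixed `k` only one `l` can contribute. What remains is a diagonal term plus signed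
indicators of intervals of `k`, a shape suited to geometric sums. -/
theorem cgCore_eq_ite (q : ℂ) (i j k l : ℕ) :
    cgCore q i j k l = (if l = i + j - k ∧ k ≤ i + j then
      (if k = i then (if j ≤ i then q else q⁻¹) else 0)
        + (q - q⁻¹) * ((if j ≤ k ∧ k < i then 1 else 0) - (if i < k ∧ k < j then 1 else 0))
      else 0) := by
  unfold cgCore
  by_cases h : i + j = k + l
  · rw [if_pos h, if_pos (show l = i + j - k ∧ k ≤ i + j by omega)]
    by_cases h1 : i = k
    · subst h1; simp
    · rw [if_neg h1, if_neg (Ne.symm h1)]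
      by_cases h2 : j ≤ k ∧ k < i
      · rw [if_pos h2, if_pos h2, if_neg (by omega)]; ring
      · rw [if_neg h2, if_neg h2]
        by_cases h3 : i < k ∧ k < j
        · rw [if_pos h3, if_pos h3]; ring
        · rw [if_neg h3, if_neg h3]; ring
  · rw [if_neg h, if_neg (show ¬ (l = i + j - k ∧ k ≤ i + j) by omega)]

/-- Telescoping: `(z - w) z^k w^(s-k)` is the difference of two consecutive terms `z^k w^(s+1-k)`.
-/
theorem sum_Ico_mul_pow_sub {s a b : ℕ} (hab : a ≤ b) (hb : b ≤ s + 1) (z w : ℂ) :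
    (z - w) * ∑ k ∈ Finset.Ico a b, z ^ k * w ^ (s - k)
      = z ^ b * w ^ (s + 1 - b) - z ^ a * w ^ (s + 1 - a) := by
  induction b, hab using Nat.le_induction with
  | base => simp
  | succ b hab ih =>
    rw [Finset.sum_Ico_succ_top hab, mul_add, ih (by omega)]
    obtain ⟨c, rfl⟩ : ∃ c, s = b + c := ⟨s - b, by omega⟩
    rw [show b + c + 1 - b = c + 1 by omega, show b + c - b = c by omega,
      show b + c + 1 - (b + 1) = c by omega]
    ring

/-- The off-diagonal entries in a row of `R` are constant on an interval, so their generating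
function is a geometric sum. This exhibits `R` as a divided-difference operator; the factor `z - w`
clears the denominator. -/
theorem sum_cgCore_mul_pow {n : ℕ} (q z w : ℂ) (i j : Fin n) :
    (z - w) * ∑ k : Fin n, ∑ l : Fin n, cgCore q i j k l * (z ^ (k : ℕ) * w ^ (l : ℕ))
      = (q * z - q⁻¹ * w) * (z ^ (i : ℕ) * w ^ (j : ℕ))
        - (q - q⁻¹) * w * (w ^ (i : ℕ) * z ^ (j : ℕ)) := by
  obtain ⟨i, hi⟩ := i
  obtain ⟨j, hj⟩ := j
  simp only
  have h1 : ∀ k : Fin n, ∑ l : Fin n, cgCore q i j k l * (z ^ (k : ℕ) * w ^ (l : ℕ))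
      = (if (k : ℕ) = i then (if j ≤ i then q else q⁻¹) else 0) * (z ^ i * w ^ j)
        + (q - q⁻¹) * ((if j ≤ (k : ℕ) ∧ (k : ℕ) < i then 1 else 0)
          - (if i < (k : ℕ) ∧ (k : ℕ) < j then 1 else 0)) * (z ^ (k : ℕ) * w ^ (i + j - k)) := by
    intro k
    by_cases hk : (k : ℕ) ≤ i + j ∧ i + j - k < n
    · rw [Finset.sum_eq_single ⟨i + j - k, hk.2⟩]
      · rw [cgCore_eq_ite, if_pos ⟨rfl, hk.1⟩]
        by_cases h : (k : ℕ) = i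
        · simp [h]
        · simp [h]
      · intro l _ hl
        rw [cgCore_of_ne, zero_mul]
        intro h
        exact hl (Fin.ext (by simp only; omega))
      · simp
    · have hl : ∀ l : Fin n, i + j ≠ k + l := fun l h => hk ⟨by omega, by omega⟩
      rw [Finset.sum_eq_zero fun l _ => by rw [cgCore_of_ne (hl l), zero_mul]]
      rw [if_neg (by omega), if_neg (by omega), if_neg (by omega)]
      simp
  simp only [h1, Finset.sum_add_distrib, ← Finset.sum_mul]
  rw [Fin.sum_univ_eq_sum_range (fun k => if k = i then (if j ≤ i then q else q⁻¹) else 0),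
    Fin.sum_univ_eq_sum_range (fun k => (q - q⁻¹) * ((if j ≤ k ∧ k < i then 1 else 0)
          - (if i < k ∧ k < j then 1 else 0)) * (z ^ k * w ^ (i + j - k))),
    Finset.sum_ite_eq' (Finset.range n), if_pos (Finset.mem_range.2 hi)]
  rcases le_or_gt j i with hji | hij
  · have h2 : ∑ k ∈ Finset.range n, (q - q⁻¹) * ((if j ≤ k ∧ k < i then 1 else 0)
          - (if i < k ∧ k < j then 1 else 0)) * (z ^ k * w ^ (i + j - k))
        = (q - q⁻¹) * ∑ k ∈ Finset.Ico j i, z ^ k * w ^ (i + j - k) := by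
      rw [Finset.mul_sum, ← Finset.sum_subset (s₁ := Finset.Ico j i)]
      · refine Finset.sum_congr rfl fun k hk => ?_
        rw [Finset.mem_Ico] at hk
        rw [if_pos hk, if_neg (by omega)]; ring
      · intro k hk
        rw [Finset.mem_Ico] at hk
        exact Finset.mem_range.2 (by omega)
      · intro k _ hk
        rw [Finset.mem_Ico] at hk
        rw [if_neg hk, if_neg (by omega)]; ring
    have h3 := sum_Ico_mul_pow_sub (s := i + j) hji (by omega) z w
    rw [h2, if_pos hji, mul_add, mul_left_comm (z - w) (q - q⁻¹), h3,
      show i + j + 1 - i = j + 1 by omega, show i + j + 1 - j = i + 1 by omega]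
    ring
  · have h2 : ∑ k ∈ Finset.range n, (q - q⁻¹) * ((if j ≤ k ∧ k < i then 1 else 0)
          - (if i < k ∧ k < j then 1 else 0)) * (z ^ k * w ^ (i + j - k))
        = -(q - q⁻¹) * ∑ k ∈ Finset.Ico (i + 1) j, z ^ k * w ^ (i + j - k) := by
      rw [Finset.mul_sum, ← Finset.sum_subset (s₁ := Finset.Ico (i + 1) j)]
      · refine Finset.sum_congr rfl fun k hk => ?_
        rw [Finset.mem_Ico] at hk
        rw [if_pos (show i < k ∧ k < j by omega), if_neg (by omega)]; ring
      · intro k hk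
        rw [Finset.mem_Ico] at hk
        exact Finset.mem_range.2 (by omega)
      · intro k _ hk
        rw [Finset.mem_Ico] at hk
        rw [if_neg (by omega), if_neg (by omega)]; ring
    have h3 := sum_Ico_mul_pow_sub (s := i + j) (show i + 1 ≤ j by omega) (by omega) z w
    rw [h2, if_neg (by omega), mul_add, mul_left_comm (z - w) (-(q - q⁻¹)), h3,
      show i + j + 1 - j = i + 1 by omega, show i + j + 1 - (i + 1) = j by omega]
    ring

/-- A polynomial that vanishes off a finite set has infinitely many roots. The exceptional set
leaves room for the points at which denominators such as `z - w` vanish. -/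
theorem coeff_eq_zero_of_sum_mul_pow {n : ℕ} (c : Fin n → ℂ) (s : Set ℂ) (hs : s.Finite)
    (h : ∀ z ∉ s, ∑ a, c a * z ^ (a : ℕ) = 0) : c = 0 := by
  set P : Polynomial ℂ := ∑ a : Fin n, Polynomial.monomial (a : ℕ) (c a) with hP
  have h0 : P = 0 := by
    refine Polynomial.eq_zero_of_infinite_isRoot P ?_
    refine hs.infinite_compl.mono fun z hz => ?_
    simpa [hP, Polynomial.IsRoot.def, Polynomial.eval_finsetSum] using h z hz
  funext a
  have := congrArg (fun Q => Polynomial.coeff Q (a : ℕ)) h0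
  simpa [hP, Polynomial.finsetSum_coeff, Polynomial.coeff_monomial, Fin.val_inj] using this

theorem eq_of_sum_mul_pow₂ {n : ℕ} (c d : Fin n → Fin n → ℂ)
    (h : ∀ z w : ℂ, z ≠ w → ∑ a, ∑ b, c a b * (z ^ (a : ℕ) * w ^ (b : ℕ))
      = ∑ a, ∑ b, d a b * (z ^ (a : ℕ) * w ^ (b : ℕ))) : c = d := by
  rw [← sub_eq_zero]
  funext a b
  have h1 : ∀ w : ℂ, (fun a => ∑ b, (c a b - d a b) * w ^ (b : ℕ)) = 0 := by
    intro w
    refine coeff_eq_zero_of_sum_mul_pow _ {w} (Set.finite_singleton w) fun z hz => ?_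
    have := sub_eq_zero.2 (h z w hz)
    rw [← this]
    simp only [← Finset.sum_sub_distrib, Finset.sum_mul]
    exact Finset.sum_congr rfl fun a _ => Finset.sum_congr rfl fun b _ => by ring
  exact congrFun (coeff_eq_zero_of_sum_mul_pow _ ∅ Set.finite_empty
    fun w _ => congrFun (h1 w) a) b

theorem eq_of_sum_mul_pow₃ {n : ℕ} (c d : Fin n → Fin n → Fin n → ℂ)
    (h : ∀ x y z : ℂ, x ≠ y → x ≠ z → y ≠ z →
      ∑ i, ∑ j, ∑ k, c i j k * (x ^ (i : ℕ) * (y ^ (j : ℕ) * z ^ (k : ℕ)))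
      = ∑ i, ∑ j, ∑ k, d i j k * (x ^ (i : ℕ) * (y ^ (j : ℕ) * z ^ (k : ℕ)))) : c = d := by
  funext i
  refine eq_of_sum_mul_pow₂ _ _ fun y z hyz => ?_
  rw [← sub_eq_zero]
  refine congrFun (coeff_eq_zero_of_sum_mul_pow (fun i =>
    ∑ j, ∑ k, c i j k * (y ^ (j : ℕ) * z ^ (k : ℕ))
      - ∑ j, ∑ k, d i j k * (y ^ (j : ℕ) * z ^ (k : ℕ))) {y, z} (by simp) fun x hx => ?_) i
  simp only [Set.mem_insert_iff, Set.mem_singleton_iff, not_or] at hx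
  have := sub_eq_zero.2 (h x y z hx.1 hx.2 hyz)
  rw [← this]
  simp only [← Finset.sum_sub_distrib, Finset.sum_mul]
  exact Finset.sum_congr rfl fun a _ => Finset.sum_congr rfl fun b _ =>
    Finset.sum_congr rfl fun c _ => by ring

/-- The value of `R(z^i w^j)` as a function, for `p = 1`. -/
theorem sum_cgCore_mul_pow' {n : ℕ} (q : ℂ) {z w : ℂ} (h : z ≠ w) (i j : Fin n) :
    ∑ k : Fin n, ∑ l : Fin n, cgCore q i j k l * (z ^ (k : ℕ) * w ^ (l : ℕ))
      = (q * z - q⁻¹ * w) / (z - w) * (z ^ (i : ℕ) * w ^ (j : ℕ))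
        + -((q - q⁻¹) * w) / (z - w) * (w ^ (i : ℕ) * z ^ (j : ℕ)) := by
  have h' : z - w ≠ 0 := sub_ne_zero.2 h
  refine mul_left_cancel₀ h' ?_
  rw [sum_cgCore_mul_pow]
  field_simp
  ring

theorem sum_swap₆ {ι M : Type*} [Fintype ι] [AddCommMonoid M] (f : ι → ι → ι → ι → ι → ι → M) :
    ∑ a, ∑ b, ∑ c, ∑ u, ∑ v, ∑ w, f a b c u v w = ∑ u, ∑ v, ∑ w, ∑ a, ∑ b, ∑ c, f a b c u v w := by
  have h : ∑ x : ι × ι × ι, ∑ y : ι × ι × ι, f x.1 x.2.1 x.2.2 y.1 y.2.1 y.2.2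
      = ∑ y : ι × ι × ι, ∑ x : ι × ι × ι, f x.1 x.2.1 x.2.2 y.1 y.2.1 y.2.2 := Finset.sum_comm
  simpa only [Fintype.sum_prod_type] using h

/-- Both sides are compared through their generating functions in three pairwise distinct variables.
Each factor `R` is then evaluated by its two-term formula, which leaves an identity of rational
functions. -/
theorem cgCore_yangBaxter {n : ℕ} {q : ℂ} (hq : q ≠ 0) (i j k a b c : Fin n) :
    ∑ u : Fin n, ∑ v : Fin n, ∑ w : Fin n,
        cgCore q i j u v * cgCore q u k a w * cgCore q v w b c
      = ∑ u : Fin n, ∑ v : Fin n, ∑ w : Fin n,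
        cgCore q j k v w * cgCore q i w u c * cgCore q u v a b := by
  refine congrFun (congrFun (congrFun (eq_of_sum_mul_pow₃
    (fun a b c : Fin n => ∑ u : Fin n, ∑ v : Fin n, ∑ w : Fin n,
        cgCore q i j u v * cgCore q u k a w * cgCore q v w b c)
    (fun a b c : Fin n => ∑ u : Fin n, ∑ v : Fin n, ∑ w : Fin n,
        cgCore q j k v w * cgCore q i w u c * cgCore q u v a b) fun x y z hxy hxz hyz => ?_) a) b) c
  simp only [Finset.sum_mul]
  conv_lhs => rw [sum_swap₆]
  conv_rhs => rw [sum_swap₆]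
  -- `E` is the generating function of a row of `R`, and `A`, `B` are the coefficients in its
  -- two-term value. The sums are removed from the inside outwards on both sides, until they meet in
  -- the middle of the chain at an identity decided by `field_simp` and `ring`.
  set E : Fin n → Fin n → ℂ → ℂ → ℂ := fun i j z w =>
    ∑ k : Fin n, ∑ l : Fin n, cgCore q i j k l * (z ^ (k : ℕ) * w ^ (l : ℕ)) with hE
  set A : ℂ → ℂ → ℂ := fun z w => (q * z - q⁻¹ * w) / (z - w) with hA
  set B : ℂ → ℂ → ℂ := fun z w => -((q - q⁻¹) * w) / (z - w) with hB
  have hval : ∀ (i j : Fin n) (z w : ℂ), z ≠ w →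
      E i j z w = A z w * (z ^ (i : ℕ) * w ^ (j : ℕ)) + B z w * (w ^ (i : ℕ) * z ^ (j : ℕ)) :=
    fun i j z w h => sum_cgCore_mul_pow' q h i j
  calc _ = ∑ u : Fin n, ∑ v : Fin n, cgCore q i j u v * ∑ a : Fin n, ∑ w : Fin n,
            cgCore q u k a w * (x ^ (a : ℕ) * E v w y z) := by
          simp only [hE, Finset.mul_sum]
          refine Finset.sum_congr rfl fun u _ => Finset.sum_congr rfl fun v _ => ?_
          rw [Finset.sum_comm]
          exact Finset.sum_congr rfl fun a _ => Finset.sum_congr rfl fun w _ =>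
            Finset.sum_congr rfl fun b _ => Finset.sum_congr rfl fun c _ => by ring
    _ = ∑ u : Fin n, ∑ v : Fin n, cgCore q i j u v * (A y z * y ^ (v : ℕ) * E u k x z
          + B y z * z ^ (v : ℕ) * E u k x y) := by
          refine Finset.sum_congr rfl fun u _ => Finset.sum_congr rfl fun v _ => ?_
          simp only [hval _ _ y z hyz]
          simp only [hE, Finset.mul_sum, ← Finset.sum_add_distrib]
          exact Finset.sum_congr rfl fun a _ => Finset.sum_congr rfl fun w _ => by ring
    _ = A y z * A x z * z ^ (k : ℕ) * E i j x y + A y z * B x z * x ^ (k : ℕ) * E i j z y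
          + B y z * A x y * y ^ (k : ℕ) * E i j x z + B y z * B x y * x ^ (k : ℕ) * E i j y z := by
          simp only [hval _ k x z hxz, hval _ k x y hxy]
          simp only [hE, Finset.mul_sum, ← Finset.sum_add_distrib]
          exact Finset.sum_congr rfl fun a _ => Finset.sum_congr rfl fun w _ => by ring
    _ = A x y * A x z * x ^ (i : ℕ) * E j k y z + A x y * B x z * z ^ (i : ℕ) * E j k y x
          + B x y * A y z * y ^ (i : ℕ) * E j k x z + B x y * B y z * z ^ (i : ℕ) * E j k x y := by
          rw [hval _ _ _ _ hxy, hval _ _ _ _ hyz.symm, hval _ _ _ _ hxz, hval _ _ _ _ hyz,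
            hval _ _ _ _ hyz, hval _ _ _ _ hxy.symm, hval _ _ _ _ hxz, hval _ _ _ _ hxy]
          have h1 : x - y ≠ 0 := sub_ne_zero.2 hxy
          have h2 : x - z ≠ 0 := sub_ne_zero.2 hxz
          have h3 : y - z ≠ 0 := sub_ne_zero.2 hyz
          have h1' : y - x ≠ 0 := sub_ne_zero.2 hxy.symm
          have h3' : z - y ≠ 0 := sub_ne_zero.2 hyz.symm
          simp only [hA, hB]
          rw [← neg_sub x y, ← neg_sub y z] 
          generalize x ^ (i : ℕ) = xi, y ^ (i : ℕ) = yi, z ^ (i : ℕ) = zi,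
            x ^ (j : ℕ) = xj, y ^ (j : ℕ) = yj, z ^ (j : ℕ) = zj,
            x ^ (k : ℕ) = xk, y ^ (k : ℕ) = yk, z ^ (k : ℕ) = zk
          field_simp
          ring
    _ = ∑ v : Fin n, ∑ w : Fin n, cgCore q j k v w * (A x y * y ^ (v : ℕ) * E i w x z
          + B x y * x ^ (v : ℕ) * E i w y z) := by
          simp only [hval i _ x z hxz, hval i _ y z hyz]
          simp only [hE, Finset.mul_sum, ← Finset.sum_add_distrib]
          exact Finset.sum_congr rfl fun a _ => Finset.sum_congr rfl fun w _ => by ring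
    _ = ∑ v : Fin n, ∑ w : Fin n, cgCore q j k v w * ∑ u : Fin n, ∑ c : Fin n,
            cgCore q i w u c * (z ^ (c : ℕ) * E u v x y) := by
          refine Finset.sum_congr rfl fun u _ => Finset.sum_congr rfl fun v _ => ?_
          simp only [hval _ _ x y hxy]
          simp only [hE, Finset.mul_sum, ← Finset.sum_add_distrib]
          exact Finset.sum_congr rfl fun a _ => Finset.sum_congr rfl fun w _ => by ring
    _ = _ := by
          simp only [hE, Finset.mul_sum]
          conv_rhs => rw [Finset.sum_comm]
          refine Finset.sum_congr rfl fun v _ => ?_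
          conv_rhs => rw [Finset.sum_comm]
          refine Finset.sum_congr rfl fun w _ => Finset.sum_congr rfl fun u _ => ?_
          rw [Finset.sum_comm]
          refine Finset.sum_congr rfl fun a _ => ?_
          rw [Finset.sum_comm]
          exact Finset.sum_congr rfl fun b _ => Finset.sum_congr rfl fun c _ => by ring

/-- This is the quadratic relation of the braid operator `R` followed by the flip, whence the
swapped lower indices of the second factor. On generating functions it follows from applying the
two-term formula at `(z, w)` and at `(w, z)`. -/
theorem cgCore_hecke {n : ℕ} {q : ℂ} (hq : q ≠ 0) (i j a m : Fin n) :
    ∑ k : Fin n, ∑ l : Fin n, cgCore q i j k l * cgCore q l k a m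
      = (q - q⁻¹) * cgCore q i j a m + if a = j ∧ m = i then 1 else 0 := by
  refine congrFun (congrFun (eq_of_sum_mul_pow₂
    (fun a m : Fin n => ∑ k : Fin n, ∑ l : Fin n, cgCore q i j k l * cgCore q l k a m)
    (fun a m : Fin n => (q - q⁻¹) * cgCore q i j a m + if a = j ∧ m = i then 1 else 0)
    fun z w h => ?_) a) m
  have h2 : w ≠ z := h.symm
  simp only [Finset.sum_mul, add_mul, Finset.sum_add_distrib, mul_assoc, ← Finset.mul_sum]
  rw [FRT.sum_swap₄]
  simp only [← Finset.mul_sum, sum_cgCore_mul_pow' q h]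
  have h3 : ∑ a : Fin n, ∑ m : Fin n, (if a = j ∧ m = i then (1 : ℂ) else 0)
      * (z ^ (a : ℕ) * w ^ (m : ℕ)) = z ^ (j : ℕ) * w ^ (i : ℕ) := by
    simp [ite_and]
  rw [h3]
  have h4 : ∀ k l : Fin n, cgCore q i j k l * ((q * z - q⁻¹ * w) / (z - w)
        * (z ^ (l : ℕ) * w ^ (k : ℕ)) + -((q - q⁻¹) * w) / (z - w) * (w ^ (l : ℕ) * z ^ (k : ℕ)))
      = (q * z - q⁻¹ * w) / (z - w) * (cgCore q i j k l * (w ^ (k : ℕ) * z ^ (l : ℕ)))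
        + -((q - q⁻¹) * w) / (z - w) * (cgCore q i j k l * (z ^ (k : ℕ) * w ^ (l : ℕ))) := by
    intro k l; ring
  simp only [h4, Finset.sum_add_distrib, ← Finset.mul_sum, sum_cgCore_mul_pow' q h,
    sum_cgCore_mul_pow' q h2]
  have h1 : z - w ≠ 0 := sub_ne_zero.2 h
  rw [← neg_sub z w]
  generalize z ^ (i : ℕ) = zi, w ^ (i : ℕ) = wi, z ^ (j : ℕ) = zj, w ^ (j : ℕ) = wj
  field_simp
  ring

/-- Because `R` preserves the sum of the indices, every non-zero term on either side carries the
same power of `p`, depending only on the outer indices. If the outer index sums differ, all terms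
vanish. -/
theorem cremmerGervais_yangBaxter {n : ℕ} {q p : ℂ} (hq : q ≠ 0) (hp : p ≠ 0)
    (i j k a b c : Fin n) :
    ∑ u, ∑ v, ∑ w, cremmerGervais n q p i j u v * cremmerGervais n q p u k a w
        * cremmerGervais n q p v w b c
      = ∑ u, ∑ v, ∑ w, cremmerGervais n q p j k v w * cremmerGervais n q p i w u c
        * cremmerGervais n q p u v a b := by
  by_cases hs : (i : ℕ) + j + k = a + b + c
  · have h1 : ∀ u v w : Fin n, cremmerGervais n q p i j u v * cremmerGervais n q p u k a w
        * cremmerGervais n q p v w b c = p⁻¹ ^ 3 * p ^ (2 * ((c : ℤ) + k - i - a))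
          * (cgCore q i j u v * cgCore q u k a w * cgCore q v w b c) := by
      intro u v w
      simp only [cremmerGervais_eq]
      by_cases h2 : (u : ℕ) + k = a + w
      · have e : p ^ (2 * ((c : ℤ) + k - i - a)) = p ^ (2 * ((v : ℤ) - i))
            * p ^ (2 * ((w : ℤ) - u)) * p ^ (2 * ((c : ℤ) - v)) := by
          rw [← zpow_add₀ hp, ← zpow_add₀ hp]; congr 1; omega
        rw [e]; ring
      · rw [cgCore_of_ne h2]; ring
    have h2 : ∀ u v w : Fin n, cremmerGervais n q p j k v w * cremmerGervais n q p i w u c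
        * cremmerGervais n q p u v a b = p⁻¹ ^ 3 * p ^ (2 * ((c : ℤ) + k - i - a))
          * (cgCore q j k v w * cgCore q i w u c * cgCore q u v a b) := by
      intro u v w
      simp only [cremmerGervais_eq]
      by_cases h2 : (i : ℕ) + w = u + c
      · have e : p ^ (2 * ((c : ℤ) + k - i - a)) = p ^ (2 * ((w : ℤ) - j))
            * p ^ (2 * ((c : ℤ) - i)) * p ^ (2 * ((b : ℤ) - u)) := by
          rw [← zpow_add₀ hp, ← zpow_add₀ hp]; congr 1; omega
        rw [e]; ring
      · rw [cgCore_of_ne h2]; ring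
    simp only [h1, h2, ← Finset.mul_sum]
    rw [cgCore_yangBaxter hq]
  · rw [Finset.sum_eq_zero, Finset.sum_eq_zero]
    all_goals
      intro u _
      refine Finset.sum_eq_zero fun v _ => Finset.sum_eq_zero fun w _ => ?_
      simp only [cremmerGervais_eq]
    · by_cases h1 : (j : ℕ) + k = v + w
      · by_cases h2 : (i : ℕ) + w = u + c
        · rw [cgCore_of_ne (show (u : ℕ) + v ≠ a + b by omega)]; ring
        · rw [cgCore_of_ne h2]; ring
      · rw [cgCore_of_ne h1]; ring
    · by_cases h1 : (i : ℕ) + j = u + v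
      · by_cases h2 : (u : ℕ) + k = a + w
        · rw [cgCore_of_ne (show (v : ℕ) + w ≠ b + c by omega)]; ring
        · rw [cgCore_of_ne h2]; ring
      · rw [cgCore_of_ne h1]; ring

/-- The powers of `p` in the two factors telescope to `p^(2(m-i))`, which is `1` in the identity
term because there `m = i`. -/
theorem cremmerGervais_hecke {n : ℕ} {q p : ℂ} (hq : q ≠ 0) (hp : p ≠ 0) (i j a m : Fin n) :
    p ^ 2 * ∑ k, ∑ l, cremmerGervais n q p i j k l * cremmerGervais n q p l k a m
      = (q - q⁻¹) * (p * cremmerGervais n q p i j a m) + if a = j ∧ m = i then 1 else 0 := by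
  have h1 : ∀ k l : Fin n, cremmerGervais n q p i j k l * cremmerGervais n q p l k a m
      = p⁻¹ ^ 2 * p ^ (2 * ((m : ℤ) - i)) * (cgCore q i j k l * cgCore q l k a m) := by
    intro k l
    have e : p ^ (2 * ((m : ℤ) - i)) = p ^ (2 * ((l : ℤ) - i)) * p ^ (2 * ((m : ℤ) - l)) := by
      rw [← zpow_add₀ hp]; congr 1; ring
    rw [cremmerGervais_eq, cremmerGervais_eq, e]; ring
  simp only [h1, ← Finset.mul_sum]
  rw [cgCore_hecke hq, cremmerGervais_eq]
  have h2 : p ^ (2 * ((m : ℤ) - i)) * (if a = j ∧ m = i then (1 : ℂ) else 0)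
      = if a = j ∧ m = i then 1 else 0 := by
    split_ifs with h
    · rw [h.2]; simp
    · simp
  calc _ = (q - q⁻¹) * (p ^ (2 * ((m : ℤ) - i)) * cgCore q i j a m)
        + p ^ (2 * ((m : ℤ) - i)) * (if a = j ∧ m = i then (1 : ℂ) else 0) := by
        field_simp
    _ = _ := by rw [h2]; field_simp


/-! ### The exterior algebra -/

/-- The elements `y_i` satisfy `p^{-2k} y_k y_l + p^{-2l} y_l y_k = 0` for all `k` and `l`. -/
def TwistedAnticomm {n : ℕ} {B : Type*} [Ring B] [Algebra ℂ B] (p : ℂ) (y : Fin n → B) : Prop :=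
  ∀ k l : Fin n, p ^ (-2 * (k : ℤ)) • (y k * y l) + p ^ (-2 * (l : ℤ)) • (y l * y k) = 0

/-- `k` lies strictly between `i` and `j`, and `k + l = i + j`. -/
abbrev StrictlyBetween (i j k l : ℕ) : Prop :=
  i + j = k + l ∧ ((j < k ∧ k < i) ∨ (i < k ∧ k < j))

theorem cgCore_self (q : ℂ) (i k l : ℕ) :
    cgCore q i i k l = if k = i ∧ l = i then q else 0 := by
  unfold cgCore
  by_cases h : i + i = k + l
  · by_cases h1 : i = k
    · subst h1
      rw [if_pos h, if_pos rfl, if_pos le_rfl, if_pos (by omega)]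
    · rw [if_pos h, if_neg h1, if_neg (by omega), if_neg (by omega), if_neg (by omega)]
  · rw [if_neg h, if_neg (by omega)]

theorem cgCore_of_gt (q : ℂ) {i j : ℕ} (hij : j < i) (k l : ℕ) :
    cgCore q i j k l = (if k = i ∧ l = j then q else 0)
      + (if k = j ∧ l = i then q - q⁻¹ else 0)
      + (q - q⁻¹) * (if StrictlyBetween i j k l then 1 else 0) := by
  unfold cgCore
  by_cases h : i + j = k + l
  · by_cases h1 : i = k
    · subst h1
      rw [if_pos h, if_pos rfl, if_pos hij.le, if_pos (by omega), if_neg (by omega),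
        if_neg (by omega)]
      ring
    · by_cases h2 : k = j
      · subst h2
        rw [if_pos h, if_neg h1, if_pos (by omega), if_neg (by omega), if_pos (by omega),
          if_neg (by omega)]
        ring
      · by_cases h3 : j < k ∧ k < i
        · rw [if_pos h, if_neg h1, if_pos (by omega), if_neg (by omega), if_neg (by omega),
            if_pos (by omega)]
          ring
        · rw [if_pos h, if_neg h1, if_neg (by omega), if_neg (by omega), if_neg (by omega),
            if_neg (by omega), if_neg (by omega)]
          ring
  · rw [if_neg h, if_neg (by omega), if_neg (by omega), if_neg (by omega)]
    ring

theorem cgCore_of_lt (q : ℂ) {i j : ℕ} (hij : i < j) (k l : ℕ) :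
    cgCore q i j k l = (if k = i ∧ l = j then q⁻¹ else 0)
      + (q⁻¹ - q) * (if StrictlyBetween i j k l then 1 else 0) := by
  unfold cgCore
  by_cases h : i + j = k + l
  · by_cases h1 : i = k
    · subst h1
      rw [if_pos h, if_pos rfl, if_neg (by omega), if_pos (by omega), if_neg (by omega)]
      ring
    · by_cases h3 : i < k ∧ k < j
      · rw [if_pos h, if_neg h1, if_neg (by omega), if_pos h3, if_neg (by omega),
          if_pos (by omega)]
        ring
      · rw [if_pos h, if_neg h1, if_neg (by omega), if_neg h3, if_neg (by omega),
          if_neg (by omega)]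
        ring
  · rw [if_neg h, if_neg (by omega), if_neg (by omega)]
    ring

/-- The set of pairs `(k, l)` is stable under the swap while `z` is antisymmetric on it, so twice
the sum vanishes. -/
theorem sum_strictlyBetween_eq_zero {n : ℕ} {M : Type*} [AddCommGroup M] [Module ℂ M]
    (i j : Fin n) (z : Fin n → Fin n → M)
    (h : ∀ k l : Fin n, StrictlyBetween i j k l → z k l + z l k = 0) :
    ∑ k : Fin n, ∑ l : Fin n, (if StrictlyBetween i j k l then (1 : ℂ) else 0) • z k l = 0 := by
  set S := ∑ k : Fin n, ∑ l : Fin n, (if StrictlyBetween i j k l then (1 : ℂ) else 0) • z k l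
    with hS
  have h1 : S + S = 0 := by
    nth_rewrite 2 [hS]
    rw [Finset.sum_comm, hS]
    simp only [← Finset.sum_add_distrib]
    refine Finset.sum_eq_zero fun k _ => Finset.sum_eq_zero fun l _ => ?_
    have hiff : StrictlyBetween i j l k ↔ StrictlyBetween i j k l := by
      unfold StrictlyBetween; omega
    simp only [hiff]
    split_ifs with hb
    · rw [one_smul, one_smul, h k l hb]
    · rw [zero_smul, zero_smul, add_zero]
  have h2 : (2 : ℂ) • S = 0 := by rw [two_smul, h1]
  exact (smul_eq_zero.1 h2).resolve_left two_ne_zero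

/-! ### The quadratic relations of `Λ(R)` versus twisted anticommutation. -/

section quad

variable {n : ℕ} {B : Type*} [Ring B] [Algebra ℂ B] {q p : ℂ}

/-- The left-hand side of the quadratic relation of `Λ(R)`. -/
def quadExpr (q p : ℂ) (y : Fin n → B) (i j : Fin n) : B :=
  q⁻¹ • (y j * y i) + p • ∑ k, ∑ l, cremmerGervais n q p i j k l • (y k * y l)

/-- On the support of `R` one has `l - i = j - k`. The power of `p` therefore splits into an outer
factor and the weight `p^(-2k)`, so that only the matrix for `p = 1` remains. -/
theorem quadExpr_eq (hp : p ≠ 0) (y : Fin n → B) (i j : Fin n) :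
    quadExpr q p y i j = p ^ (2 * (j : ℤ)) • (q⁻¹ • p ^ (-2 * (j : ℤ)) • (y j * y i)
      + ∑ k : Fin n, ∑ l : Fin n, cgCore q i j k l • p ^ (-2 * (k : ℤ)) • (y k * y l)) := by
  unfold quadExpr
  rw [smul_add, Finset.smul_sum, Finset.smul_sum]
  congr 1
  · rw [smul_comm q⁻¹, smul_smul (p ^ _), ← zpow_add₀ hp]
    simp
  · refine Finset.sum_congr rfl fun k _ => ?_
    rw [Finset.smul_sum, Finset.smul_sum]
    refine Finset.sum_congr rfl fun l _ => ?_
    rw [cremmerGervais_eq]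
    by_cases h : (i : ℕ) + j = k + l
    · rw [smul_smul, smul_smul, smul_smul]
      congr 1
      have e : p ^ (2 * ((l : ℤ) - i)) = p ^ (2 * (j : ℤ)) * p ^ (-2 * (k : ℤ)) := by
        rw [← zpow_add₀ hp]; congr 1; omega
      rw [e]
      field_simp
    · rw [cgCore_of_ne h]; simp

/-- The terms with `k` strictly between `i` and `j` all have the same coefficient, hence cancel in
pairs by hypothesis. What survives is a non-zero multiple of the two-term relation for the pair `i`,
`j`. -/
theorem quadExpr_eq_zero_iff_of_strictlyBetween (hq : q ≠ 0) (hp : p ≠ 0) (y : Fin n → B)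
    {i j : Fin n} (hij : i ≠ j)
    (h : ∀ k l : Fin n, StrictlyBetween i j k l →
      p ^ (-2 * (k : ℤ)) • (y k * y l) + p ^ (-2 * (l : ℤ)) • (y l * y k) = 0) :
    quadExpr q p y i j = 0 ↔
      p ^ (-2 * (j : ℤ)) • (y j * y i) + p ^ (-2 * (i : ℤ)) • (y i * y j) = 0 := by
  have h0 := sum_strictlyBetween_eq_zero i j (fun k l => p ^ (-2 * (k : ℤ)) • (y k * y l)) h
  rw [quadExpr_eq hp, smul_eq_zero_iff_right (zpow_ne_zero _ hp)]
  set z : Fin n → Fin n → B := fun k l => p ^ (-2 * (k : ℤ)) • (y k * y l) with hz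
  replace h0 : ∑ k : Fin n, ∑ l : Fin n,
      (if StrictlyBetween i j k l then (1 : ℂ) else 0) • z k l = 0 := h0
  change q⁻¹ • z j i + ∑ k : Fin n, ∑ l : Fin n, cgCore q i j k l • z k l = 0
    ↔ z j i + z i j = 0
  have hsum : ∀ (a b : Fin n) (c : ℂ), ∑ k : Fin n, ∑ l : Fin n,
      (if (k : ℕ) = a ∧ (l : ℕ) = b then c else 0) • z k l = c • z a b := by
    intro a b c
    simp only [Fin.val_inj, ite_and, ite_smul, zero_smul]
    rw [Finset.sum_eq_single a (by intro k _ hk; simp [hk]) (by simp),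
      Finset.sum_eq_single b (by intro k _ hk; simp [hk]) (by simp)]
    simp
  rcases lt_or_gt_of_ne hij with hlt | hgt
  · have e : ∑ k : Fin n, ∑ l : Fin n, cgCore q i j k l • z k l = q⁻¹ • z i j := by
      simp only [cgCore_of_lt q (show (i : ℕ) < j from hlt), add_smul, mul_smul,
        Finset.sum_add_distrib, ← Finset.smul_sum, h0, hsum, smul_zero, add_zero]
    rw [e, ← smul_add, smul_eq_zero_iff_right (inv_ne_zero hq)]
  · have e : ∑ k : Fin n, ∑ l : Fin n, cgCore q i j k l • z k l
        = q • z i j + (q - q⁻¹) • z j i := by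
      simp only [cgCore_of_gt q (show (j : ℕ) < i from hgt), add_smul, mul_smul,
        Finset.sum_add_distrib, ← Finset.smul_sum, h0, hsum, smul_zero, add_zero]
    have e2 : q⁻¹ • z j i + (q • z i j + (q - q⁻¹) • z j i) = q • (z j i + z i j) := by
      module
    rw [e, e2, smul_eq_zero_iff_right hq]

theorem TwistedAnticomm.mul_self {y : Fin n → B} (hp : p ≠ 0) (h : TwistedAnticomm p y)
    (i : Fin n) : y i * y i = 0 := by
  have := h i i
  rw [← two_smul ℂ, smul_smul] at this
  exact (smul_eq_zero.1 this).resolve_left (mul_ne_zero two_ne_zero (zpow_ne_zero _ hp))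

theorem TwistedAnticomm.quadExpr_eq_zero (hq : q ≠ 0) (hp : p ≠ 0) {y : Fin n → B}
    (h : TwistedAnticomm p y) (i j : Fin n) : quadExpr q p y i j = 0 := by
  rcases eq_or_ne i j with rfl | hij
  · rw [quadExpr_eq hp]
    rw [h.mul_self hp, smul_zero, smul_zero, zero_add, Finset.sum_eq_zero, smul_zero]
    intro k _
    refine Finset.sum_eq_zero fun l _ => ?_
    rw [cgCore_self]
    split_ifs with hkl
    · rw [Fin.ext hkl.1, Fin.ext hkl.2, h.mul_self hp, smul_zero, smul_zero]
    · rw [zero_smul]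
  · exact (quadExpr_eq_zero_iff_of_strictlyBetween hq hp y hij fun k l _ => h k l).2 (h j i)

/-- Strong induction on `|k - l|`: pairs strictly between `k` and `l` are closer together, so their
relations are already known. The squares start the induction, which also covers `q^2 = -1`. -/
theorem twistedAnticomm_of_quadExpr (hq : q ≠ 0) (hp : p ≠ 0) {y : Fin n → B}
    (h : ∀ i j, quadExpr q p y i j = 0) (hsq : ∀ i, y i * y i = 0) : TwistedAnticomm p y := by
  suffices H : ∀ d : ℕ, ∀ k l : Fin n, ((k : ℤ) - l).natAbs = d →
      p ^ (-2 * (k : ℤ)) • (y k * y l) + p ^ (-2 * (l : ℤ)) • (y l * y k) = 0 from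
    fun k l => H _ k l rfl
  intro d
  induction d using Nat.strong_induction_on with
  | _ d ih =>
    intro k l hd
    rcases eq_or_ne l k with rfl | hkl
    · rw [hsq]; simp
    · refine (quadExpr_eq_zero_iff_of_strictlyBetween hq hp y hkl fun a b hab => ?_).1 (h l k)
      unfold StrictlyBetween at hab
      exact ih _ (by omega) a b rfl

end quad

namespace CGExt

variable {n : ℕ} {q p : ℂ}

theorem twistedAnticomm (hq : q ≠ 0) (hp : p ≠ 0) : TwistedAnticomm p (cgX n q p) := by
  refine twistedAnticomm_of_quadExpr hq hp (fun i j => ?_) (fun i => ?_)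
  · have h := RingQuot.mkAlgHom_rel ℂ (CGExtRel.quad (n := n) (q := q) (p := p) i j)
    simpa [quadExpr, cgX, map_sum] using h
  · have h := RingQuot.mkAlgHom_rel ℂ (CGExtRel.sq (n := n) (q := q) (p := p) i)
    simpa [cgX] using h

theorem mul_self (hq : q ≠ 0) (hp : p ≠ 0) (i : Fin n) : cgX n q p i * cgX n q p i = 0 :=
  (twistedAnticomm hq hp).mul_self hp i

section lift

variable {B : Type*} [Ring B] [Algebra ℂ B]

/-- Algebra maps out of `Λ(R)`. -/
def lift (y : Fin n → B) (h : ∀ i j, quadExpr q p y i j = 0) (hsq : ∀ i, y i * y i = 0) :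
    CGExt n q p →ₐ[ℂ] B :=
  RingQuot.liftAlgHom ℂ ⟨FreeAlgebra.lift ℂ y, by
    rintro _ _ (⟨i, j⟩ | i)
    · simpa [quadExpr, map_sum] using h i j
    · simpa using hsq i⟩

@[simp] theorem lift_cgX (y : Fin n → B) (h : ∀ i j, quadExpr q p y i j = 0)
    (hsq : ∀ i, y i * y i = 0) (i : Fin n) : lift y h hsq (cgX n q p i) = y i := by
  unfold lift cgX
  rw [RingQuot.liftAlgHom_mkAlgHom_apply, FreeAlgebra.lift_ι_apply]

theorem hom_ext {f g : CGExt n q p →ₐ[ℂ] B} (h : ∀ i, f (cgX n q p i) = g (cgX n q p i)) :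
    f = g :=
  RingQuot.ringQuot_ext' ℂ f g (FreeAlgebra.hom_ext (funext h))

end lift

@[elab_as_elim]
theorem induction {P : CGExt n q p → Prop} (algebraMap : ∀ c, P (algebraMap ℂ _ c))
    (cgX : ∀ i, P (cgX n q p i)) (mul : ∀ a b, P a → P b → P (a * b))
    (add : ∀ a b, P a → P b → P (a + b)) (a : CGExt n q p) : P a := by
  obtain ⟨a, rfl⟩ := RingQuot.mkAlgHom_surjective ℂ (CGExtRel n q p) a
  induction a using FreeAlgebra.induction with
  | grade0 c => simpa using algebraMap c
  | grade1 i => exact cgX i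
  | mul a b ha hb => simpa using mul _ _ ha hb
  | add a b ha hb => simpa using add _ _ ha hb

/-- Products of permuted lists of generators differ by non-zero scalars. -/
theorem exists_smul_of_perm {B : Type*} [Ring B] [Algebra ℂ B] {y : Fin n → B} (hp : p ≠ 0)
    (hy : TwistedAnticomm p y) {l l' : List (Fin n)} (h : l.Perm l') :
    ∃ c : ℂ, c ≠ 0 ∧ (l.map y).prod = c • (l'.map y).prod := by
  induction h with
  | nil => exact ⟨1, one_ne_zero, by simp⟩
  | cons a _ ih =>
    obtain ⟨c, hc, h⟩ := ih
    exact ⟨c, hc, by simp [h]⟩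
  | swap a b l =>
    refine ⟨-p ^ (2 * (b : ℤ) - 2 * a), neg_ne_zero.2 (zpow_ne_zero _ hp), ?_⟩
    have h1 : y b * y a = -p ^ (2 * (b : ℤ) - 2 * a) • (y a * y b) := by
      have h2 := congrArg (fun t => p ^ (2 * (b : ℤ)) • t) (hy b a)
      simp only [smul_add, smul_smul, ← zpow_add₀ hp, smul_zero] at h2
      rw [show 2 * (b : ℤ) + -2 * b = 0 by ring, zpow_zero, one_smul,
        show 2 * (b : ℤ) + -2 * a = 2 * (b : ℤ) - 2 * a by ring] at h2
      rw [neg_smul]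
      exact eq_neg_of_add_eq_zero_left h2
    simp only [List.map_cons, List.prod_cons, ← mul_assoc]
    rw [h1, smul_mul_assoc]
  | trans _ _ ih1 ih2 =>
    obtain ⟨c, hc, h⟩ := ih1
    obtain ⟨d, hd, h'⟩ := ih2
    exact ⟨c * d, mul_ne_zero hc hd, by rw [h, h', smul_smul]⟩

theorem mul_prod_eq_zero_of_mem {B : Type*} [Ring B] [Algebra ℂ B] {y : Fin n → B} (hp : p ≠ 0)
    (hy : TwistedAnticomm p y) {l : List (Fin n)} {i : Fin n} (h : i ∈ l) :
    y i * (l.map y).prod = 0 := by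
  obtain ⟨c, -, hc⟩ := exists_smul_of_perm hp hy (List.perm_cons_erase h)
  rw [hc, List.map_cons, List.prod_cons, mul_smul_comm, ← mul_assoc, hy.mul_self hp, zero_mul,
    smul_zero]

theorem prod_mul_eq_zero_of_mem {B : Type*} [Ring B] [Algebra ℂ B] {y : Fin n → B} (hp : p ≠ 0)
    (hy : TwistedAnticomm p y) {l : List (Fin n)} {i : Fin n} (h : i ∈ l) :
    (l.map y).prod * y i = 0 := by
  obtain ⟨c, -, hc⟩ := exists_smul_of_perm hp hy
    ((List.perm_cons_erase h).trans (List.perm_append_singleton i (l.erase i)).symm)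
  rw [hc, List.map_append, List.prod_append, List.map_singleton, List.prod_singleton,
    smul_mul_assoc, mul_assoc, hy.mul_self hp, mul_zero, smul_zero]

theorem prod_eq_zero_of_not_nodup {B : Type*} [Ring B] [Algebra ℂ B] {y : Fin n → B}
    (hp : p ≠ 0) (hy : TwistedAnticomm p y) {l : List (Fin n)} (h : ¬ l.Nodup) :
    (l.map y).prod = 0 := by
  induction l with
  | nil => exact absurd List.nodup_nil h
  | cons i l ih =>
    rw [List.map_cons, List.prod_cons]
    by_cases hi : i ∈ l
    · exact mul_prod_eq_zero_of_mem hp hy hi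
    · rw [ih fun hl => h (List.nodup_cons.2 ⟨hi, hl⟩), mul_zero]

/-! #### The Fock representation -/

/-- The scalar picked up when `x_i` is moved into the product of the `x_j`, `j ∈ S`. -/
def fockCoeff (p : ℂ) (i : Fin n) (S : Finset (Fin n)) : ℂ :=
  ∏ j ∈ S, if j < i then -p ^ (2 * ((i : ℕ) - (j : ℕ))) else 1

/-- Multiplication by `x_i` on the space with basis the subsets of the index set. -/
def fockGen (p : ℂ) (i : Fin n) : Module.End ℂ (Finset (Fin n) → ℂ) where
  toFun v S := if i ∈ S then fockCoeff p i (S.erase i) * v (S.erase i) else 0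
  map_add' v w := by
    funext S
    simp only [Pi.add_apply]
    split_ifs <;> ring
  map_smul' c v := by
    funext S
    simp only [Pi.smul_apply, smul_eq_mul, RingHom.id_apply]
    split_ifs <;> ring

theorem fockGen_apply (p : ℂ) (i : Fin n) (v : Finset (Fin n) → ℂ) (S : Finset (Fin n)) :
    fockGen p i v S = if i ∈ S then fockCoeff p i (S.erase i) * v (S.erase i) else 0 := rfl

theorem fockCoeff_erase_of_lt {i j : Fin n} (hij : i < j) {S : Finset (Fin n)} (hi : i ∈ S) :
    fockCoeff p j S = -p ^ (2 * ((j : ℕ) - (i : ℕ))) * fockCoeff p j (S.erase i) := by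
  unfold fockCoeff
  rw [← Finset.mul_prod_erase S _ hi, if_pos hij]

theorem fockCoeff_erase_of_le {i j : Fin n} (hij : j ≤ i) (S : Finset (Fin n)) :
    fockCoeff p j (S.erase i) = fockCoeff p j S := by
  unfold fockCoeff
  exact Finset.prod_erase S (if_neg (not_lt.2 hij))

/-- For `k < l`, inserting `l` into a set that contains `k` costs an additional factor
`-p^(2(l-k))`, whereas inserting `k` is insensitive to the presence of `l`. This is the ratio of the
two weights, up to sign. -/
theorem twistedAnticomm_fockGen (hp : p ≠ 0) :
    TwistedAnticomm p (fockGen p : Fin n → Module.End ℂ (Finset (Fin n) → ℂ)) := by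
  have H : ∀ k l : Fin n, k < l →
      p ^ (-2 * (k : ℤ)) • (fockGen p k * fockGen p l)
        + p ^ (-2 * (l : ℤ)) • (fockGen p l * fockGen p k) = 0 := by
    intro k l hkl
    refine LinearMap.ext fun v => funext fun S => ?_
    simp only [LinearMap.add_apply, LinearMap.smul_apply, Module.End.mul_apply, Pi.add_apply,
      Pi.smul_apply, smul_eq_mul, LinearMap.zero_apply, Pi.zero_apply, fockGen_apply]
    by_cases hk : k ∈ S
    · by_cases hl : l ∈ S
      · rw [if_pos hk, if_pos hl, if_pos (Finset.mem_erase.2 ⟨hkl.ne', hl⟩),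
          if_pos (Finset.mem_erase.2 ⟨hkl.ne, hk⟩),
          fockCoeff_erase_of_lt hkl (Finset.mem_erase.2 ⟨hkl.ne, hk⟩),
          fockCoeff_erase_of_le (j := k) (i := k) le_rfl,
          fockCoeff_erase_of_le (j := k) (i := k) le_rfl,
          fockCoeff_erase_of_le (j := k) (i := l) hkl.le, Finset.erase_right_comm]
        have e : p ^ (-2 * (k : ℤ)) = p ^ (-2 * (l : ℤ)) * p ^ (2 * ((l : ℕ) - (k : ℕ))) := by
          rw [← zpow_natCast, ← zpow_add₀ hp]
          congr 1
          have : (k : ℕ) < l := hkl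
          omega
        rw [e]
        ring
      · rw [if_neg hl, if_pos hk, if_neg (fun h => hl (Finset.mem_of_mem_erase h))]
        simp
    · by_cases hl : l ∈ S
      · rw [if_neg hk, if_pos hl, if_neg (fun h => hk (Finset.mem_of_mem_erase h))]
        simp
      · rw [if_neg hk, if_neg hl]
        simp
  intro k l
  rcases lt_trichotomy k l with h | rfl | h
  · exact H k l h
  · have : fockGen p k * fockGen p k = 0 := by
      refine LinearMap.ext fun v => funext fun S => ?_
      simp [Module.End.mul_apply, fockGen_apply]
    rw [this]; simp
  · rw [add_comm]; exact H l k h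

/-- The Fock representation of `Λ(R)`. -/
def fock (hq : q ≠ 0) (hp : p ≠ 0) :
    CGExt n q p →ₐ[ℂ] Module.End ℂ (Finset (Fin n) → ℂ) :=
  lift (fockGen p) ((twistedAnticomm_fockGen hp).quadExpr_eq_zero hq hp)
    ((twistedAnticomm_fockGen hp).mul_self hp)

/-- The coefficient of the top form. -/
def topCoeff (hq : q ≠ 0) (hp : p ≠ 0) : CGExt n q p →ₗ[ℂ] ℂ :=
  LinearMap.proj Finset.univ ∘ₗ LinearMap.applyₗ (Pi.single ∅ 1) ∘ₗ (fock hq hp).toLinearMap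

theorem fockGen_single {i : Fin n} {S : Finset (Fin n)} (hi : i ∉ S) :
    fockGen p i (Pi.single S 1) = fockCoeff p i S • Pi.single (insert i S) 1 := by
  funext U
  rw [fockGen_apply, Pi.smul_apply, smul_eq_mul]
  by_cases hU : U = insert i S
  · subst hU
    rw [if_pos (Finset.mem_insert_self i S), Finset.erase_insert hi]
    simp
  · rw [Pi.single_eq_of_ne hU, mul_zero]
    split_ifs with h
    · rw [Pi.single_eq_of_ne, mul_zero]
      rintro rfl
      exact hU (Finset.insert_erase h).symm
    · rfl

/-- The scalar of a word in the generators, relative to the increasing word. -/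
def wordCoeff (p : ℂ) : List (Fin n) → ℂ
  | [] => 1
  | i :: l => fockCoeff p i l.toFinset * wordCoeff p l

theorem fock_prod (hq : q ≠ 0) (hp : p ≠ 0) {l : List (Fin n)} (hl : l.Nodup) :
    fock hq hp (l.map (cgX n q p)).prod (Pi.single ∅ 1)
      = wordCoeff p l • Pi.single l.toFinset 1 := by
  induction l with
  | nil => simp [wordCoeff]
  | cons i l ih =>
    rw [List.nodup_cons] at hl
    rw [List.map_cons, List.prod_cons, map_mul, Module.End.mul_apply, ih hl.2, map_smul, fock,
      lift_cgX, fockGen_single (by simpa using hl.1), smul_smul, List.toFinset_cons, wordCoeff,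
      mul_comm]

/-- Peeling off the first letter accounts for exactly the pairs with `i = 0`. Injections rather than
permutations are considered so that the remaining word is of the same kind. -/
theorem wordCoeff_ofFn {m : ℕ} (f : Fin m → Fin n) (hf : Function.Injective f) :
    wordCoeff p (List.ofFn f)
      = ∏ i, ∏ j, if i < j ∧ f j < f i then -p ^ (2 * ((f i : ℕ) - (f j : ℕ))) else 1 := by
  induction m with
  | zero => simp [wordCoeff]
  | succ m ih =>
    rw [List.ofFn_succ, wordCoeff, ih (fun i => f i.succ)
      (fun a b h => Fin.succ_injective _ (hf h)), Fin.prod_univ_succ]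
    congr 1
    · rw [Fin.prod_univ_succ]
      have : (List.ofFn fun i : Fin m => f i.succ).toFinset
          = Finset.univ.image fun i : Fin m => f i.succ := by
        ext a; simp [List.mem_ofFn]
      rw [fockCoeff, this, Finset.prod_image fun a _ b _ h => Fin.succ_injective _ (hf h)]
      simp
    · refine Finset.prod_congr rfl fun i _ => ?_
      rw [Fin.prod_univ_succ, if_neg (fun h => absurd h.1 (Fin.not_lt_zero _)), one_mul]
      simp

theorem topCoeff_prod (hq : q ≠ 0) (hp : p ≠ 0) (σ : Equiv.Perm (Fin n)) :
    topCoeff hq hp ((List.ofFn σ).map (cgX n q p)).prod = cgCoeff p σ := by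
  have h := fock_prod (q := q) hq hp (List.nodup_ofFn.2 σ.injective)
  have h2 : (List.ofFn σ).toFinset = Finset.univ := by
    ext a
    simpa [List.mem_ofFn] using ⟨σ.symm a, σ.apply_symm_apply a⟩
  simp only [topCoeff, LinearMap.comp_apply, AlgHom.toLinearMap_apply, LinearMap.applyₗ_apply_apply,
    LinearMap.proj_apply, h, h2]
  rw [wordCoeff_ofFn _ σ.injective]
  simp [cgCoeff]

theorem cgTop_eq : cgTop n q p = ((List.finRange n).map (cgX n q p)).prod := by
  rw [cgTop, List.ofFn_eq_map]

theorem cgCoeff_one : cgCoeff p (1 : Equiv.Perm (Fin n)) = 1 := by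
  unfold cgCoeff
  refine Finset.prod_eq_one fun i _ => Finset.prod_eq_one fun j _ => if_neg ?_
  rintro ⟨h1, h2⟩
  exact absurd h1 (not_lt.2 (le_of_lt h2))

theorem topCoeff_cgTop (hq : q ≠ 0) (hp : p ≠ 0) : topCoeff hq hp (cgTop n q p) = 1 := by
  have h := topCoeff_prod (n := n) hq hp 1
  rw [cgCoeff_one] at h
  rw [← h, cgTop_eq, List.ofFn_eq_map]
  simp

theorem cgTop_ne_zero (hq : q ≠ 0) (hp : p ≠ 0) : cgTop n q p ≠ 0 := fun h => by
  simpa [h] using topCoeff_cgTop (n := n) hq hp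

theorem exists_prod_eq_smul_cgTop (hq : q ≠ 0) (hp : p ≠ 0) {l : List (Fin n)}
    (hl : l.Perm (List.finRange n)) :
    ∃ c : ℂ, c ≠ 0 ∧ (l.map (cgX n q p)).prod = c • cgTop n q p := by
  rw [cgTop_eq]
  exact exists_smul_of_perm hp (twistedAnticomm hq hp) hl

/-- Reordering shows that the two products are proportional, and the Fock representation identifies
the scalar. -/
theorem prod_perm_eq (hq : q ≠ 0) (hp : p ≠ 0) (σ : Equiv.Perm (Fin n)) :
    ((List.ofFn σ).map (cgX n q p)).prod = cgCoeff p σ • cgTop n q p := by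
  obtain ⟨c, -, hc⟩ := exists_prod_eq_smul_cgTop (q := q) hq hp (l := List.ofFn σ) (by
    rw [List.ofFn_eq_map]
    exact Equiv.Perm.map_finRange_perm σ)
  have h := congrArg (topCoeff hq hp) hc
  rw [topCoeff_prod, map_smul, topCoeff_cgTop, smul_eq_mul, mul_one] at h
  rw [hc, h]

end CGExt


/-! ### Convolution algebras -/

namespace WithConv

open Coalgebra

variable {k : Type*} [Field k] {B C D : Type*} [Ring B] [Algebra k B] [AddCommMonoid C]
  [Module k C] [Coalgebra k C] [AddCommMonoid D] [Module k D] [Coalgebra k D]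

theorem _root_.Coalgebra.sum_counit_right_smul {ι : Type*} {c : C} (r : Coalgebra.Repr k c ι) :
    ∑ i ∈ r.index, counit (R := k) (r.right i) • r.left i = c := by
  have h := congrArg (TensorProduct.rid k C) (sum_tmul_counit_eq r)
  simpa only [map_sum, TensorProduct.rid_tmul, one_smul] using h

/-- Restriction along a coalgebra map. -/
def pullback (B : Type*) [Ring B] [Algebra k B] (u : C →ₗc[k] D) :
    WithConv (D →ₗ[k] B) →ₐ[k] WithConv (C →ₗ[k] B) :=
  AlgHom.ofLinearMap
    { toFun := fun φ => toConv (φ.ofConv ∘ₗ u.toLinearMap)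
      map_add' := fun _ _ => rfl
      map_smul' := fun _ _ => rfl }
    (by
      refine WithConv.ext (LinearMap.ext fun c => ?_)
      simp [LinearMap.convOne_def])
    (fun f g => WithConv.ext (LinearMap.convMul_comp_coalgHom_distrib f g u))

@[simp] theorem pullback_apply (u : C →ₗc[k] D) (φ : WithConv (D →ₗ[k] B)) (c : C) :
    pullback B u φ c = φ (u c) := rfl

/-- The functionals with values in the scalars. -/
def ofScalar (k C B : Type*) [Field k] [AddCommMonoid C] [Module k C] [Coalgebra k C] [Ring B]
    [Algebra k B] :
    WithConv (C →ₗ[k] k) →ₐ[k] WithConv (C →ₗ[k] B) :=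
  AlgHom.ofLinearMap
    { toFun := fun φ => toConv (Algebra.linearMap k B ∘ₗ φ.ofConv)
      map_add' := fun _ _ => WithConv.ext (LinearMap.ext fun _ => by simp)
      map_smul' := fun c φ => WithConv.ext (LinearMap.ext fun x => by
        change algebraMap k B (c * φ x) = c • algebraMap k B (φ x)
        rw [map_mul, Algebra.smul_def]) }
    (by
      refine WithConv.ext (LinearMap.ext fun c => ?_)
      simp [LinearMap.convOne_def])
    (fun f g => WithConv.ext (LinearMap.algHom_comp_convMul_distrib (Algebra.ofId k B) f g))

@[simp] theorem ofScalar_apply (φ : WithConv (C →ₗ[k] k)) (c : C) :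
    ofScalar k C B φ c = algebraMap k B (φ c) := rfl

/-- The multiples of the counit. -/
def const (C : Type*) [AddCommMonoid C] [Module k C] [Coalgebra k C] :
    B →ₐ[k] WithConv (C →ₗ[k] B) :=
  AlgHom.ofLinearMap
    { toFun := fun b => toConv (LinearMap.toSpanSingleton k B b ∘ₗ counit)
      map_add' := fun _ _ => WithConv.ext (LinearMap.ext fun _ => by simp)
      map_smul' := fun c b => WithConv.ext (LinearMap.ext fun x => smul_comm (counit (R := k) x) c b) }
    (by
      refine WithConv.ext (LinearMap.ext fun c => ?_)
      simp [LinearMap.convOne_def, Algebra.algebraMap_eq_smul_one])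
    (fun f g => by
      refine WithConv.ext (LinearMap.ext fun c => ?_)
      have h := (ℛ k c).convMul_apply (toConv (LinearMap.toSpanSingleton k B f ∘ₗ counit))
        (toConv (LinearMap.toSpanSingleton k B g ∘ₗ counit))
      refine Eq.trans ?_ h.symm
      simp only [LinearMap.coe_mk, AddHom.coe_mk, LinearMap.comp_apply,
        LinearMap.toSpanSingleton_apply, smul_mul_smul_comm, ← Finset.sum_smul]
      congr 1
      conv_lhs => rw [← sum_counit_smul (ℛ k c)]
      simp)

@[simp] theorem const_apply (b : B) (c : C) :
    const (k := k) C b c = counit (R := k) c • b := rfl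

theorem mul_const_apply (φ : WithConv (C →ₗ[k] B)) (b : B) (c : C) :
    (φ * const (k := k) C b) c = φ c * b := by
  rw [(ℛ k c).convMul_apply]
  simp only [const_apply, mul_smul_comm, ← smul_mul_assoc, ← map_smul, ← Finset.sum_mul,
    ← map_sum]
  rw [sum_counit_right_smul]

theorem const_mul_apply (φ : WithConv (C →ₗ[k] B)) (b : B) (c : C) :
    (const (k := k) C b * φ) c = b * φ c := by
  rw [(ℛ k c).convMul_apply]
  simp only [const_apply, smul_mul_assoc, ← mul_smul_comm, ← map_smul, ← Finset.mul_sum,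
    ← map_sum]
  rw [sum_counit_smul]

/-- This commutation permits combining functionals with elements of `B` by the universal property of
the tensor product of algebras. -/
theorem commute_ofScalar_const (φ : WithConv (C →ₗ[k] k)) (b : B) :
    Commute (ofScalar k C B φ) (const (k := k) C b) :=
  WithConv.ext (LinearMap.ext fun c => by
    refine (mul_const_apply _ _ _).trans (Eq.trans ?_ (const_mul_apply _ _ _).symm)
    rw [ofScalar_apply, Algebra.commutes])

end WithConv

/-! ### Skew pairings of bialgebras -/

open WithConv Coalgebra

/-- A bilinear form with `⟨a | c d⟩ = ∑ ⟨a₁ | c⟩ ⟨a₂ | d⟩`, `⟨a b | c⟩ = ∑ ⟨b | c₁⟩ ⟨a | c₂⟩`,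
`⟨1 | c⟩ = ε(c)` and `⟨a | 1⟩ = ε(a)`. -/
structure SkewPairing (k X Y : Type*) [Field k] [Ring X] [Ring Y] [Bialgebra k X]
    [Bialgebra k Y] where
  /-- the bilinear form -/
  form : X →ₗ[k] Y →ₗ[k] k
  mul_left : ∀ a b, toConv (form (a * b)) = toConv (form b) * toConv (form a)
  one_left : form 1 = counit
  mul_right : ∀ c d, toConv (form.flip (c * d)) = toConv (form.flip c) * toConv (form.flip d)
  one_right : form.flip 1 = counit

namespace SkewPairing

variable {k X Y : Type*} [Field k] [Ring X] [Ring Y] [Bialgebra k X] [Bialgebra k Y]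

/-- `a ↦ ⟨a | ·⟩` -/
def leftHom (σ : SkewPairing k X Y) : X →ₐ[k] (WithConv (Y →ₗ[k] k))ᵐᵒᵖ :=
  AlgHom.ofLinearMap ((MulOpposite.opLinearEquiv k).toLinearMap
      ∘ₗ (WithConv.linearEquiv k (Y →ₗ[k] k)).symm.toLinearMap ∘ₗ σ.form)
    (MulOpposite.unop_injective (WithConv.ext (by
      simpa [LinearMap.convOne_def] using! σ.one_left)))
    (fun a b => MulOpposite.unop_injective (σ.mul_left a b))

/-- `c ↦ ⟨· | c⟩` -/
def rightHom (σ : SkewPairing k X Y) : Y →ₐ[k] WithConv (X →ₗ[k] k) :=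
  AlgHom.ofLinearMap ((WithConv.linearEquiv k (X →ₗ[k] k)).symm.toLinearMap ∘ₗ σ.form.flip)
    (WithConv.ext (by simpa [LinearMap.convOne_def] using! σ.one_right))
    (fun a b => σ.mul_right a b)

@[simp] theorem leftHom_apply (σ : SkewPairing k X Y) (a : X) (c : Y) :
    (σ.leftHom a).unop c = σ.form a c := rfl

@[simp] theorem rightHom_apply (σ : SkewPairing k X Y) (a : X) (c : Y) :
    σ.rightHom c a = σ.form a c := rfl

theorem mul_left_apply (σ : SkewPairing k X Y) (a b : X) (c : Y) {ι : Type*}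
    (rc : Coalgebra.Repr k c ι) :
    σ.form (a * b) c = ∑ i ∈ rc.index, σ.form b (rc.left i) * σ.form a (rc.right i) := by
  have h := congrArg (fun φ : WithConv (Y →ₗ[k] k) => φ c) (σ.mul_left a b)
  exact h.trans (rc.convMul_apply _ _)

theorem mul_right_apply (σ : SkewPairing k X Y) (a : X) (c d : Y) {ι : Type*}
    (ra : Coalgebra.Repr k a ι) :
    σ.form a (c * d) = ∑ i ∈ ra.index, σ.form (ra.left i) c * σ.form (ra.right i) d := by
  have h := congrArg (fun φ : WithConv (X →ₗ[k] k) => φ a) (σ.mul_right c d)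
  exact h.trans (ra.convMul_apply _ _)

theorem one_left_apply (σ : SkewPairing k X Y) (c : Y) : σ.form 1 c = counit (R := k) c := by
  rw [σ.one_left]

theorem one_right_apply (σ : SkewPairing k X Y) (a : X) : σ.form a 1 = counit (R := k) a :=
  LinearMap.congr_fun σ.one_right a

end SkewPairing

section constructors

variable {k X Y : Type*} [Field k] [Ring X] [Ring Y] [Bialgebra k X] [Bialgebra k Y]

/-- The projection `Y ⊗ Y → Y`, `c ⊗ d ↦ ε(d) c`. -/
def fstCoalgHom (k Y : Type*) [Field k] [Ring Y] [Bialgebra k Y] : Y ⊗[k] Y →ₗc[k] Y :=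
  ((Coalgebra.TensorProduct.rid k k Y) : Y ⊗[k] k →ₗc[k] Y).comp
    (Coalgebra.TensorProduct.map (CoalgHom.id k Y) (counitCoalgHom k Y))

/-- The projection `Y ⊗ Y → Y`, `c ⊗ d ↦ ε(c) d`. -/
def sndCoalgHom (k Y : Type*) [Field k] [Ring Y] [Bialgebra k Y] : Y ⊗[k] Y →ₗc[k] Y :=
  ((Coalgebra.TensorProduct.lid k Y) : k ⊗[k] Y →ₗc[k] Y).comp
    (Coalgebra.TensorProduct.map (counitCoalgHom k Y) (CoalgHom.id k Y))

@[simp] theorem fstCoalgHom_tmul (c d : Y) :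
    fstCoalgHom k Y (c ⊗ₜ d) = counit (R := k) d • c := rfl

@[simp] theorem sndCoalgHom_tmul (c d : Y) :
    sndCoalgHom k Y (c ⊗ₜ d) = counit (R := k) c • d := rfl

theorem pullback_fst_mul_snd (φ ψ : WithConv (Y →ₗ[k] k)) (c d : Y) :
    (pullback k (fstCoalgHom k Y) φ * pullback k (sndCoalgHom k Y) ψ) (c ⊗ₜ d) = φ c * ψ d := by
  rw [((ℛ k c).tmul (ℛ k d)).convMul_apply]
  simp only [Coalgebra.Repr.tmul, pullback_apply, fstCoalgHom_tmul, sndCoalgHom_tmul,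
    Finset.sum_product]
  conv_rhs => rw [← sum_counit_smul (ℛ k d), ← sum_counit_right_smul (ℛ k c)]
  simp only [map_sum, map_smul, Finset.sum_mul_sum, smul_eq_mul]
  exact Finset.sum_congr rfl fun i _ => Finset.sum_congr rfl fun j _ => by ring

theorem pullback_snd_mul_fst (φ ψ : WithConv (Y →ₗ[k] k)) (c d : Y) :
    (pullback k (sndCoalgHom k Y) ψ * pullback k (fstCoalgHom k Y) φ) (c ⊗ₜ d) = φ c * ψ d := by
  rw [((ℛ k c).tmul (ℛ k d)).convMul_apply]
  simp only [Coalgebra.Repr.tmul, pullback_apply, fstCoalgHom_tmul, sndCoalgHom_tmul,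
    Finset.sum_product]
  conv_rhs => rw [← sum_counit_smul (ℛ k c), ← sum_counit_right_smul (ℛ k d)]
  simp only [map_sum, map_smul, Finset.sum_mul_sum, smul_eq_mul]
  exact Finset.sum_congr rfl fun i _ => Finset.sum_congr rfl fun j _ => by ring

/-- The two functionals see different tensor factors. Consequently the Sweedler sums in the pairing
axioms are values of algebra maps, and those axioms can be checked on generators. -/
theorem commute_pullback_fst_snd (φ ψ : WithConv (Y →ₗ[k] k)) :
    Commute (pullback k (fstCoalgHom k Y) φ) (pullback k (sndCoalgHom k Y) ψ) :=
  WithConv.ext (TensorProduct.ext' fun c d =>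
    (pullback_fst_mul_snd φ ψ c d).trans (pullback_snd_mul_fst φ ψ c d).symm)

/-- `a ↦ (c ⊗ d ↦ ⟨a | c d⟩)` -/
def leftMulHom (Ψ : X →ₐ[k] (WithConv (Y →ₗ[k] k))ᵐᵒᵖ) :
    X →ₐ[k] (WithConv (Y ⊗[k] Y →ₗ[k] k))ᵐᵒᵖ :=
  (AlgHom.op (pullback k (Bialgebra.mulCoalgHom k Y))).comp Ψ

/-- `a ↦ (c ⊗ d ↦ ∑ ⟨a₁ | c⟩ ⟨a₂ | d⟩)` -/
def leftComulHom (Ψ : X →ₐ[k] (WithConv (Y →ₗ[k] k))ᵐᵒᵖ) :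
    X →ₐ[k] (WithConv (Y ⊗[k] Y →ₗ[k] k))ᵐᵒᵖ :=
  (Algebra.TensorProduct.lift ((AlgHom.op (pullback k (fstCoalgHom k Y))).comp Ψ)
    ((AlgHom.op (pullback k (sndCoalgHom k Y))).comp Ψ)
    (fun a b => (commute_pullback_fst_snd (Ψ a).unop (Ψ b).unop).op)).comp (Bialgebra.comulAlgHom k X)

/-- `c ↦ (a ⊗ b ↦ ⟨a b | c⟩)` -/
def rightMulHom (Φ : Y →ₐ[k] WithConv (X →ₗ[k] k)) : Y →ₐ[k] WithConv (X ⊗[k] X →ₗ[k] k) :=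
  (pullback k (Bialgebra.mulCoalgHom k X)).comp Φ

/-- `c ↦ (a ⊗ b ↦ ∑ ⟨b | c₁⟩ ⟨a | c₂⟩)` -/
def rightComulHom (Φ : Y →ₐ[k] WithConv (X →ₗ[k] k)) : Y →ₐ[k] WithConv (X ⊗[k] X →ₗ[k] k) :=
  (Algebra.TensorProduct.lift ((pullback k (sndCoalgHom k X)).comp Φ)
    ((pullback k (fstCoalgHom k X)).comp Φ)
    (fun a b => (commute_pullback_fst_snd (Φ b) (Φ a)).symm)).comp (Bialgebra.comulAlgHom k Y)

theorem leftMulHom_apply (Ψ : X →ₐ[k] (WithConv (Y →ₗ[k] k))ᵐᵒᵖ) (a : X) (c d : Y) :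
    (leftMulHom Ψ a).unop (c ⊗ₜ d) = (Ψ a).unop (c * d) := rfl

theorem leftComulHom_apply (Ψ : X →ₐ[k] (WithConv (Y →ₗ[k] k))ᵐᵒᵖ) (a : X) (c d : Y) {ι : Type*}
    (ra : Coalgebra.Repr k a ι) :
    (leftComulHom Ψ a).unop (c ⊗ₜ d)
      = ∑ i ∈ ra.index, (Ψ (ra.left i)).unop c * (Ψ (ra.right i)).unop d := by
  rw [leftComulHom, AlgHom.comp_apply, Bialgebra.comulAlgHom_apply, ← ra.eq, map_sum]
  simp only [Finset.unop_sum, WithConv.ofConv_sum, LinearMap.sum_apply]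
  exact Finset.sum_congr rfl fun i _ => pullback_snd_mul_fst _ _ c d

theorem rightMulHom_apply (Φ : Y →ₐ[k] WithConv (X →ₗ[k] k)) (c : Y) (a b : X) :
    rightMulHom Φ c (a ⊗ₜ b) = Φ c (a * b) := rfl

theorem rightComulHom_apply (Φ : Y →ₐ[k] WithConv (X →ₗ[k] k)) (c : Y) (a b : X) {ι : Type*}
    (rc : Coalgebra.Repr k c ι) :
    rightComulHom Φ c (a ⊗ₜ b) = ∑ i ∈ rc.index, Φ (rc.left i) b * Φ (rc.right i) a := by
  rw [rightComulHom, AlgHom.comp_apply, Bialgebra.comulAlgHom_apply, ← rc.eq, map_sum]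
  simp only [WithConv.ofConv_sum, LinearMap.sum_apply]
  exact Finset.sum_congr rfl fun i _ =>
    (pullback_snd_mul_fst _ _ a b).trans (mul_comm _ _)

/-- Evaluation at `1` on a convolution algebra. -/
def evalOne (k Y : Type*) [Field k] [Ring Y] [Bialgebra k Y] : WithConv (Y →ₗ[k] k) →ₐ[k] k :=
  AlgHom.ofLinearMap
    { toFun := fun φ => φ 1
      map_add' := fun _ _ => rfl
      map_smul' := fun _ _ => rfl }
    (by
      change (1 : WithConv (Y →ₗ[k] k)) 1 = 1
      simp)
    (fun φ ψ => by
      change (φ * ψ) 1 = φ 1 * ψ 1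
      simp [Algebra.TensorProduct.one_def])

/-- `a ↦ ⟨a | 1⟩` -/
def leftOneHom (Ψ : X →ₐ[k] (WithConv (Y →ₗ[k] k))ᵐᵒᵖ) : X →ₐ[k] k :=
  AlgHom.ofLinearMap
    { toFun := fun a => evalOne k Y (Ψ a).unop
      map_add' := fun a b => by rw [map_add, MulOpposite.unop_add, map_add]
      map_smul' := fun c a => by
        rw [map_smul, MulOpposite.unop_smul, map_smul, RingHom.id_apply] }
    (by
      change evalOne k Y (Ψ 1).unop = 1
      rw [map_one, MulOpposite.unop_one, map_one])
    (fun a b => by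
      change evalOne k Y (Ψ (a * b)).unop = evalOne k Y (Ψ a).unop * evalOne k Y (Ψ b).unop
      rw [map_mul, MulOpposite.unop_mul, map_mul, mul_comm])

@[simp] theorem leftOneHom_apply (Ψ : X →ₐ[k] (WithConv (Y →ₗ[k] k))ᵐᵒᵖ) (a : X) :
    leftOneHom Ψ a = (Ψ a).unop 1 := rfl

namespace SkewPairing

/-- A skew pairing from `a ↦ ⟨a | ·⟩`. -/
def ofLeft (Ψ : X →ₐ[k] (WithConv (Y →ₗ[k] k))ᵐᵒᵖ) (h : leftMulHom Ψ = leftComulHom Ψ)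
    (h1 : leftOneHom Ψ = Bialgebra.counitAlgHom k X) : SkewPairing k X Y where
  form := (WithConv.linearEquiv k (Y →ₗ[k] k)).toLinearMap
    ∘ₗ (MulOpposite.opLinearEquiv k).symm.toLinearMap ∘ₗ Ψ.toLinearMap
  mul_left a b := by
    change (Ψ (a * b)).unop = (Ψ b).unop * (Ψ a).unop
    rw [map_mul, MulOpposite.unop_mul]
  one_left := by
    change (Ψ 1).unop.ofConv = counit
    rw [map_one]
    rfl
  mul_right c d := by
    refine WithConv.ext (LinearMap.ext fun a => ?_)
    rw [(ℛ k a).convMul_apply]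
    change (leftMulHom Ψ a).unop (c ⊗ₜ d) = _
    rw [h, leftComulHom_apply _ _ _ _ (ℛ k a)]
    rfl
  one_right := LinearMap.ext fun a => DFunLike.congr_fun h1 a

@[simp] theorem ofLeft_form (Ψ : X →ₐ[k] (WithConv (Y →ₗ[k] k))ᵐᵒᵖ)
    (h : leftMulHom Ψ = leftComulHom Ψ) (h1 : leftOneHom Ψ = Bialgebra.counitAlgHom k X)
    (a : X) (c : Y) : (ofLeft Ψ h h1).form a c = (Ψ a).unop c := rfl

/-- A skew pairing from `c ↦ ⟨· | c⟩`. -/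
def ofRight (Φ : Y →ₐ[k] WithConv (X →ₗ[k] k)) (h : rightMulHom Φ = rightComulHom Φ)
    (h1 : (evalOne k X).comp Φ = Bialgebra.counitAlgHom k Y) : SkewPairing k X Y where
  form := ((WithConv.linearEquiv k (X →ₗ[k] k)).toLinearMap ∘ₗ Φ.toLinearMap).flip
  mul_left a b := by
    refine WithConv.ext (LinearMap.ext fun c => ?_)
    rw [(ℛ k c).convMul_apply]
    change rightMulHom Φ c (a ⊗ₜ b) = _
    rw [h, rightComulHom_apply _ _ _ _ (ℛ k c)]
    rfl
  one_left := LinearMap.ext fun c => DFunLike.congr_fun h1 c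
  mul_right c d := by
    change Φ (c * d) = Φ c * Φ d
    rw [map_mul]
  one_right := by
    change (Φ 1).ofConv = counit
    rw [map_one]
    rfl

@[simp] theorem ofRight_form (Φ : Y →ₐ[k] WithConv (X →ₗ[k] k))
    (h : rightMulHom Φ = rightComulHom Φ)
    (h1 : (evalOne k X).comp Φ = Bialgebra.counitAlgHom k Y) (a : X) (c : Y) :
    (ofRight Φ h h1).form a c = Φ c a := rfl

/-- In this form, as an equality of algebra maps, multiplicativity in the second variable can be
carried over to an extension of `X`. -/
theorem leftMulHom_leftHom (σ : SkewPairing k X Y) :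
    leftMulHom σ.leftHom = leftComulHom σ.leftHom := by
  refine AlgHom.ext fun a => MulOpposite.unop_injective (WithConv.ext
    (TensorProduct.ext' fun c d => ?_))
  exact (σ.mul_right_apply a c d (ℛ k a)).trans
    (leftComulHom_apply σ.leftHom a c d (ℛ k a)).symm

theorem rightMulHom_rightHom (σ : SkewPairing k X Y) :
    rightMulHom σ.rightHom = rightComulHom σ.rightHom := by
  refine AlgHom.ext fun c => WithConv.ext (TensorProduct.ext' fun a b => ?_)
  exact (σ.mul_left_apply a b c (ℛ k c)).trans
    (rightComulHom_apply σ.rightHom c a b (ℛ k c)).symm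

end SkewPairing

end constructors

/-! ### The commutation relation -/

namespace SkewPairing

variable {k H C : Type*} [Field k] [Ring H] [Bialgebra k H] [AddCommMonoid C] [Module k C]
  [Coalgebra k C] (σ : SkewPairing k H H)

/-- `c ↦ (a ↦ ∑ ⟨u a | c₁⟩ c₂)` -/
def pairRight (u : C →ₗc[k] H) : H →ₐ[k] WithConv (C →ₗ[k] H) :=
  (Algebra.TensorProduct.lift ((ofScalar k C H).comp ((pullback k u).comp σ.rightHom))
    (WithConv.const C) (fun _ _ => commute_ofScalar_const _ _)).comp (Bialgebra.comulAlgHom k H)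

/-- `c ↦ (a ↦ ∑ ⟨u a | c₂⟩ c₁)` -/
def pairRight' (u : C →ₗc[k] H) : H →ₐ[k] WithConv (C →ₗ[k] H) :=
  (Algebra.TensorProduct.lift (WithConv.const C)
    ((ofScalar k C H).comp ((pullback k u).comp σ.rightHom))
    (fun _ _ => (commute_ofScalar_const _ _).symm)).comp (Bialgebra.comulAlgHom k H)

theorem pairRight_mul_apply (u : C →ₗc[k] H) (a : C) (c : H) {ι κ : Type*}
    (ra : Coalgebra.Repr k a ι) (rc : Coalgebra.Repr k c κ) :
    (σ.pairRight u c * toConv u.toLinearMap) a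
      = ∑ i ∈ ra.index, ∑ j ∈ rc.index,
        σ.form (u (ra.left i)) (rc.left j) • (rc.right j * u (ra.right i)) := by
  rw [ra.convMul_apply]
  refine Finset.sum_congr rfl fun i _ => ?_
  rw [pairRight, AlgHom.comp_apply, Bialgebra.comulAlgHom_apply, ← rc.eq, map_sum]
  simp only [WithConv.ofConv_sum, LinearMap.sum_apply, Finset.sum_mul]
  refine Finset.sum_congr rfl fun j _ => ?_
  rw [← smul_mul_assoc]
  congr 1
  refine (WithConv.mul_const_apply _ _ _).trans ?_
  rw [Algebra.smul_def]
  rfl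

theorem mul_pairRight'_apply (u : C →ₗc[k] H) (a : C) (c : H) {ι κ : Type*}
    (ra : Coalgebra.Repr k a ι) (rc : Coalgebra.Repr k c κ) :
    (toConv u.toLinearMap * σ.pairRight' u c) a
      = ∑ i ∈ ra.index, ∑ j ∈ rc.index,
        σ.form (u (ra.right i)) (rc.right j) • (u (ra.left i) * rc.left j) := by
  rw [ra.convMul_apply]
  refine Finset.sum_congr rfl fun i _ => ?_
  rw [pairRight', AlgHom.comp_apply, Bialgebra.comulAlgHom_apply, ← rc.eq, map_sum]
  simp only [WithConv.ofConv_sum, LinearMap.sum_apply, Finset.mul_sum]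
  refine Finset.sum_congr rfl fun j _ => ?_
  rw [← mul_smul_comm]
  congr 1
  refine (WithConv.const_mul_apply _ _ _).trans ?_
  rw [Algebra.smul_def, Algebra.commutes]
  rfl

/-- `∑ ⟨a₁ | c₁⟩ c₂ a₂ = ∑ ⟨a₂ | c₂⟩ a₁ c₁`, see `commRel_iff`. -/
def CommRel (a c : H) : Prop :=
  (σ.pairRight (CoalgHom.id k H) c * toConv (CoalgHom.id k H).toLinearMap) a
    = (toConv (CoalgHom.id k H).toLinearMap * σ.pairRight' (CoalgHom.id k H) c) a

theorem commRel_iff {a c : H} {ι κ : Type*} (ra : Coalgebra.Repr k a ι)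
    (rc : Coalgebra.Repr k c κ) : σ.CommRel a c ↔
    ∑ i ∈ ra.index, ∑ j ∈ rc.index, σ.form (ra.left i) (rc.left j) • (rc.right j * ra.right i)
      = ∑ i ∈ ra.index, ∑ j ∈ rc.index,
        σ.form (ra.right i) (rc.right j) • (ra.left i * rc.left j) := by
  rw [CommRel, σ.pairRight_mul_apply _ a c ra rc, σ.mul_pairRight'_apply _ a c ra rc]
  rfl

/-- The commutation relation says that `u` intertwines two algebra maps from `H` to a convolution
algebra. The coalgebra map `u` restricts the first variable to its image, which is needed when the
relation is extended in the second variable alone. -/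
theorem pairRight_eq_iff (u : C →ₗc[k] H) (c : H) :
    σ.pairRight u c * toConv u.toLinearMap = toConv u.toLinearMap * σ.pairRight' u c ↔
      ∀ a, σ.CommRel (u a) c := by
  have key : ∀ a, (σ.pairRight u c * toConv u.toLinearMap) a
      = (toConv u.toLinearMap * σ.pairRight' u c) a ↔ σ.CommRel (u a) c := by
    intro a
    rw [σ.commRel_iff ((ℛ k a).induced u) (ℛ k c), σ.pairRight_mul_apply _ a c (ℛ k a) (ℛ k c),
      σ.mul_pairRight'_apply _ a c (ℛ k a) (ℛ k c)]
    rfl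
  exact ⟨fun h a => (key a).1 (by rw [h]),
    fun h => WithConv.ext (LinearMap.ext fun a => (key a).2 (h a))⟩

section right

variable {σ} {u : C →ₗc[k] H}

theorem commRel_right_mul {c d : H} (hc : ∀ a, σ.CommRel (u a) c) (hd : ∀ a, σ.CommRel (u a) d) :
    ∀ a, σ.CommRel (u a) (c * d) := by
  rw [← pairRight_eq_iff] at *
  rw [map_mul, map_mul, mul_assoc, hd, ← mul_assoc, hc, mul_assoc]

/-- An element intertwining the images of `c` also intertwines the images of its inverse. -/
theorem commRel_right_inv {c d : H} (hc : ∀ a, σ.CommRel (u a) c) (h1 : c * d = 1)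
    (h2 : d * c = 1) : ∀ a, σ.CommRel (u a) d := by
  rw [← pairRight_eq_iff] at *
  have e1 : σ.pairRight u d * σ.pairRight u c = 1 := by rw [← map_mul, h2, map_one]
  have e2 : σ.pairRight' u c * σ.pairRight' u d = 1 := by rw [← map_mul, h1, map_one]
  calc σ.pairRight u d * toConv u.toLinearMap
      = σ.pairRight u d * (toConv u.toLinearMap * σ.pairRight' u c) * σ.pairRight' u d := by
        rw [mul_assoc, mul_assoc, e2, mul_one]
    _ = (σ.pairRight u d * σ.pairRight u c) * toConv u.toLinearMap * σ.pairRight' u d := by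
        rw [← hc, ← mul_assoc]
    _ = _ := by rw [e1, one_mul]

end right

section left

/-- `x ⊗ y` acts by `m ↦ ⟨x | ·⟩ m y`. -/
def leftAct : H ⊗[k] H →ₐ[k] (Module.End k (WithConv (H →ₗ[k] H)))ᵐᵒᵖ :=
  Algebra.TensorProduct.lift
    ((AlgHom.op (Algebra.lmul k (WithConv (H →ₗ[k] H)))).comp
      ((AlgHom.op (ofScalar k H H)).comp σ.leftHom))
    (AlgHom.ofLinearMap ((MulOpposite.opLinearEquiv k).toLinearMap ∘ₗ
        (LinearMap.mul k (WithConv (H →ₗ[k] H))).flip ∘ₗ (WithConv.const (k := k) H).toLinearMap)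
      (MulOpposite.unop_injective (LinearMap.ext fun m => by simp))
      (fun x y => MulOpposite.unop_injective (LinearMap.ext fun m => by simp [mul_assoc])))
    (fun x y => show Commute _ _ from MulOpposite.unop_injective (LinearMap.ext fun m => by
      simp [mul_assoc]))

/-- `x ⊗ y` acts by `m ↦ x m ⟨y | ·⟩`. -/
def leftAct' : H ⊗[k] H →ₐ[k] Module.End k (WithConv (H →ₗ[k] H)) :=
  Algebra.TensorProduct.lift
    ((Algebra.lmul k (WithConv (H →ₗ[k] H))).comp (WithConv.const (k := k) H))
    (AlgHom.ofLinearMap ((LinearMap.mul k (WithConv (H →ₗ[k] H))).flip ∘ₗ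
        (MulOpposite.opLinearEquiv k).symm.toLinearMap ∘ₗ
        ((AlgHom.op (ofScalar k H H)).comp σ.leftHom).toLinearMap)
      (LinearMap.ext fun m => by simp)
      (fun x y => LinearMap.ext fun m => by simp [mul_assoc]))
    (fun x y => show Commute _ _ from LinearMap.ext fun m => by
      simp [mul_assoc])

theorem leftAct_tmul (x y : H) (m : WithConv (H →ₗ[k] H)) :
    (σ.leftAct (x ⊗ₜ y)).unop m
      = ofScalar k H H (σ.leftHom x).unop * (m * WithConv.const (k := k) H y) := by
  rw [leftAct, Algebra.TensorProduct.lift_tmul, MulOpposite.unop_mul, Module.End.mul_apply]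
  exact mul_assoc _ _ _

theorem leftAct'_tmul (x y : H) (m : WithConv (H →ₗ[k] H)) :
    σ.leftAct' (x ⊗ₜ y) m
      = WithConv.const (k := k) H x * (m * ofScalar k H H (σ.leftHom y).unop) := by
  simp [leftAct']

/-- On pure tensors each action multiplies by a scalar functional on one side and by a constant on
the other. Multiplications on opposite sides commute, and on the same side a scalar functional
commutes with a constant. -/
theorem leftAct_leftAct' (Z W : H ⊗[k] H) (m : WithConv (H →ₗ[k] H)) :
    (σ.leftAct Z).unop (σ.leftAct' W m) = σ.leftAct' W ((σ.leftAct Z).unop m) := by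
  induction Z with
  | zero => simp
  | add Z₁ Z₂ h1 h2 => simp only [map_add, MulOpposite.unop_add, LinearMap.add_apply, h1, h2]
  | tmul x y =>
    induction W with
    | zero => simp
    | add W₁ W₂ h1 h2 => simp only [map_add, LinearMap.add_apply, h1, h2]
    | tmul z w =>
      simp only [leftAct_tmul, leftAct'_tmul]
      have e1 := commute_ofScalar_const (B := H) (σ.leftHom x).unop z
      have e2 := commute_ofScalar_const (B := H) (σ.leftHom w).unop y
      rw [← mul_assoc, ← mul_assoc, ← mul_assoc, e1.eq]
      simp only [mul_assoc]
      rw [e2.eq]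

/-- For a fixed first variable, the relation says that two commuting actions of `Δ(a)` agree on the
identity map. -/
theorem leftAct_eq_iff (a : H) :
    (σ.leftAct (comul a)).unop (toConv LinearMap.id) = σ.leftAct' (comul a) (toConv LinearMap.id) ↔
      ∀ c, σ.CommRel a c := by
  have key : ∀ c, (σ.leftAct (comul a)).unop (toConv LinearMap.id) c
      = σ.leftAct' (comul a) (toConv LinearMap.id) c ↔ σ.CommRel a c := by
    intro c
    rw [σ.commRel_iff (ℛ k a) (ℛ k c), ← (ℛ k a).eq, map_sum, map_sum, Finset.unop_sum,
      LinearMap.sum_apply, LinearMap.sum_apply, WithConv.ofConv_sum, WithConv.ofConv_sum,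
      LinearMap.sum_apply, LinearMap.sum_apply]
    refine Eq.congr (Finset.sum_congr rfl fun i _ => ?_) (Finset.sum_congr rfl fun i _ => ?_)
    · rw [leftAct_tmul, (ℛ k c).convMul_apply]
      refine Finset.sum_congr rfl fun j _ => ?_
      rw [WithConv.mul_const_apply, Algebra.smul_def]
      rfl
    · rw [leftAct'_tmul, WithConv.const_mul_apply, (ℛ k c).convMul_apply, Finset.mul_sum]
      refine Finset.sum_congr rfl fun j _ => ?_
      rw [Algebra.smul_def, ← mul_assoc, Algebra.commutes, mul_assoc, mul_assoc]
      rfl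
  exact ⟨fun h c => (key c).1 (by rw [h]),
    fun h => WithConv.ext (LinearMap.ext fun c => (key c).2 (h c))⟩

variable {σ}

theorem commRel_left_algebraMap (x : k) (c : H) : σ.CommRel (algebraMap k H x) c := by
  revert c
  rw [← leftAct_eq_iff, Bialgebra.comul_algebraMap, AlgHom.commutes, AlgHom.commutes]
  rfl

theorem commRel_left_add {a b : H} (ha : ∀ c, σ.CommRel a c) (hb : ∀ c, σ.CommRel b c) :
    ∀ c, σ.CommRel (a + b) c := by
  rw [← leftAct_eq_iff] at *
  simp only [map_add, MulOpposite.unop_add, LinearMap.add_apply, ha, hb]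

/-- One action is an antihomomorphism and the other a homomorphism. The first action of `Δ(a)` on
the identity map is traded for the second, the actions are interchanged, and then `Δ(b)` is traded.
-/
theorem commRel_left_mul {a b : H} (ha : ∀ c, σ.CommRel a c) (hb : ∀ c, σ.CommRel b c) :
    ∀ c, σ.CommRel (a * b) c := by
  rw [← leftAct_eq_iff] at *
  rw [Bialgebra.comul_mul, map_mul, map_mul, MulOpposite.unop_mul, Module.End.mul_apply,
    Module.End.mul_apply, ha, leftAct_leftAct', hb]

theorem commRel_left_inv {a b : H} (ha : ∀ c, σ.CommRel a c) (h1 : a * b = 1)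
    (h2 : b * a = 1) : ∀ c, σ.CommRel b c := by
  rw [← leftAct_eq_iff] at *
  have e1 : ∀ m, (σ.leftAct (comul b)).unop ((σ.leftAct (comul a)).unop m) = m := by
    intro m
    rw [← Module.End.mul_apply, ← MulOpposite.unop_mul, ← map_mul, ← Bialgebra.comul_mul, h1,
      Bialgebra.comul_one, map_one]
    rfl
  have e2 : ∀ m, σ.leftAct' (comul b) (σ.leftAct' (comul a) m) = m := by
    intro m
    rw [← Module.End.mul_apply, ← map_mul, ← Bialgebra.comul_mul, h2, Bialgebra.comul_one, map_one]
    rfl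
  rw [← e2 ((σ.leftAct (comul b)).unop (toConv LinearMap.id)), ← leftAct_leftAct', ← ha, e1]

end left

end SkewPairing


/-! ### The pairing of `A(R)` with itself -/

namespace FRT

open WithConv Coalgebra

variable {k : Type*} [Field k] {n : ℕ} {R : Fin n → Fin n → Fin n → Fin n → k}

theorem induction {P : FRT R → Prop} (algebraMap : ∀ c, P (algebraMap k _ c))
    (T : ∀ i j, P (T R i j)) (mul : ∀ a b, P a → P b → P (a * b))
    (add : ∀ a b, P a → P b → P (a + b)) (a : FRT R) : P a := by
  obtain ⟨x, rfl⟩ := RingQuot.mkAlgHom_surjective k (FRTRel R) a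
  change P (proj R x)
  induction x using FreeAlgebra.induction with
  | grade0 c => rw [AlgHom.commutes]; exact algebraMap c
  | grade1 x => exact T x.1 x.2
  | mul x y hx hy => rw [map_mul]; exact mul _ _ hx hy
  | add x y hx hy => rw [map_add]; exact add _ _ hx hy

/-- The matrix `(T_i^j)`. -/
def genMatrix (R : Fin n → Fin n → Fin n → Fin n → k) : Matrix (Fin n) (Fin n) (FRT R) :=
  Matrix.of fun i j => T R i j

@[simp] theorem genMatrix_apply (i j : Fin n) : genMatrix R i j = T R i j := rfl

/-- The canonical representation of the comultiplication of a generator. -/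
def reprT (i j : Fin n) : Coalgebra.Repr k (T R i j) (Fin n) where
  index := Finset.univ
  left u := T R i u
  right u := T R u j
  eq := (comul_T R i j).symm

/-- The Yang-Baxter equation. -/
def YangBaxter (R : Fin n → Fin n → Fin n → Fin n → k) : Prop :=
  ∀ i j l a b c, ∑ u, ∑ v, ∑ w, R i j u v * R u l a w * R v w b c
    = ∑ u, ∑ v, ∑ w, R j l v w * R i w u c * R u v a b

/-- The representation `T_j^l ↦ (R_{ji}^{lk})_{ik}` of `A(R)`. -/
def rep (h : YangBaxter R) : FRT R →ₐ[k] Matrix (Fin n) (Fin n) k :=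
  lift R (fun j l => Matrix.of fun i m => R j i l m) (by
    intro i j a b
    ext s t
    simp only [Matrix.sum_apply, Matrix.smul_apply, Matrix.mul_apply, Matrix.of_apply, smul_eq_mul,
      Finset.mul_sum]
    refine Eq.trans ?_ ((h j i s a b t).trans ?_)
    · exact Finset.sum_congr rfl fun u _ => Finset.sum_congr rfl fun v _ =>
        Finset.sum_congr rfl fun w _ => by ring
    · rw [Finset.sum_comm]
      exact Finset.sum_congr rfl fun u _ => Finset.sum_congr rfl fun v _ =>
        Finset.sum_congr rfl fun w _ => by ring)

@[simp] theorem rep_T (h : YangBaxter R) (j l i m : Fin n) : rep h (T R j l) i m = R j i l m := by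
  rw [rep, lift_T, Matrix.of_apply]

/-- `A ↦ A ⊗ 1` -/
def kronLeft (k : Type*) [Field k] (n : ℕ) :
    Matrix (Fin n) (Fin n) k →ₐ[k] Matrix (Fin n × Fin n) (Fin n × Fin n) k :=
  AlgHom.ofLinearMap
    { toFun := fun A => Matrix.kronecker A (1 : Matrix (Fin n) (Fin n) k)
      map_add' := fun A B => Matrix.add_kronecker A B 1
      map_smul' := fun c A => Matrix.smul_kronecker c A 1 }
    Matrix.one_kronecker_one (fun A B => by
      have := Matrix.mul_kronecker_mul A B (1 : Matrix (Fin n) (Fin n) k) (1 : Matrix (Fin n) (Fin n) k)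
      rw [mul_one] at this
      exact this)

/-- `A ↦ 1 ⊗ A` -/
def kronRight (k : Type*) [Field k] (n : ℕ) :
    Matrix (Fin n) (Fin n) k →ₐ[k] Matrix (Fin n × Fin n) (Fin n × Fin n) k :=
  AlgHom.ofLinearMap
    { toFun := fun A => Matrix.kronecker (1 : Matrix (Fin n) (Fin n) k) A
      map_add' := fun A B => Matrix.kronecker_add 1 A B
      map_smul' := fun c A => Matrix.kronecker_smul c 1 A }
    Matrix.one_kronecker_one (fun A B => by
      have := Matrix.mul_kronecker_mul (1 : Matrix (Fin n) (Fin n) k) (1 : Matrix (Fin n) (Fin n) k) A B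
      rw [mul_one] at this
      exact this)

theorem kronLeft_mul_kronRight (A B : Matrix (Fin n) (Fin n) k) :
    kronLeft k n A * kronRight k n B = Matrix.kronecker A B := by
  have h := Matrix.mul_kronecker_mul A (1 : Matrix (Fin n) (Fin n) k) (1 : Matrix (Fin n) (Fin n) k) B
  rw [mul_one, one_mul] at h
  exact h.symm

theorem commute_kronLeft_kronRight (A B : Matrix (Fin n) (Fin n) k) :
    Commute (kronLeft k n A) (kronRight k n B) := by
  have h := Matrix.mul_kronecker_mul (1 : Matrix (Fin n) (Fin n) k) A B (1 : Matrix (Fin n) (Fin n) k)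
  rw [mul_one, one_mul] at h
  exact (kronLeft_mul_kronRight A B).trans h

/-- The tensor square of `rep`. -/
def repSquare (h : YangBaxter R) : FRT R →ₐ[k] Matrix (Fin n × Fin n) (Fin n × Fin n) k :=
  (Algebra.TensorProduct.lift ((kronLeft k n).comp (rep h)) ((kronRight k n).comp (rep h))
    (fun _ _ => show Commute _ _ from commute_kronLeft_kronRight _ _)).comp (Bialgebra.comulAlgHom k _)

theorem repSquare_apply (h : YangBaxter R) (a : FRT R) {ι : Type*} (r : Coalgebra.Repr k a ι)
    (i j l m : Fin n) : repSquare h a (i, j) (l, m)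
      = ∑ x ∈ r.index, rep h (r.left x) i l * rep h (r.right x) j m := by
  rw [repSquare, AlgHom.comp_apply, Bialgebra.comulAlgHom_apply, ← r.eq, map_sum, Matrix.sum_apply]
  refine Finset.sum_congr rfl fun x _ => ?_
  rw [Algebra.TensorProduct.lift_tmul]
  exact congrFun (congrFun (kronLeft_mul_kronRight _ _) (i, j)) (l, m)

/-- The matrix `R` as an endomorphism of the tensor square. -/
def braidMatrix (R : Fin n → Fin n → Fin n → Fin n → k) :
    Matrix (Fin n × Fin n) (Fin n × Fin n) k :=
  Matrix.of fun x y => R x.1 x.2 y.2 y.1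

/-- On generators this is the Yang-Baxter equation again, and a commutant is closed under sums and
products. It expresses that the matrix coefficients of `rep` satisfy the defining relations of
`A(R)` under convolution, as `pairHom` requires. -/
theorem commute_braidMatrix_repSquare (h : YangBaxter R) (a : FRT R) :
    Commute (braidMatrix R) (repSquare h a) := by
  induction a using induction with
  | algebraMap c => rw [AlgHom.commutes]; exact (Algebra.commutes c _).symm
  | mul a b ha hb => rw [map_mul]; exact ha.mul_right hb
  | add a b ha hb => rw [map_add]; exact ha.add_right hb
  | T s t =>
    ext ⟨j, i⟩ ⟨b, a⟩
    simp only [Matrix.mul_apply, Fintype.sum_prod_type, repSquare_apply h _ (reprT s t)]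
    simp only [reprT, braidMatrix, Matrix.of_apply, rep_T, Finset.mul_sum, Finset.sum_mul]
    refine Eq.trans ?_ ((h s j i t a b).symm.trans ?_)
    · rw [Finset.sum_comm_cycle]
      refine Finset.sum_congr rfl fun u _ => ?_
      rw [Finset.sum_comm]
      exact Finset.sum_congr rfl fun v _ => Finset.sum_congr rfl fun w _ => by ring
    · rw [Finset.sum_comm]
      refine Finset.sum_congr rfl fun v _ => ?_
      rw [Finset.sum_comm]

/-- The functional `a ↦ rep a i j`. -/
def coeffFun (h : YangBaxter R) (i j : Fin n) : WithConv (FRT R →ₗ[k] k) :=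
  toConv (Matrix.entryLinearMap k k i j ∘ₗ (rep h).toLinearMap)

@[simp] theorem coeffFun_apply (h : YangBaxter R) (i j : Fin n) (a : FRT R) :
    coeffFun h i j a = rep h a i j := rfl

/-- `T_i^k ↦ coeffFun i k`. -/
def pairHom (h : YangBaxter R) : FRT R →ₐ[k] (WithConv (FRT R →ₗ[k] k))ᵐᵒᵖ :=
  lift R (fun i j => MulOpposite.op (coeffFun h i j)) (by
    intro i j a b
    refine MulOpposite.unop_injective (WithConv.ext (LinearMap.ext fun c => ?_))
    have e := congrFun (congrFun (commute_braidMatrix_repSquare h c).eq (j, i)) (b, a)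
    simp only [Matrix.mul_apply, Fintype.sum_prod_type, repSquare_apply h _ (ℛ k c)] at e
    simp only [braidMatrix, Matrix.of_apply] at e
    simp only [Finset.unop_sum, MulOpposite.unop_smul, MulOpposite.unop_mul, MulOpposite.unop_op,
      WithConv.ofConv_sum, WithConv.ofConv_smul, LinearMap.sum_apply, LinearMap.smul_apply,
      (ℛ k c).convMul_apply, coeffFun_apply, smul_eq_mul]
    rw [Finset.sum_comm, e, Finset.sum_comm]
    exact Finset.sum_congr rfl fun u _ => Finset.sum_congr rfl fun v _ => mul_comm _ _)

@[simp] theorem pairHom_T (h : YangBaxter R) (i j : Fin n) :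
    pairHom h (T R i j) = MulOpposite.op (coeffFun h i j) := lift_T _ _ _ _ _

/-- The pairing of `A(R)` with itself such that `⟨T_i^k | T_j^l⟩ = R_{ji}^{lk}`. -/
def pairing (h : YangBaxter R) : SkewPairing k (FRT R) (FRT R) :=
  SkewPairing.ofLeft (pairHom h)
    (by
      refine hom_ext fun i j => MulOpposite.unop_injective (WithConv.ext
        (TensorProduct.ext' fun c d => ?_))
      rw [leftMulHom_apply, leftComulHom_apply _ _ _ _ (reprT i j)]
      simp only [reprT, pairHom_T, MulOpposite.unop_op, coeffFun_apply, map_mul, Matrix.mul_apply])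
    (by
      refine hom_ext fun i j => ?_
      rw [leftOneHom_apply, pairHom_T, MulOpposite.unop_op, coeffFun_apply, map_one,
        Matrix.one_apply]
      exact (counit_T R i j).symm)

theorem pairing_T_left (h : YangBaxter R) (i j : Fin n) (c : FRT R) :
    (pairing h).form (T R i j) c = rep h c i j := by
  rw [pairing, SkewPairing.ofLeft_form, pairHom_T, MulOpposite.unop_op, coeffFun_apply]

theorem pairing_T_T (h : YangBaxter R) (i j l m : Fin n) :
    (pairing h).form (T R i j) (T R l m) = R l i m j := by
  rw [pairing_T_left, rep_T]

theorem commute_map_scalar {B : Type*} [Ring B] [Algebra k B] (A : Matrix (Fin n) (Fin n) k)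
    (b : B) : Commute ((Algebra.ofId k B).mapMatrix A) (Matrix.scalarAlgHom (Fin n) k b) := by
  refine Matrix.ext fun i j => ?_
  simp [Matrix.mul_apply, Matrix.diagonal_apply, Algebra.ofId_apply, Algebra.commutes]

/-- `b ↦ ∑ rep b₁ ⊗ b₂` -/
def repLeft (h : YangBaxter R) : FRT R →ₐ[k] Matrix (Fin n) (Fin n) (FRT R) :=
  (Algebra.TensorProduct.lift ((Algebra.ofId k (FRT R)).mapMatrix.comp (rep h))
    (Matrix.scalarAlgHom (Fin n) k)
    (fun _ _ => show Commute _ _ from commute_map_scalar _ _)).comp (Bialgebra.comulAlgHom k _)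

/-- `b ↦ ∑ b₁ ⊗ rep b₂` -/
def repRight (h : YangBaxter R) : FRT R →ₐ[k] Matrix (Fin n) (Fin n) (FRT R) :=
  (Algebra.TensorProduct.lift (Matrix.scalarAlgHom (Fin n) k)
    ((Algebra.ofId k (FRT R)).mapMatrix.comp (rep h))
    (fun _ _ => show Commute _ _ from (commute_map_scalar _ _).symm)).comp
      (Bialgebra.comulAlgHom k _)

theorem repLeft_apply (h : YangBaxter R) (a : FRT R) {ι : Type*} (r : Coalgebra.Repr k a ι)
    (i j : Fin n) : repLeft h a i j = ∑ x ∈ r.index, rep h (r.left x) i j • r.right x := by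
  rw [repLeft, AlgHom.comp_apply, Bialgebra.comulAlgHom_apply, ← r.eq, map_sum, Matrix.sum_apply]
  refine Finset.sum_congr rfl fun x _ => ?_
  rw [Algebra.TensorProduct.lift_tmul, Algebra.smul_def]
  simp [Matrix.mul_apply, Matrix.diagonal_apply, Algebra.ofId_apply]

theorem repRight_apply (h : YangBaxter R) (a : FRT R) {ι : Type*} (r : Coalgebra.Repr k a ι)
    (i j : Fin n) : repRight h a i j = ∑ x ∈ r.index, rep h (r.right x) i j • r.left x := by
  rw [repRight, AlgHom.comp_apply, Bialgebra.comulAlgHom_apply, ← r.eq, map_sum, Matrix.sum_apply]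
  refine Finset.sum_congr rfl fun x _ => ?_
  rw [Algebra.TensorProduct.lift_tmul, Algebra.smul_def, Algebra.commutes]
  simp [Matrix.mul_apply, Matrix.diagonal_apply, Algebra.ofId_apply]

/-- Both `repLeft` and `repRight` are algebra maps, so the intertwining relation propagates from
generators, where it is the defining relation of `A(R)`. -/
theorem repLeft_mul_genMatrix (h : YangBaxter R) (b : FRT R) :
    repLeft h b * genMatrix R = genMatrix R * repRight h b := by
  induction b using induction with
  | algebraMap c => rw [AlgHom.commutes, AlgHom.commutes, Algebra.commutes]
  | add a b ha hb => rw [map_add, map_add, add_mul, mul_add, ha, hb]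
  | mul a b ha hb => rw [map_mul, map_mul, mul_assoc, hb, ← mul_assoc, ha, mul_assoc]
  | T j l =>
    ext i m
    simp only [Matrix.mul_apply, repLeft_apply h _ (reprT j l), repRight_apply h _ (reprT j l)]
    simp only [reprT, rep_T, genMatrix_apply, Finset.sum_mul, Finset.mul_sum, smul_mul_assoc,
      mul_smul_comm]
    rw [Finset.sum_comm]
    exact rel R i j l m

/-- In the first variable the relation is closed under sums and products; for a generator it is an
entry of the intertwining relation `repLeft_mul_genMatrix`. -/
theorem pairing_commRel (h : YangBaxter R) (a b : FRT R) : (pairing h).CommRel a b := by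
  revert b
  induction a using induction with
  | algebraMap c => exact SkewPairing.commRel_left_algebraMap c
  | add a b ha hb => exact SkewPairing.commRel_left_add ha hb
  | mul a b ha hb => exact SkewPairing.commRel_left_mul ha hb
  | T i m =>
    intro b
    rw [SkewPairing.commRel_iff _ (reprT i m) (ℛ k b)]
    have e := congrFun (congrFun (repLeft_mul_genMatrix h b) i) m
    simp only [Matrix.mul_apply, repLeft_apply h _ (ℛ k b), repRight_apply h _ (ℛ k b),
      genMatrix_apply, Finset.sum_mul, Finset.mul_sum, smul_mul_assoc, mul_smul_comm] at e
    simpa only [reprT, pairing_T_left] using e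

end FRT


/-! ### The coaction of `A(R)` on `Λ(R)` and the quantum determinant -/

theorem sum_antisymm_eq_zero {ι M : Type*} [Fintype ι] [AddCommGroup M] [Module ℂ M]
    (f : ι → ι → M) (h : ∀ u v, f v u = -f u v) : ∑ u, ∑ v, f u v = 0 := by
  have e : ∑ u, ∑ v, f u v = -∑ u, ∑ v, f u v := by
    rw [← Finset.sum_neg_distrib, Finset.sum_comm]
    refine Finset.sum_congr rfl fun u _ => ?_
    rw [← Finset.sum_neg_distrib]
    exact Finset.sum_congr rfl fun v _ => h u v
  have h2 : (2 : ℂ) • ∑ u, ∑ v, f u v = 0 := by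
    rw [two_smul]
    nth_rewrite 2 [e]
    exact add_neg_cancel _
  exact (smul_eq_zero.1 h2).resolve_left two_ne_zero

theorem YangBaxter_cremmerGervais {n : ℕ} {q p : ℂ} (hq : q ≠ 0) (hp : p ≠ 0) :
    FRT.YangBaxter (cremmerGervais n q p) := cremmerGervais_yangBaxter hq hp

/-! ### Products of generators within one row. -/

section rows

variable {n : ℕ} {q p : ℂ}

/-- When both lower indices equal `i`, one side of the defining relation collapses, because
`R_{ii}^{uv}` is non-zero only for `u = v = i`. The weights remove `p` from the other side. -/
theorem cgT_row_relation (hp : p ≠ 0) (i a b : Fin n) :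
    q • (p ^ (-2 * (b : ℤ)) • (cgT n q p i a * cgT n q p i b))
      = ∑ u : Fin n, ∑ v : Fin n, cgCore q v u a b •
        (p ^ (-2 * (v : ℤ)) • (cgT n q p i u * cgT n q p i v)) := by
  have h := FRT.rel (cremmerGervais n q p) i i a b
  have hl : ∑ u, ∑ v, cremmerGervais n q p i i u v • (cgT n q p u a * cgT n q p v b)
      = (p⁻¹ * q) • (cgT n q p i a * cgT n q p i b) := by
    rw [Finset.sum_eq_single i, Finset.sum_eq_single i]
    · simp [cremmerGervais]
    · intro v _ hv
      rw [cremmerGervais_of_ne (by have := Fin.val_ne_of_ne hv; omega), zero_smul]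
    · simp
    · intro u _ hu
      refine Finset.sum_eq_zero fun v _ => ?_
      have : cremmerGervais n q p i i u v = 0 := by
        have hu' := Fin.val_ne_of_ne hu
        simp only [cremmerGervais, if_neg (Ne.symm hu)]
        split_ifs <;> first | omega | simp
      rw [this, zero_smul]
    · simp
  rw [hl] at h
  have h' := congrArg (fun z => (p * p ^ (-2 * (b : ℤ))) • z) h
  simp only [Finset.smul_sum, smul_smul] at h' ⊢
  refine Eq.trans ?_ (h'.trans ?_)
  · congr 1
    field_simp
  · refine Finset.sum_congr rfl fun u _ => Finset.sum_congr rfl fun v _ => ?_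
    congr 1
    rw [cremmerGervais_eq, mul_sub, sub_eq_add_neg, zpow_add₀ hp, neg_mul, neg_mul, zpow_neg,
      zpow_neg]
    have : p ^ (2 * (b : ℤ)) ≠ 0 := zpow_ne_zero _ hp
    field_simp

/-- Induction on the smaller index `b`: in the row relation, everything except the swapped product
cancels once products with an index below `b` are known to be symmetric. -/
theorem cgT_row_symm_of_le (hq : q ≠ 0) (hp : p ≠ 0) (i : Fin n) (m : ℕ) :
    ∀ a b : Fin n, (b : ℕ) = m → b ≤ a →
    p ^ (-2 * (b : ℤ)) • (cgT n q p i a * cgT n q p i b)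
      = p ^ (-2 * (a : ℤ)) • (cgT n q p i b * cgT n q p i a) := by
  induction m using Nat.strong_induction_on with
  | _ m ih =>
  intro a b hb hba
  have hba' : (b : ℕ) ≤ a := hba
  set w : Fin n → Fin n → CGA n q p := fun u v =>
    p ^ (-2 * (v : ℤ)) • (cgT n q p i u * cgT n q p i v) with hw
  have hs : ∀ u v : Fin n, (u : ℕ) < b ∨ (v : ℕ) < b → w u v = w v u := by
    intro u v h
    rcases le_total u v with huv | huv
    · have : (u : ℕ) ≤ v := huv
      exact (ih u (by omega) v u rfl huv).symm
    · have : (v : ℕ) ≤ u := huv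
      exact ih v (by omega) u v rfl huv
  have h := cgT_row_relation (q := q) hp i a b
  -- If `u` or `v` is below `b`, then `w` is symmetric by induction and the coefficients are
  -- antisymmetric. Otherwise the remaining coefficients vanish.
  have h0 : ∑ u : Fin n, ∑ v : Fin n, (if v = a then 0 else cgCore q v u a b) • w u v = 0 := by
    refine sum_antisymm_eq_zero _ fun u v => ?_
    by_cases hsum : (u : ℕ) + v = a + b
    · by_cases huv : (u : ℕ) < b ∨ (v : ℕ) < b
      · rw [hs u v huv, ← neg_smul]
        congr 1
        simp only [cgCore, Fin.ext_iff]
        split_ifs <;> first | omega | ring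
      · have h1 : (u = a ∧ v = b) ∨ (u ≠ a ∧ v ≠ a) ∨ (v = a ∧ u = b) := by
          simp only [Fin.ext_iff, ne_eq]; omega
        have h2 : (if u = a then 0 else cgCore q u v a b) = 0 := by
          simp only [cgCore, Fin.ext_iff]
          split_ifs <;> first | omega | ring
        have h3 : (if v = a then 0 else cgCore q v u a b) = 0 := by
          simp only [cgCore, Fin.ext_iff]
          split_ifs <;> first | omega | ring
        rw [h2, h3, zero_smul, zero_smul, neg_zero]
    · rw [cgCore_of_ne (by omega), cgCore_of_ne (by omega)]
      simp
  have h1 : ∑ u : Fin n, ∑ v : Fin n, cgCore q v u a b • w u v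
      = q • w b a + ∑ u : Fin n, ∑ v : Fin n, (if v = a then 0 else cgCore q v u a b) • w u v := by
    have hd : q • w b a = ∑ u : Fin n, ∑ v : Fin n,
        (if v = a then cgCore q v u a b else 0) • w u v := by
      rw [Finset.sum_eq_single b, Finset.sum_eq_single a]
      · rw [if_pos rfl, cgCore, if_pos rfl, if_pos rfl, if_pos hba']
      · intro v _ hv
        rw [if_neg hv, zero_smul]
      · simp
      · intro u _ hu
        refine Finset.sum_eq_zero fun v _ => ?_
        split_ifs with hv
        · rw [cgCore_of_ne (by rw [hv]; omega), zero_smul]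
        · rw [zero_smul]
      · simp
    rw [hd, ← Finset.sum_add_distrib]
    refine Finset.sum_congr rfl fun u _ => ?_
    rw [← Finset.sum_add_distrib]
    refine Finset.sum_congr rfl fun v _ => ?_
    rw [← add_smul]
    congr 1
    split_ifs <;> ring
  rw [h0, add_zero] at h1
  exact smul_right_injective _ hq (h.trans h1)

theorem cgT_row_symm (hq : q ≠ 0) (hp : p ≠ 0) (i a b : Fin n) :
    p ^ (-2 * (b : ℤ)) • (cgT n q p i a * cgT n q p i b)
      = p ^ (-2 * (a : ℤ)) • (cgT n q p i b * cgT n q p i a) := by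
  rcases le_total b a with h | h
  · exact cgT_row_symm_of_le hq hp i _ a b rfl h
  · exact (cgT_row_symm_of_le hq hp i _ b a rfl h).symm

end rows

namespace CGExt

variable {n : ℕ} {q p : ℂ}

/-- The element `∑ T_i^j ⊗ x_j`. -/
def coactX (n : ℕ) (q p : ℂ) (i : Fin n) : CGA n q p ⊗[ℂ] CGExt n q p :=
  ∑ j, cgT n q p i j ⊗ₜ cgX n q p j

theorem coactX_mul (i j : Fin n) : coactX n q p i * coactX n q p j
    = ∑ a, ∑ b, (cgT n q p i a * cgT n q p j b) ⊗ₜ[ℂ] (cgX n q p a * cgX n q p b) := by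
  simp only [coactX, Finset.sum_mul_sum, Algebra.TensorProduct.tmul_mul_tmul]

theorem quadExpr_cgX (hq : q ≠ 0) (hp : p ≠ 0) (i j : Fin n) :
    quadExpr q p (cgX n q p) i j = 0 :=
  (twistedAnticomm hq hp).quadExpr_eq_zero hq hp i j

/-- The defining relations of `A(R)` move `R` across the tensor sign, from the `T` to the `x`, where
the quadratic relations of `Λ(R)` apply. -/
theorem quadExpr_coactX (hq : q ≠ 0) (hp : p ≠ 0) (i j : Fin n) :
    quadExpr q p (coactX n q p) i j = 0 := by
  have h1 : ∑ k, ∑ l, cremmerGervais n q p i j k l • (coactX n q p k * coactX n q p l)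
      = ∑ u, ∑ v, (cgT n q p j u * cgT n q p i v) ⊗ₜ[ℂ]
        ∑ a, ∑ b, cremmerGervais n q p v u a b • (cgX n q p a * cgX n q p b) := by
    calc _ = ∑ k, ∑ l, ∑ a, ∑ b, (cremmerGervais n q p i j k l • (cgT n q p k a * cgT n q p l b))
          ⊗ₜ[ℂ] (cgX n q p a * cgX n q p b) := by
          simp only [coactX_mul, Finset.smul_sum, TensorProduct.smul_tmul']
      _ = ∑ a, ∑ b, (∑ u, ∑ v, cremmerGervais n q p v u a b • (cgT n q p j u * cgT n q p i v))
          ⊗ₜ[ℂ] (cgX n q p a * cgX n q p b) := by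
          rw [FRT.sum_swap₄]
          simp only [← TensorProduct.sum_tmul]
          simp only [FRT.rel (cremmerGervais n q p) j i]
      _ = _ := by
          simp only [TensorProduct.sum_tmul, TensorProduct.tmul_sum, TensorProduct.tmul_smul,
            TensorProduct.smul_tmul']
          exact FRT.sum_swap₄ _
  rw [quadExpr, h1, coactX_mul]
  simp only [Finset.smul_sum, ← TensorProduct.tmul_smul, ← Finset.sum_add_distrib,
    ← TensorProduct.tmul_add]
  refine Finset.sum_eq_zero fun u _ => Finset.sum_eq_zero fun v _ => ?_
  have h := quadExpr_cgX (n := n) hq hp v u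
  rw [quadExpr] at h
  simp only [Finset.smul_sum] at h
  rw [h, TensorProduct.tmul_zero]

/-- Products within a row of `T` are symmetric and products of the `x` antisymmetric, with
reciprocal powers of `p`. The double sum is therefore antisymmetric. The argument works also for
`q^2 = -1`, where the squares do not follow from the quadratic relations. -/
theorem coactX_mul_self (hq : q ≠ 0) (hp : p ≠ 0) (i : Fin n) :
    coactX n q p i * coactX n q p i = 0 := by
  rw [coactX_mul]
  refine sum_antisymm_eq_zero _ fun u v => ?_
  have h1 := cgT_row_symm hq hp i u v
  have h2 := twistedAnticomm (n := n) hq hp u v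
  have hu : p ^ (-2 * (u : ℤ)) ≠ 0 := zpow_ne_zero _ hp
  have hv : p ^ (-2 * (v : ℤ)) ≠ 0 := zpow_ne_zero _ hp
  refine smul_right_injective _ (mul_ne_zero hu hv) ?_
  change (_ * _) • _ = (_ * _) • _
  calc (p ^ (-2 * (u : ℤ)) * p ^ (-2 * (v : ℤ))) • ((cgT n q p i v * cgT n q p i u) ⊗ₜ[ℂ]
        (cgX n q p v * cgX n q p u))
      = (p ^ (-2 * (u : ℤ)) • (cgT n q p i v * cgT n q p i u)) ⊗ₜ[ℂ]
        (p ^ (-2 * (v : ℤ)) • (cgX n q p v * cgX n q p u)) := by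
        rw [TensorProduct.smul_tmul_smul]
    _ = (p ^ (-2 * (v : ℤ)) • (cgT n q p i u * cgT n q p i v)) ⊗ₜ[ℂ]
        (-(p ^ (-2 * (u : ℤ)) • (cgX n q p u * cgX n q p v))) := by
        rw [h1, eq_neg_of_add_eq_zero_right h2]
    _ = _ := by
        rw [TensorProduct.tmul_neg, TensorProduct.smul_tmul_smul, smul_neg, mul_comm]

/-- The coaction of `A(R)` on `Λ(R)`. -/
def coact (hq : q ≠ 0) (hp : p ≠ 0) : CGExt n q p →ₐ[ℂ] CGA n q p ⊗[ℂ] CGExt n q p :=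
  lift (coactX n q p) (quadExpr_coactX hq hp) (coactX_mul_self hq hp)

@[simp] theorem coact_cgX (hq : q ≠ 0) (hp : p ≠ 0) (i : Fin n) :
    coact hq hp (cgX n q p i) = ∑ j, cgT n q p i j ⊗ₜ cgX n q p j :=
  lift_cgX _ _ _ _

theorem prod_ofFn_tmul {A B : Type*} [Ring A] [Algebra ℂ A] [Ring B] [Algebra ℂ B] {m : ℕ}
    (a : Fin m → A) (b : Fin m → B) : (List.ofFn fun i => a i ⊗ₜ[ℂ] b i).prod
      = (List.ofFn a).prod ⊗ₜ (List.ofFn b).prod := by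
  induction m with
  | zero => simp [Algebra.TensorProduct.one_def]
  | succ m ih =>
    simp only [List.ofFn_succ, List.prod_cons, ih, Algebra.TensorProduct.tmul_mul_tmul]

/-- Multilinear expansion gives a sum over all maps `f`. A repeated letter kills the non-injective
terms, and the other terms reorder to multiples of the top form with scalars `a_σ`. -/
theorem coact_cgTop (hq : q ≠ 0) (hp : p ≠ 0) :
    coact hq hp (cgTop n q p) = cgDet n q p ⊗ₜ cgTop n q p := by
  have h1 : coact hq hp (cgTop n q p) = ∑ f : Fin n → Fin n,
      (List.ofFn fun i => cgT n q p i (f i)).prod ⊗ₜ[ℂ] (List.ofFn fun i => cgX n q p (f i)).prod := by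
    have e := MultilinearMap.map_sum (MultilinearMap.mkPiAlgebraFin ℂ n
      (CGA n q p ⊗[ℂ] CGExt n q p)) (fun i j => cgT n q p i j ⊗ₜ[ℂ] cgX n q p j)
    simp only [MultilinearMap.mkPiAlgebraFin_apply, prod_ofFn_tmul] at e
    rw [← e, cgTop, map_list_prod, List.map_ofFn]
    congr 2
    funext i
    exact coact_cgX hq hp i
  rw [h1, cgDet, TensorProduct.sum_tmul]
  symm
  refine Fintype.sum_of_injective (fun σ : Equiv.Perm (Fin n) => (σ : Fin n → Fin n))
    DFunLike.coe_injective _ _ ?_ ?_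
  · intro f hf
    have hinj : ¬ Function.Injective f := fun h =>
      hf ⟨Equiv.ofBijective f (Finite.injective_iff_bijective.1 h), rfl⟩
    have h0 := prod_eq_zero_of_not_nodup hp (twistedAnticomm (n := n) hq hp) (l := List.ofFn f)
      (by rwa [List.nodup_ofFn])
    rw [List.map_ofFn] at h0
    change _ ⊗ₜ[ℂ] (List.ofFn (cgX n q p ∘ f)).prod = 0
    rw [h0, TensorProduct.tmul_zero]
  · intro σ
    have h0 := prod_perm_eq (n := n) hq hp σ
    rw [List.map_ofFn] at h0
    change _ = _ ⊗ₜ[ℂ] (List.ofFn (cgX n q p ∘ σ)).prod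
    rw [h0, TensorProduct.tmul_smul, TensorProduct.smul_tmul']

/-- `a ⊗ x ↦ φ(x) a` -/
def slice {A Λ : Type*} [Ring A] [Algebra ℂ A] [AddCommGroup Λ] [Module ℂ Λ] (φ : Λ →ₗ[ℂ] ℂ) :
    A ⊗[ℂ] Λ →ₗ[ℂ] A :=
  (TensorProduct.rid ℂ A).toLinearMap ∘ₗ LinearMap.lTensor A φ

@[simp] theorem slice_tmul {A Λ : Type*} [Ring A] [Algebra ℂ A] [AddCommGroup Λ] [Module ℂ Λ]
    (φ : Λ →ₗ[ℂ] ℂ) (a : A) (x : Λ) : slice φ (a ⊗ₜ[ℂ] x) = φ x • a := by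
  simp [slice]

theorem coact_coassoc (hq : q ≠ 0) (hp : p ≠ 0) (x : CGExt n q p) :
    Algebra.TensorProduct.assoc ℂ ℂ ℂ _ _ _ (Algebra.TensorProduct.map
      (Bialgebra.comulAlgHom ℂ (CGA n q p)) (AlgHom.id ℂ (CGExt n q p)) (coact hq hp x))
      = Algebra.TensorProduct.map (AlgHom.id ℂ (CGA n q p)) (coact hq hp) (coact hq hp x) := by
  refine DFunLike.congr_fun (hom_ext (f := (Algebra.TensorProduct.assoc ℂ ℂ ℂ (CGA n q p)
    (CGA n q p) (CGExt n q p)).toAlgHom.comp ((Algebra.TensorProduct.map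
      (Bialgebra.comulAlgHom ℂ (CGA n q p)) (AlgHom.id ℂ (CGExt n q p))).comp (coact hq hp)))
    (g := (Algebra.TensorProduct.map (AlgHom.id ℂ (CGA n q p)) (coact hq hp)).comp (coact hq hp))
    fun i => ?_) x
  simp only [AlgHom.comp_apply, coact_cgX, map_sum, Algebra.TensorProduct.map_tmul,
    Bialgebra.comulAlgHom_apply, FRT.comul_T, AlgHom.id_apply, TensorProduct.sum_tmul,
    TensorProduct.tmul_sum]
  rw [Finset.sum_comm]
  rfl

theorem coact_counit (hq : q ≠ 0) (hp : p ≠ 0) (x : CGExt n q p) :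
    Algebra.TensorProduct.lid ℂ _ (Algebra.TensorProduct.map
      (Bialgebra.counitAlgHom ℂ (CGA n q p)) (AlgHom.id ℂ (CGExt n q p)) (coact hq hp x)) = x := by
  refine DFunLike.congr_fun (hom_ext (f := (Algebra.TensorProduct.lid ℂ
    (CGExt n q p)).toAlgHom.comp ((Algebra.TensorProduct.map
      (Bialgebra.counitAlgHom ℂ (CGA n q p)) (AlgHom.id ℂ (CGExt n q p))).comp (coact hq hp)))
    (g := AlgHom.id ℂ _) fun i => ?_) x
  simp [coact_cgX]

end CGExt

/-! ### The quantum determinant is group-like. -/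

section det

variable {n : ℕ} {q p : ℂ}

/-- Coassociativity of the coaction on the top form, with the coefficient of the top form extracted
from the last tensor factor. -/
theorem comul_cgDet (hq : q ≠ 0) (hp : p ≠ 0) :
    Coalgebra.comul (R := ℂ) (cgDet n q p) = cgDet n q p ⊗ₜ cgDet n q p := by
  have h := CGExt.coact_coassoc hq hp (cgTop n q p)
  rw [CGExt.coact_cgTop, Algebra.TensorProduct.map_tmul, Algebra.TensorProduct.map_tmul,
    CGExt.coact_cgTop] at h
  have key : ∀ z : CGA n q p ⊗[ℂ] CGA n q p, LinearMap.lTensor _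
      (CGExt.slice (CGExt.topCoeff hq hp)) (Algebra.TensorProduct.assoc ℂ ℂ ℂ _ _ _
        (z ⊗ₜ[ℂ] cgTop n q p)) = z := by
    intro z
    induction z with
    | zero => simp
    | add x y hx hy => rw [TensorProduct.add_tmul, map_add, map_add, hx, hy]
    | tmul x y => simp [CGExt.topCoeff_cgTop]
  have h' := congrArg (LinearMap.lTensor _ (CGExt.slice (CGExt.topCoeff hq hp))) h
  rw [AlgHom.id_apply, key] at h'
  simpa [CGExt.topCoeff_cgTop] using h'

theorem counit_cgDet (hq : q ≠ 0) (hp : p ≠ 0) : Coalgebra.counit (R := ℂ) (cgDet n q p) = 1 := by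
  have h := congrArg (CGExt.topCoeff hq hp) (CGExt.coact_counit hq hp (cgTop n q p))
  rw [CGExt.coact_cgTop] at h
  simpa [CGExt.topCoeff_cgTop] using h

end det


/-! ### Evaluation of the pairing on the quantum determinant -/

section weights

theorem prod_range_zpow {p : ℂ} (hp : p ≠ 0) (i : ℤ) (m : ℕ) :
    ∏ a ∈ Finset.range m, p⁻¹ * p ^ (2 * (i - a)) = p ^ (2 * i * m - (m : ℤ) ^ 2) := by
  induction m with
  | zero => simp
  | succ m ih =>
    rw [Finset.prod_range_succ, ih, ← zpow_neg_one, ← zpow_add₀ hp, ← zpow_add₀ hp]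
    congr 1
    push_cast
    ring

theorem prod_range_ite {q : ℂ} (hq : q ≠ 0) (i m : ℕ) :
    ∏ a ∈ Finset.range m, (if i ≤ a then q else q⁻¹) = q ^ ((m : ℤ) - 2 * (min i m : ℕ)) := by
  induction m with
  | zero => simp
  | succ m ih =>
    rw [Finset.prod_range_succ, ih]
    split_ifs with h
    · rw [← zpow_add_one₀ hq]
      congr 1
      omega
    · rw [← zpow_sub_one₀ hq]
      congr 1
      omega

variable {n : ℕ} {q p : ℂ}

/-- The powers of `p` combine to `p^(2in - n^2)`. There are `n - i` factors `q` and `i` factors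
`q⁻¹`, so both contributions have the exponent `n - 2i` of `q p^(-n)`. -/
theorem prod_cremmerGervais_right (hq : q ≠ 0) (hp : p ≠ 0) (i : Fin n) :
    ∏ a, cremmerGervais n q p a i a i = (q * (p ^ n)⁻¹) ^ ((n : ℤ) - 2 * (i : ℤ)) := by
  have h : ∀ a : Fin n, cremmerGervais n q p a i a i
      = (p⁻¹ * p ^ (2 * ((i : ℤ) - a))) * (if (i : ℕ) ≤ a then q else q⁻¹) := fun a => by
    rw [cremmerGervais, if_pos rfl, if_pos rfl]
    rfl
  simp only [h]
  rw [Finset.prod_mul_distrib,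
    Fin.prod_univ_eq_prod_range (fun a : ℕ => p⁻¹ * p ^ (2 * ((i : ℤ) - a))) n,
    Fin.prod_univ_eq_prod_range (fun a : ℕ => if (i : ℕ) ≤ a then q else q⁻¹) n,
    prod_range_zpow hp, prod_range_ite hq, mul_zpow, ← zpow_natCast, ← zpow_neg, ← zpow_mul,
    mul_comm]
  congr 2
  · rw [min_eq_left i.2.le]
  · ring

theorem prod_cremmerGervais_left (hq : q ≠ 0) (hp : p ≠ 0) (j : Fin n) :
    ∏ a, cremmerGervais n q p j a j a = (q * (p ^ n)⁻¹) ^ (2 * (j : ℤ) + 2 - n) := by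
  -- Each factor is the reciprocal of the one for the other side with index `j + 1`. The shift comes
  -- from the diagonal case, which carries `q` rather than `q⁻¹`; `j + 1` may equal `n`, so it is
  -- treated as a natural number.
  have h : ∀ a : Fin n, cremmerGervais n q p j a j a
      = ((p⁻¹ * p ^ (2 * ((j : ℤ) + 1 - a))) * (if (j : ℕ) + 1 ≤ a then q else q⁻¹))⁻¹ := fun a => by
    have e : p⁻¹ * p ^ (2 * ((a : ℤ) - j)) = (p⁻¹ * p ^ (2 * ((j : ℤ) + 1 - a)))⁻¹ := by
      rw [← zpow_neg_one, ← zpow_add₀ hp, ← zpow_add₀ hp, ← zpow_neg]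
      congr 1
      ring
    have e2 : (if a ≤ j then q else q⁻¹) = (if (j : ℕ) + 1 ≤ a then q else q⁻¹)⁻¹ := by
      by_cases hh : a ≤ j
      · have : (a : ℕ) ≤ j := hh
        rw [if_pos hh, if_neg (by omega), inv_inv]
      · have : ¬ (a : ℕ) ≤ j := hh
        rw [if_neg hh, if_pos (by omega)]
    rw [cremmerGervais, if_pos rfl, if_pos rfl, e, e2, ← mul_inv]
  simp only [h]
  rw [Finset.prod_inv_distrib, Finset.prod_mul_distrib,
    Fin.prod_univ_eq_prod_range (fun a : ℕ => p⁻¹ * p ^ (2 * ((j : ℤ) + 1 - a))) n,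
    Fin.prod_univ_eq_prod_range (fun a : ℕ => if (j : ℕ) + 1 ≤ a then q else q⁻¹) n,
    prod_range_zpow hp, prod_range_ite hq, mul_zpow, ← zpow_natCast, ← zpow_neg, ← zpow_mul,
    mul_comm, mul_inv, ← zpow_neg, ← zpow_neg]
  congr 2
  · rw [min_eq_left (by omega)]
    push_cast
    ring
  · ring

theorem eq_or_natAbs_lt_of_cremmerGervais_ne_zero {a i l m : Fin n}
    (h : cremmerGervais n q p a i l m ≠ 0) :
    (l = a ∧ m = i) ∨ l = i ∨ ((l : ℤ) - i).natAbs < ((a : ℤ) - i).natAbs := by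
  by_contra hc
  apply h
  simp only [cremmerGervais, Fin.ext_iff] at *
  split_ifs <;> first | omega | simp

theorem eq_or_natAbs_lt_of_cremmerGervais_ne_zero' {a j l m : Fin n}
    (h : cremmerGervais n q p j a l m ≠ 0) :
    (l = j ∧ m = a) ∨ m = j ∨ ((m : ℤ) - j).natAbs < ((a : ℤ) - j).natAbs := by
  by_contra hc
  apply h
  simp only [cremmerGervais, Fin.ext_iff] at *
  split_ifs <;> first | omega | simp

end weights

/-- Words without repetitions such that each letter is closer to `i` than the letters to its left,
or equally close. -/
inductive CenteredWord {n : ℕ} (i : Fin n) : List (Fin n) → Prop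
  | nil : CenteredWord i []
  | cons (a : Fin n) (w : List (Fin n)) : CenteredWord i w → a ∉ i :: w →
      (∀ l : Fin n, ((l : ℤ) - i).natAbs < ((a : ℤ) - i).natAbs → l ∈ i :: w) →
      CenteredWord i (a :: w)

namespace CenteredWord

variable {n : ℕ} {i : Fin n}

theorem nodup {w : List (Fin n)} (h : CenteredWord i w) : (i :: w).Nodup := by
  induction h with
  | nil => simp
  | cons a w _ ha _ ih =>
    simp only [List.nodup_cons, List.mem_cons, not_or] at *
    exact ⟨⟨fun h => ha.1 h.symm, ih.1⟩, ha.2, ih.2⟩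

/-- Greedy construction: among the unused letters, one nearest to `i` is put in front. -/
theorem exists_of_lt (m : ℕ) (hm : m < n) : ∃ w, CenteredWord i w ∧ w.length = m := by
  induction m with
  | zero => exact ⟨[], .nil, rfl⟩
  | succ m ih =>
    obtain ⟨w, hw, hl⟩ := ih (by omega)
    have hne : (Finset.univ.filter fun a => a ∉ i :: w).Nonempty := by
      by_contra hc
      rw [Finset.not_nonempty_iff_eq_empty, Finset.filter_eq_empty_iff] at hc
      have h1 : (i :: w).toFinset = Finset.univ := by
        ext a
        have h := hc (Finset.mem_univ a)
        rw [not_not] at h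
        simpa using h
      have h2 := List.toFinset_card_of_nodup hw.nodup
      rw [h1, Finset.card_univ, Fintype.card_fin, List.length_cons] at h2
      omega
    obtain ⟨a, ha, hmin⟩ := Finset.exists_min_image _ (fun a : Fin n => ((a : ℤ) - i).natAbs) hne
    refine ⟨a :: w, .cons a w hw (Finset.mem_filter.1 ha).2 fun l hl => ?_, by simp [hl]⟩
    by_contra hc
    exact absurd (hmin l (Finset.mem_filter.2 ⟨Finset.mem_univ _, hc⟩)) (not_le.2 hl)

theorem exists_perm (i : Fin n) :
    ∃ w, CenteredWord i w ∧ (i :: w).Perm (List.finRange n) := by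
  have := i.2
  obtain ⟨w, hw, hl⟩ := exists_of_lt (i := i) (n - 1) (by omega)
  refine ⟨w, hw, List.perm_of_nodup_nodup_toFinset_eq hw.nodup (List.nodup_finRange n) ?_⟩
  rw [List.toFinset_finRange]
  refine Finset.eq_univ_of_card _ ?_
  rw [List.toFinset_card_of_nodup hw.nodup, List.length_cons, Fintype.card_fin]
  omega

end CenteredWord

/-! ### Triangular evaluation of matrix-valued products along centered words. -/

namespace CGExt

variable {n : ℕ} {q p : ℂ}

/-- Replacing a letter `a` through `R` produces `a` itself, `i`, or letters nearer to `i` than `a`.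
In a centered word the last two kinds already occur to the left, so their products vanish and only
the diagonal term survives. The scalar `s` is `1` for the pairing and `-q⁻¹p` for the skew
derivations. -/
theorem cgX_mul_prod_apply (hq : q ≠ 0) (hp : p ≠ 0) (s : ℂ)
    {y : Fin n → Matrix (Fin n) (Fin n) (CGExt n q p)}
    (hy : ∀ a i k, y a i k = s • ∑ l, cremmerGervais n q p a i l k • cgX n q p l)
    {i : Fin n} {w : List (Fin n)} (hw : CenteredWord i w) (k : Fin n) :
    cgX n q p i * (w.reverse.map y).prod i k
      = if k = i then (w.map fun a => s * cremmerGervais n q p a i a i).prod •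
          (cgX n q p i * (w.reverse.map (cgX n q p)).prod) else 0 := by
  induction hw generalizing k with
  | nil => simp [Matrix.one_apply, eq_comm]
  | cons a w hw ha hl ih =>
    rw [List.reverse_cons, List.map_append, List.prod_append, List.map_singleton,
      List.prod_singleton, List.map_append, List.prod_append, List.map_singleton,
      List.prod_singleton, List.map_cons, List.prod_cons]
    simp only [Matrix.mul_apply, Finset.mul_sum, ← mul_assoc, ih]
    rw [Finset.sum_eq_single i (fun m _ hm => by rw [if_neg hm, zero_mul]) (by simp), if_pos rfl,
      hy, smul_mul_smul_comm, Finset.mul_sum, Finset.sum_eq_single a]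
    · split_ifs with hk
      · rw [hk, mul_smul_comm, smul_smul]
        congr 1
        ring
      · rw [cremmerGervais_of_ne (by have := Fin.val_ne_of_ne hk; omega), zero_smul, mul_zero,
          smul_zero]
    · intro l _ hla
      by_cases hR : cremmerGervais n q p a i l k = 0
      · rw [hR, zero_smul, mul_zero]
      · have hmem : l ∈ i :: w.reverse := by
          rcases eq_or_natAbs_lt_of_cremmerGervais_ne_zero hR with h | h | h
          · exact absurd h.1 hla
          · simp [h]
          · simpa using hl l h
        have h0 := prod_mul_eq_zero_of_mem hp (twistedAnticomm (n := n) hq hp) hmem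
        rw [List.map_cons, List.prod_cons] at h0
        rw [mul_smul_comm, h0, smul_zero]
    · simp

/-- Mirror image of `cgX_mul_prod_apply`: the distinguished letter stands on the right, and
superfluous letters are killed by equal ones to their right. -/
theorem prod_apply_mul_cgX (hq : q ≠ 0) (hp : p ≠ 0)
    {y : Fin n → Matrix (Fin n) (Fin n) (CGExt n q p)} {j : Fin n}
    (hy : ∀ a l, y a l j = ∑ m, cremmerGervais n q p j a l m • cgX n q p m)
    {w : List (Fin n)} (hw : CenteredWord j w) (l : Fin n) :
    (w.map y).prod l j * cgX n q p j
      = if l = j then (w.map fun a => cremmerGervais n q p j a j a).prod •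
          ((w.map (cgX n q p)).prod * cgX n q p j) else 0 := by
  induction hw generalizing l with
  | nil => simp [Matrix.one_apply]
  | cons a w hw ha hl ih =>
    simp only [List.map_cons, List.prod_cons, Matrix.mul_apply, Finset.sum_mul, mul_assoc, ih]
    rw [Finset.sum_eq_single j (fun m _ hm => by rw [if_neg hm, mul_zero]) (by simp), if_pos rfl,
      hy, mul_smul_comm, Finset.sum_mul, Finset.sum_eq_single a]
    · split_ifs with hk
      · rw [hk, smul_mul_assoc, smul_smul, mul_comm]
      · rw [cremmerGervais_of_ne (by have := Fin.val_ne_of_ne hk; omega), zero_smul, zero_mul,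
          smul_zero]
    · intro m _ hma
      by_cases hR : cremmerGervais n q p j a l m = 0
      · rw [hR, zero_smul, zero_mul]
      · have hmem : m ∈ w ++ [j] := by
          rcases eq_or_natAbs_lt_of_cremmerGervais_ne_zero' hR with h | h | h
          · exact absurd h.2 hma
          · simp [h]
          · have := hl m h
            simp only [List.mem_cons, List.mem_append, List.not_mem_nil, or_false] at this ⊢
            exact this.symm
        have h0 := mul_prod_eq_zero_of_mem hp (twistedAnticomm (n := n) hq hp) hmem
        rw [List.map_append, List.prod_append, List.map_cons, List.map_nil, List.prod_singleton]
          at h0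
        rw [smul_mul_assoc, h0, smul_zero]
    · simp

theorem cremmerGervais_same (i l m : Fin n) :
    cremmerGervais n q p i i l m = if l = i ∧ m = i then p⁻¹ * q else 0 := by
  by_cases h : l = i ∧ m = i
  · rw [if_pos h, h.1, h.2]
    simp [cremmerGervais]
  · rw [if_neg h]
    simp only [cremmerGervais, Fin.ext_iff] at *
    split_ifs <;> first | omega | simp

/-- A representation of `A(R)` applied to the first tensor factor. -/
def matTensor {A Λ : Type*} [Ring A] [Algebra ℂ A] [Ring Λ] [Algebra ℂ Λ]
    (L : A →ₐ[ℂ] Matrix (Fin n) (Fin n) ℂ) : A ⊗[ℂ] Λ →ₐ[ℂ] Matrix (Fin n) (Fin n) Λ :=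
  Algebra.TensorProduct.lift ((Algebra.ofId ℂ Λ).mapMatrix.comp L) (Matrix.scalarAlgHom (Fin n) ℂ)
    (fun _ _ => show Commute _ _ from FRT.commute_map_scalar _ _)

theorem matTensor_tmul_apply {A Λ : Type*} [Ring A] [Algebra ℂ A] [Ring Λ] [Algebra ℂ Λ]
    (L : A →ₐ[ℂ] Matrix (Fin n) (Fin n) ℂ) (a : A) (x : Λ) (i j : Fin n) :
    matTensor L (a ⊗ₜ[ℂ] x) i j = L a i j • x := by
  rw [matTensor, Algebra.TensorProduct.lift_tmul, Algebra.smul_def]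
  simp [Matrix.mul_apply, Matrix.diagonal_apply, Algebra.ofId_apply]

theorem matTensor_coact_cgX (hq : q ≠ 0) (hp : p ≠ 0)
    (L : CGA n q p →ₐ[ℂ] Matrix (Fin n) (Fin n) ℂ) (a i k : Fin n) :
    matTensor L (coact hq hp (cgX n q p a)) i k = ∑ l, L (cgT n q p a l) i k • cgX n q p l := by
  rw [coact_cgX, map_sum, Matrix.sum_apply]
  simp only [matTensor_tmul_apply]

/-- The determinant is the coefficient for any ordering of the letters, since orderings differ by
scalars. This leaves the choice of a convenient ordering. -/
theorem matTensor_coact_prod (hq : q ≠ 0) (hp : p ≠ 0)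
    (L : CGA n q p →ₐ[ℂ] Matrix (Fin n) (Fin n) ℂ) {w : List (Fin n)}
    (hw : w.Perm (List.finRange n)) (i k : Fin n) :
    (w.map fun a => matTensor L (coact hq hp (cgX n q p a))).prod i k
      = L (cgDet n q p) i k • (w.map (cgX n q p)).prod := by
  obtain ⟨c, -, hc⟩ := exists_prod_eq_smul_cgTop hq hp hw
  have h : (w.map fun a => matTensor L (coact hq hp (cgX n q p a))).prod
      = matTensor L (coact hq hp (w.map (cgX n q p)).prod) := by
    rw [map_list_prod, map_list_prod, List.map_map, List.map_map]
    rfl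
  rw [h, hc, map_smul, map_smul, coact_cgTop, Matrix.smul_apply, matTensor_tmul_apply, smul_comm]

theorem topCoeff_prod_ne_zero (hq : q ≠ 0) (hp : p ≠ 0) {w : List (Fin n)}
    (hw : w.Perm (List.finRange n)) : topCoeff hq hp (w.map (cgX n q p)).prod ≠ 0 := by
  obtain ⟨c, h0, hc⟩ := exists_prod_eq_smul_cgTop hq hp hw
  rwa [hc, map_smul, topCoeff_cgTop, smul_eq_mul, mul_one]

theorem list_prod_eq_prod {w : List (Fin n)} (hw : w.Perm (List.finRange n)) (f : Fin n → ℂ) :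
    (w.map f).prod = ∏ a, f a := by
  rw [(hw.map f).prod_eq, Fin.prod_univ_def]

end CGExt

section

variable {n : ℕ} {q p : ℂ}

open CGExt

/-- `⟨T_i^k | det_q⟩ = δ_{ik} κ^{n - 2i}` with `κ = q p^{-n}`. -/
theorem rep_cgDet (hq : q ≠ 0) (hp : p ≠ 0) (i k : Fin n) :
    FRT.rep (YangBaxter_cremmerGervais hq hp) (cgDet n q p) i k
      = if k = i then (q * (p ^ n)⁻¹) ^ ((n : ℤ) - 2 * (i : ℤ)) else 0 := by
  set L := FRT.rep (YangBaxter_cremmerGervais (n := n) hq hp)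
  set y := fun a => matTensor L (coact hq hp (cgX n q p a)) with hy
  have hy1 : ∀ a i k, y a i k = (1 : ℂ) • ∑ l, cremmerGervais n q p a i l k • cgX n q p l := by
    intro a i k
    rw [one_smul]
    refine (matTensor_coact_cgX hq hp L a i k).trans ?_
    simp only [L, FRT.rep_T]
  -- The ordering is `i` first, then the other letters by non-decreasing distance from `i`.
  obtain ⟨w, hw, hperm⟩ := CenteredWord.exists_perm i
  have hperm' : (i :: w.reverse).Perm (List.finRange n) := (w.reverse_perm.cons i).trans hperm
  have h1 := matTensor_coact_prod hq hp L hperm' i k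
  -- Row `i` of the matrix belonging to the letter `i` has a single non-zero entry, the diagonal
  -- one.
  have h2 : ((i :: w.reverse).map y).prod i k
      = (p⁻¹ * q) • (cgX n q p i * (w.reverse.map y).prod i k) := by
    rw [List.map_cons, List.prod_cons, Matrix.mul_apply, Finset.sum_eq_single i]
    · rw [hy1, one_smul, Finset.sum_eq_single i]
      · rw [cremmerGervais_same, if_pos ⟨rfl, rfl⟩, smul_mul_assoc]
      · intro l _ hl
        rw [cremmerGervais_same, if_neg (fun h => hl h.1), zero_smul]
      · simp
    · intro m _ hm
      rw [hy1, one_smul, Finset.sum_eq_zero, zero_mul]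
      intro l _
      rw [cremmerGervais_same, if_neg (fun h => hm h.2), zero_smul]
    · simp
  have h3 := congrArg (topCoeff hq hp) (h1.symm.trans h2)
  have h0 := topCoeff_prod_ne_zero hq hp hperm'
  rw [cgX_mul_prod_apply hq hp 1 hy1 hw k] at h3
  rw [List.map_cons, List.prod_cons] at h3 h0
  rw [map_smul, smul_eq_mul] at h3
  refine mul_right_cancel₀ h0 (h3.trans ?_)
  split_ifs with hk
  · rw [map_smul, map_smul, smul_smul, smul_eq_mul]
    congr 1
    rw [← prod_cremmerGervais_right hq hp, ← list_prod_eq_prod hperm, List.map_cons, List.prod_cons,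
      cremmerGervais_same, if_pos ⟨rfl, rfl⟩]
    simp only [one_mul]
  · simp

/-- The representation `a ↦ (⟨a | T_j^l⟩)_{lj}`. -/
def corep (hq : q ≠ 0) (hp : p ≠ 0) : CGA n q p →ₐ[ℂ] Matrix (Fin n) (Fin n) ℂ :=
  AlgHom.ofLinearMap
    { toFun := fun a => Matrix.of fun l j =>
        (FRT.pairing (YangBaxter_cremmerGervais hq hp)).form a (cgT n q p j l)
      map_add' := fun a b => by ext; simp
      map_smul' := fun c a => by ext; simp }
    (by
      ext l j
      simp [SkewPairing.one_left_apply, Matrix.one_apply, eq_comm])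
    (fun a b => by
      ext l j
      simp only [LinearMap.coe_mk, AddHom.coe_mk, Matrix.of_apply, Matrix.mul_apply]
      rw [SkewPairing.mul_left_apply _ _ _ _ (FRT.reprT j l)]
      exact Finset.sum_congr rfl fun u _ => mul_comm _ _)

theorem corep_apply (hq : q ≠ 0) (hp : p ≠ 0) (a : CGA n q p) (l j : Fin n) :
    corep hq hp a l j
      = (FRT.pairing (YangBaxter_cremmerGervais hq hp)).form a (cgT n q p j l) := rfl

/-- `⟨det_q | T_j^l⟩ = δ_{jl} κ^{2j + 2 - n}` with `κ = q p^{-n}`. -/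
theorem corep_cgDet (hq : q ≠ 0) (hp : p ≠ 0) (l j : Fin n) :
    corep hq hp (cgDet n q p) l j
      = if l = j then (q * (p ^ n)⁻¹) ^ (2 * (j : ℤ) + 2 - n) else 0 := by
  set L := corep (n := n) hq hp with hL
  set y := fun a => matTensor L (coact hq hp (cgX n q p a)) with hy
  have hy1 : ∀ a l m, y a l m = ∑ u, cremmerGervais n q p m a l u • cgX n q p u := by
    intro a l m
    refine (matTensor_coact_cgX hq hp L a l m).trans ?_
    simp only [L, corep_apply, FRT.pairing_T_T]
  -- Here `j` comes last and the other letters precede it by non-increasing distance from `j`.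
  obtain ⟨w, hw, hperm⟩ := CenteredWord.exists_perm j
  have hperm' : (w ++ [j]).Perm (List.finRange n) := (List.perm_append_singleton j w).trans hperm
  have h1 := matTensor_coact_prod hq hp L hperm' l j
  have h2 : ((w ++ [j]).map y).prod l j
      = (p⁻¹ * q) • ((w.map y).prod l j * cgX n q p j) := by
    rw [List.map_append, List.prod_append, List.map_cons, List.map_nil, List.prod_singleton,
      Matrix.mul_apply, Finset.sum_eq_single j]
    · rw [hy1, Finset.sum_eq_single j]
      · rw [cremmerGervais_same, if_pos ⟨rfl, rfl⟩, mul_smul_comm]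
      · intro l _ hl
        rw [cremmerGervais_same, if_neg (fun h => hl h.2), zero_smul]
      · simp
    · intro m _ hm
      rw [hy1, Finset.sum_eq_zero, mul_zero]
      intro l _
      rw [cremmerGervais_same, if_neg (fun h => hm h.1), zero_smul]
    · simp
  have h3 := congrArg (topCoeff hq hp) (h1.symm.trans h2)
  have h0 := topCoeff_prod_ne_zero hq hp hperm'
  rw [prod_apply_mul_cgX hq hp (fun a l => hy1 a l j) hw l] at h3
  rw [List.map_append, List.prod_append, List.map_cons, List.map_nil, List.prod_singleton] at h3 h0
  rw [map_smul, smul_eq_mul] at h3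
  refine mul_right_cancel₀ h0 (h3.trans ?_)
  split_ifs with hk
  · rw [map_smul, map_smul, smul_smul, smul_eq_mul]
    congr 1
    rw [← prod_cremmerGervais_left hq hp, ← list_prod_eq_prod hperm, List.map_cons, List.prod_cons,
      cremmerGervais_same, if_pos ⟨rfl, rfl⟩]
  · simp

end


/-! ### Skew derivations of `Λ(R)` and the cofactor matrix -/

theorem map_quadExpr {n : ℕ} {q p : ℂ} {B B' : Type*} [Ring B] [Algebra ℂ B] [Ring B']
    [Algebra ℂ B'] (f : B →ₐ[ℂ] B') (y : Fin n → B) (i j : Fin n) :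
    quadExpr q p (fun a => f (y a)) i j = f (quadExpr q p y i j) := by
  simp [quadExpr]

theorem smul_quadExpr {n : ℕ} {q p : ℂ} {B : Type*} [Ring B] [Algebra ℂ B] (s : ℂ) (y : Fin n → B)
    (i j : Fin n) : quadExpr q p (fun a => s • y a) i j = (s * s) • quadExpr q p y i j := by
  simp only [quadExpr, smul_mul_smul_comm, smul_add, Finset.smul_sum, smul_smul]
  congr 1
  · congr 1; ring
  · exact Finset.sum_congr rfl fun k _ => Finset.sum_congr rfl fun l _ => by congr 1; ring

namespace CGExt

variable {n : ℕ} {q p : ℂ}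

/-- The lower right block of `derivGen`. -/
def twistGen (hq : q ≠ 0) (hp : p ≠ 0) (j : Fin n) : Matrix (Fin n) (Fin n) (CGExt n q p) :=
  -- The scalar is the negative reciprocal of `R_{ii}^{ii} = p⁻¹ q`, so that the corner entry of the
  -- square of a generator cancels.
  (-(q⁻¹ * p)) • matTensor (FRT.rep (YangBaxter_cremmerGervais hq hp)) (coact hq hp (cgX n q p j))

theorem twistGen_apply (hq : q ≠ 0) (hp : p ≠ 0) (a i k : Fin n) : twistGen hq hp a i k
    = (-(q⁻¹ * p)) • ∑ l, cremmerGervais n q p a i l k • cgX n q p l := by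
  rw [twistGen, Matrix.smul_apply, matTensor_coact_cgX]
  simp only [FRT.rep_T]

theorem quadExpr_twistGen (hq : q ≠ 0) (hp : p ≠ 0) (i j : Fin n) :
    quadExpr q p (twistGen (n := n) hq hp) i j = 0 := by
  have h := smul_quadExpr (q := q) (p := p) (-(q⁻¹ * p)) (fun a =>
    ((matTensor (FRT.rep (YangBaxter_cremmerGervais hq hp))).comp (coact hq hp)) (cgX n q p a)) i j
  rw [map_quadExpr, quadExpr_cgX hq hp, map_zero, smul_zero] at h
  exact h

theorem twistGen_mul_self (hq : q ≠ 0) (hp : p ≠ 0) (i : Fin n) :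
    twistGen (n := n) hq hp i * twistGen hq hp i = 0 := by
  rw [twistGen, smul_mul_smul_comm, ← map_mul, ← map_mul, mul_self hq hp, map_zero, map_zero,
    smul_zero]

/-- The image of `x_j` under `derivHom`. -/
def derivGen (hq : q ≠ 0) (hp : p ≠ 0) (j : Fin n) :
    Matrix (Unit ⊕ Fin n) (Unit ⊕ Fin n) (CGExt n q p) :=
  Matrix.fromBlocks (Matrix.of fun _ _ => cgX n q p j) (Matrix.of fun _ m => if m = j then 1 else 0)
    0 (twistGen hq hp j)

theorem derivGen_mul (hq : q ≠ 0) (hp : p ≠ 0) (j i : Fin n) :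
    derivGen hq hp j * derivGen hq hp i
      = Matrix.fromBlocks (Matrix.of fun _ _ => cgX n q p j * cgX n q p i)
          (Matrix.of fun _ m => (if m = i then cgX n q p j else 0) + twistGen hq hp i j m)
          0 (twistGen hq hp j * twistGen hq hp i) := by
  rw [derivGen, derivGen, Matrix.fromBlocks_multiply]
  congr 1
  · ext; simp [Matrix.mul_apply]
  · ext; simp [Matrix.mul_apply]
  · simp
  · simp

/-- This is the Hecke relation: the quadratic term in `R` comes from the twist block and is replaced
by a linear term and the identity, which cancel all the others. -/
theorem derivGen_topRight (hq : q ≠ 0) (hp : p ≠ 0) (i j m : Fin n) :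
    q⁻¹ • ((if m = i then cgX n q p j else 0) + twistGen hq hp i j m)
      + p • ∑ k, ∑ l, cremmerGervais n q p i j k l •
        ((if m = l then cgX n q p k else 0) + twistGen hq hp l k m) = 0 := by
  have h1 : ∑ k, ∑ l, cremmerGervais n q p i j k l • twistGen hq hp l k m
      = -(q⁻¹ * p⁻¹) • ((q - q⁻¹) • (p • ∑ a, cremmerGervais n q p i j a m • cgX n q p a)
        + if m = i then cgX n q p j else 0) := by
    have e : ∀ a, p ^ 2 * ∑ k, ∑ l, cremmerGervais n q p i j k l * cremmerGervais n q p l k a m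
        = (q - q⁻¹) * (p * cremmerGervais n q p i j a m) + if a = j ∧ m = i then 1 else 0 :=
      fun a => cremmerGervais_hecke hq hp i j a m
    have h2 : (q - q⁻¹) • (p • ∑ a, cremmerGervais n q p i j a m • cgX n q p a)
        + (if m = i then cgX n q p j else 0) = ∑ a, (p ^ 2 * ∑ k, ∑ l,
          cremmerGervais n q p i j k l * cremmerGervais n q p l k a m) • cgX n q p a := by
      simp only [e, add_smul, Finset.sum_add_distrib, Finset.smul_sum, smul_smul]
      congr 1
      by_cases hm : m = i
      · simp [hm]
      · simp [hm]
    rw [h2]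
    simp only [twistGen_apply, Finset.smul_sum, smul_smul, Finset.mul_sum, Finset.sum_smul]
    rw [Finset.sum_comm_cycle]
    refine Finset.sum_congr rfl fun a _ => ?_
    refine Finset.sum_congr rfl fun k _ => Finset.sum_congr rfl fun l _ => ?_
    congr 1
    field_simp
  have h3 : ∑ k, ∑ l, cremmerGervais n q p i j k l • (if m = l then cgX n q p k else 0)
      = ∑ a, cremmerGervais n q p i j a m • cgX n q p a := by
    refine Finset.sum_congr rfl fun k _ => ?_
    simp
  simp only [smul_add, Finset.sum_add_distrib]
  rw [h1, h3, twistGen_apply]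
  simp only [smul_add, smul_smul, neg_smul, smul_neg]
  set S := ∑ a, cremmerGervais n q p i j a m • cgX n q p a
  have c1 : p * (-(q⁻¹ * p⁻¹) * ((q - q⁻¹) * p)) = q⁻¹ * (q⁻¹ * p) - p := by
    field_simp
    ring
  have c2 : p * (q⁻¹ * p⁻¹) = q⁻¹ := by field_simp
  rw [c1, c2, sub_smul, mul_neg, neg_smul]
  abel

theorem quadExpr_derivGen (hq : q ≠ 0) (hp : p ≠ 0) (i j : Fin n) :
    quadExpr q p (derivGen (n := n) hq hp) i j = 0 := by
  have h1 := quadExpr_cgX (n := n) hq hp i j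
  have h4 := quadExpr_twistGen (n := n) hq hp i j
  simp only [quadExpr] at h1 h4
  simp only [quadExpr, derivGen_mul]
  ext (a | a) (b | b)
  · simpa [Matrix.sum_apply] using h1
  · simpa [Matrix.sum_apply] using derivGen_topRight hq hp i j b
  · simp [Matrix.sum_apply]
  · simpa [Matrix.sum_apply] using congrFun (congrFun h4 a) b

theorem derivGen_mul_self (hq : q ≠ 0) (hp : p ≠ 0) (i : Fin n) :
    derivGen (n := n) hq hp i * derivGen hq hp i = 0 := by
  rw [derivGen_mul, mul_self hq hp, twistGen_mul_self]
  ext (a | a) (b | b)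
  · simp
  · simp only [Matrix.fromBlocks_apply₁₂, Matrix.of_apply, Matrix.zero_apply, twistGen_apply,
      cremmerGervais_same]
    by_cases hb : b = i
    · simp only [hb, and_true, ite_smul, zero_smul, Finset.sum_ite_eq', Finset.mem_univ, if_true,
        smul_smul]
      rw [show -(q⁻¹ * p) * (p⁻¹ * q) = -1 by field_simp, neg_one_smul, add_neg_cancel]
    · simp [hb]
  · simp
  · simp

/-- The block triangular representation whose upper right block consists of skew derivations. -/
def derivHom (hq : q ≠ 0) (hp : p ≠ 0) :
    CGExt n q p →ₐ[ℂ] Matrix (Unit ⊕ Fin n) (Unit ⊕ Fin n) (CGExt n q p) :=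
  lift (derivGen hq hp) (quadExpr_derivGen hq hp) (derivGen_mul_self hq hp)

/-- The lower right block of `derivHom`. -/
def twistHom (hq : q ≠ 0) (hp : p ≠ 0) : CGExt n q p →ₐ[ℂ] Matrix (Fin n) (Fin n) (CGExt n q p) :=
  lift (twistGen hq hp) (quadExpr_twistGen hq hp) (twistGen_mul_self hq hp)

/-- The skew derivation with respect to `x_k`. -/
def deriv (hq : q ≠ 0) (hp : p ≠ 0) (k : Fin n) (a : CGExt n q p) : CGExt n q p :=
  derivHom hq hp a (Sum.inl ()) (Sum.inr k)

theorem derivHom_cgX (hq : q ≠ 0) (hp : p ≠ 0) (j : Fin n) :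
    derivHom hq hp (cgX n q p j) = derivGen hq hp j := lift_cgX _ _ _ _

theorem twistHom_cgX (hq : q ≠ 0) (hp : p ≠ 0) (j : Fin n) :
    twistHom hq hp (cgX n q p j) = twistGen hq hp j := lift_cgX _ _ _ _

theorem derivHom_eq (hq : q ≠ 0) (hp : p ≠ 0) (a : CGExt n q p) : derivHom hq hp a
    = Matrix.fromBlocks (Matrix.of fun _ _ => a) (Matrix.of fun _ m => deriv hq hp m a) 0
      (twistHom hq hp a) := by
  have h : ∀ M : Matrix (Unit ⊕ Fin n) (Unit ⊕ Fin n) (CGExt n q p), M.toBlocks₁₁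
      = (Matrix.of fun _ _ => a) → M.toBlocks₂₁ = 0 → M.toBlocks₂₂ = twistHom hq hp a →
      M = Matrix.fromBlocks (Matrix.of fun _ _ => a) (Matrix.of fun _ m => M (Sum.inl ()) (Sum.inr m)) 0
      (twistHom hq hp a) := by
    intro M h1 h2 h3
    conv_lhs => rw [← Matrix.fromBlocks_toBlocks M, h1, h2, h3]
    rfl
  have key : (derivHom hq hp a).toBlocks₁₁ = (Matrix.of fun _ _ => a) ∧
      (derivHom hq hp a).toBlocks₂₁ = 0 ∧ (derivHom hq hp a).toBlocks₂₂ = twistHom hq hp a := by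
    clear h
    induction a using induction with
    | algebraMap c =>
      rw [AlgHom.commutes, AlgHom.commutes]
      refine ⟨?_, ?_, ?_⟩ <;> ext <;>
        simp [Matrix.toBlocks₁₁, Matrix.toBlocks₂₁, Matrix.toBlocks₂₂, Matrix.algebraMap_matrix_apply]
    | cgX j =>
      rw [derivHom_cgX, twistHom_cgX, derivGen]
      simp
    | mul a b ha hb =>
      have e : ∀ (x : CGExt n q p), (derivHom hq hp x).toBlocks₁₁ = (Matrix.of fun _ _ => x) ∧
          (derivHom hq hp x).toBlocks₂₁ = 0 ∧ (derivHom hq hp x).toBlocks₂₂ = twistHom hq hp x →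
          derivHom hq hp x = Matrix.fromBlocks (Matrix.of fun _ _ => x)
            (derivHom hq hp x).toBlocks₁₂ 0 (twistHom hq hp x) := by
        intro x hx
        conv_lhs => rw [← Matrix.fromBlocks_toBlocks (derivHom hq hp x), hx.1, hx.2.1, hx.2.2]
      rw [map_mul, map_mul, e a ha, e b hb, Matrix.fromBlocks_multiply]
      refine ⟨?_, ?_, ?_⟩
      · ext; simp [Matrix.mul_apply]
      · simp
      · simp
    | add a b ha hb =>
      rw [map_add, map_add]
      refine ⟨?_, ?_, ?_⟩
      · ext i j
        have h1 := congrFun (congrFun ha.1 i) j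
        have h2 := congrFun (congrFun hb.1 i) j
        simp only [Matrix.toBlocks₁₁, Matrix.of_apply] at h1 h2
        simp [Matrix.toBlocks₁₁, h1, h2]
      · ext i j
        have h1 := congrFun (congrFun ha.2.1 i) j
        have h2 := congrFun (congrFun hb.2.1 i) j
        simp only [Matrix.toBlocks₂₁, Matrix.of_apply] at h1 h2
        simp [Matrix.toBlocks₂₁, h1, h2]
      · ext i j
        have h1 := congrFun (congrFun ha.2.2 i) j
        have h2 := congrFun (congrFun hb.2.2 i) j
        simp only [Matrix.toBlocks₂₂, Matrix.of_apply] at h1 h2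
        simp [Matrix.toBlocks₂₂, h1, h2]
  exact h _ key.1 key.2.1 key.2.2

/-- The twisted Leibniz rule is the upper right block of a product of block triangular matrices. -/
theorem deriv_cgX_mul (hq : q ≠ 0) (hp : p ≠ 0) (i j : Fin n) (a : CGExt n q p) :
    deriv hq hp j (cgX n q p i * a) = cgX n q p i * deriv hq hp j a + twistHom hq hp a i j := by
  have h : deriv hq hp j (cgX n q p i * a)
      = (derivHom hq hp (cgX n q p i) * derivHom hq hp a) (Sum.inl ()) (Sum.inr j) := by
    rw [← map_mul]; rfl
  rw [h, derivHom_eq hq hp a, derivHom_cgX, derivGen, Matrix.fromBlocks_multiply]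
  simp [Matrix.mul_apply]

/-- With the top form written as a multiple of `x_i` times a centered word, the Leibniz rule gives
two terms. Left multiplication by `x_i` kills one, and the triangular evaluation computes the other.
-/
theorem exists_cgX_mul_deriv_cgTop (hq : q ≠ 0) (hp : p ≠ 0) : ∃ d : Fin n → ℂ, (∀ i, d i ≠ 0) ∧
    ∀ i j, cgX n q p i * deriv hq hp j (cgTop n q p) = if j = i then d i • cgTop n q p else 0 := by
  have h : ∀ i : Fin n, ∃ d : ℂ, d ≠ 0 ∧ ∀ j, cgX n q p i * deriv hq hp j (cgTop n q p)
      = if j = i then d • cgTop n q p else 0 := by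
    intro i
    obtain ⟨w, hw, hperm⟩ := CenteredWord.exists_perm i
    have hperm' : (i :: w.reverse).Perm (List.finRange n) := (w.reverse_perm.cons i).trans hperm
    obtain ⟨c, hc, he⟩ := exists_prod_eq_smul_cgTop hq hp hperm'
    refine ⟨(w.map fun a => -(q⁻¹ * p) * cremmerGervais n q p a i a i).prod, ?_, fun j => ?_⟩
    · refine List.prod_ne_zero ?_
      simp only [List.mem_map, not_exists, not_and]
      intro a _ h
      have h1 : p ^ (2 * ((i : ℤ) - a)) ≠ 0 := zpow_ne_zero _ hp
      simp only [cremmerGervais, if_pos] at h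
      split_ifs at h <;> simp_all
    · rw [List.map_cons, List.prod_cons] at he
      have ht : cgTop n q p = c⁻¹ • (cgX n q p i * (w.reverse.map (cgX n q p)).prod) := by
        rw [he, smul_smul, inv_mul_cancel₀ hc, one_smul]
      have hd : deriv hq hp j (cgTop n q p)
          = c⁻¹ • deriv hq hp j (cgX n q p i * (w.reverse.map (cgX n q p)).prod) := by
        rw [ht, deriv, map_smul]; rfl
      have hm : twistHom hq hp (w.reverse.map (cgX n q p)).prod
          = (w.reverse.map (twistGen hq hp)).prod := by
        rw [map_list_prod, List.map_map]
        congr 2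
        funext a
        exact twistHom_cgX hq hp a
      rw [hd, deriv_cgX_mul, mul_smul_comm, mul_add, ← mul_assoc, mul_self hq hp, zero_mul, zero_add,
        hm, cgX_mul_prod_apply hq hp _ (twistGen_apply hq hp) hw j]
      split_ifs
      · rw [ht, smul_comm]
      · rw [smul_zero]
  choose d hd h using h
  exact ⟨d, hd, h⟩

/-- `a ⊗ x ↦ a ⊗ derivHom x` -/
def derivTensor (hq : q ≠ 0) (hp : p ≠ 0) : CGA n q p ⊗[ℂ] CGExt n q p →ₐ[ℂ]
    Matrix (Unit ⊕ Fin n) (Unit ⊕ Fin n) (CGA n q p ⊗[ℂ] CGExt n q p) :=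
  Algebra.TensorProduct.lift
    ((Matrix.scalarAlgHom (Unit ⊕ Fin n) ℂ).comp Algebra.TensorProduct.includeLeft)
    ((Algebra.TensorProduct.includeRight : CGExt n q p →ₐ[ℂ] CGA n q p ⊗[ℂ] CGExt n q p).mapMatrix.comp
      (derivHom hq hp))
    (fun a x => show Commute _ _ from by
      refine Matrix.ext fun i j => ?_
      simp [Matrix.mul_apply, Matrix.diagonal_apply])

theorem derivTensor_tmul_apply (hq : q ≠ 0) (hp : p ≠ 0) (a : CGA n q p) (x : CGExt n q p)
    (i j : Unit ⊕ Fin n) : derivTensor hq hp (a ⊗ₜ x) i j = a ⊗ₜ derivHom hq hp x i j := by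
  rw [derivTensor, Algebra.TensorProduct.lift_tmul]
  simp [Matrix.mul_apply, Matrix.diagonal_apply]

/-- The matrix `diag(1, T)`. -/
def blockT (n : ℕ) (q p : ℂ) :
    Matrix (Unit ⊕ Fin n) (Unit ⊕ Fin n) (CGA n q p ⊗[ℂ] CGExt n q p) :=
  Matrix.fromBlocks 1 0 0 (Matrix.of fun i j => cgT n q p i j ⊗ₜ 1)

/-- The skew derivations are equivariant up to the matrix `T`. Both sides intertwine algebra maps,
so generators suffice, and the lower right block there is the defining relation of `A(R)`. -/
theorem derivTensor_coact (hq : q ≠ 0) (hp : p ≠ 0) (a : CGExt n q p) :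
    (coact hq hp).mapMatrix (derivHom hq hp a) * blockT n q p
      = blockT n q p * derivTensor hq hp (coact hq hp a) := by
  induction a using induction with
  | algebraMap c => rw [AlgHom.commutes, AlgHom.commutes, AlgHom.commutes, AlgHom.commutes,
      Algebra.commutes]
  | mul a b ha hb => rw [map_mul, map_mul, map_mul, map_mul, mul_assoc, hb, ← mul_assoc, ha,
      mul_assoc]
  | add a b ha hb => rw [map_add, map_add, map_add, map_add, add_mul, ha, hb, mul_add]
  | cgX j =>
    have h : derivTensor hq hp (coact hq hp (cgX n q p j)) = Matrix.fromBlocks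
        (Matrix.of fun _ _ => ∑ l, cgT n q p j l ⊗ₜ[ℂ] cgX n q p l)
        (Matrix.of fun _ m => cgT n q p j m ⊗ₜ[ℂ] 1) 0
        (Matrix.of fun i m => ∑ l, cgT n q p j l ⊗ₜ[ℂ] twistGen hq hp l i m) := by
      rw [coact_cgX, map_sum]
      ext (a | a) (b | b)
      · simp [Matrix.sum_apply, derivTensor_tmul_apply, derivHom_cgX, derivGen]
      · simp [Matrix.sum_apply, derivTensor_tmul_apply, derivHom_cgX, derivGen,
          TensorProduct.tmul_ite]
      · simp [Matrix.sum_apply, derivTensor_tmul_apply, derivHom_cgX, derivGen]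
      · simp [Matrix.sum_apply, derivTensor_tmul_apply, derivHom_cgX, derivGen]
    rw [h, derivHom_cgX, derivGen, AlgHom.mapMatrix_apply, Matrix.fromBlocks_map, blockT,
      Matrix.fromBlocks_multiply, Matrix.fromBlocks_multiply]
    congr 1
    · ext; simp
    · ext; simp [Matrix.mul_apply]
    · ext; simp
    · ext i k
      simp only [Matrix.mul_apply, Matrix.map_apply, Matrix.of_apply, Matrix.add_apply,
        twistGen_apply, map_smul, map_sum, coact_cgX, Finset.sum_mul, Finset.mul_sum,
        Finset.smul_sum, smul_mul_assoc, mul_smul_comm, Algebra.TensorProduct.tmul_mul_tmul,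
        mul_one, one_mul, TensorProduct.tmul_smul, TensorProduct.tmul_sum, Matrix.zero_apply,
        zero_mul, mul_zero, Finset.sum_const_zero, zero_add]
      have e : ∀ a, (∑ u, ∑ v, cremmerGervais n q p j i u v • (cgT n q p u a * cgT n q p v k))
          ⊗ₜ[ℂ] cgX n q p a = (∑ u, ∑ v, cremmerGervais n q p v u a k •
            (cgT n q p i u * cgT n q p j v)) ⊗ₜ[ℂ] cgX n q p a := fun a => by
        rw [FRT.rel (cremmerGervais n q p) i j a k]
      have e' := congrArg (fun z => (-(q⁻¹ * p)) • z) (Finset.sum_congr (s₁ := Finset.univ) rfl fun a _ => e a)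
      simp only [TensorProduct.sum_tmul, ← TensorProduct.smul_tmul', Finset.smul_sum] at e'
      refine Eq.trans ?_ (e'.trans ?_)
      · rw [Finset.sum_comm_cycle]
        exact Finset.sum_congr rfl fun a _ => Finset.sum_comm
      · exact Finset.sum_comm_cycle.symm

theorem slice_mul_tmul_one {A Λ : Type*} [Ring A] [Algebra ℂ A] [Ring Λ] [Algebra ℂ Λ]
    (φ : Λ →ₗ[ℂ] ℂ) (z : A ⊗[ℂ] Λ) (t : A) : slice φ (z * t ⊗ₜ 1) = slice φ z * t := by
  induction z with
  | zero => simp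
  | add x y hx hy => rw [add_mul, map_add, map_add, add_mul, hx, hy]
  | tmul x y => simp

theorem slice_tmul_mul {A Λ : Type*} [Ring A] [Algebra ℂ A] [Ring Λ] [Algebra ℂ Λ]
    (φ : Λ →ₗ[ℂ] ℂ) (z : A ⊗[ℂ] Λ) (t : A) (x : Λ) :
    slice φ (t ⊗ₜ x * z) = t * slice (φ ∘ₗ LinearMap.mulLeft ℂ x) z := by
  induction z with
  | zero => simp
  | add x y hx hy => rw [mul_add, map_add, map_add, mul_add, hx, hy]
  | tmul x y => simp

end CGExt

/-- The quantum cofactor matrix. -/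
theorem exists_cofactor {n : ℕ} {q p : ℂ} (hq : q ≠ 0) (hp : p ≠ 0) :
    ∃ (N : Fin n → Fin n → CGA n q p) (d : Fin n → ℂ), (∀ i, d i ≠ 0) ∧
      (∀ m k, ∑ i, N m i * cgT n q p i k = if k = m then d m • cgDet n q p else 0) ∧
      ∀ i j, ∑ u, cgT n q p i u * N u j = if j = i then d i • cgDet n q p else 0 := by
  obtain ⟨d, hd, h⟩ := CGExt.exists_cgX_mul_deriv_cgTop (n := n) hq hp
  refine ⟨fun m i => CGExt.slice (CGExt.topCoeff hq hp ∘ₗ LinearMap.mulLeft ℂ (cgX n q p m))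
    (CGExt.coact hq hp (CGExt.deriv hq hp i (cgTop n q p))), d, hd, fun m k => ?_, fun i j => ?_⟩
  -- The upper right block of equivariance reads `∑ ρ(∂_i top) (T_i^k ⊗ 1) = det_q ⊗ ∂_k top`. The
  -- coefficient of the top form after left multiplication by `x_m` is then taken.
  · have e := congrFun (congrFun (CGExt.derivTensor_coact hq hp (cgTop n q p)) (Sum.inl ()))
      (Sum.inr k)
    rw [CGExt.coact_cgTop] at e
    simp only [CGExt.blockT, Matrix.mul_apply, Fintype.sum_sum_type, CGExt.derivTensor_tmul_apply]
      at e
    simp at e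
    have e' := congrArg (CGExt.slice (CGExt.topCoeff hq hp ∘ₗ LinearMap.mulLeft ℂ (cgX n q p m))) e
    rw [map_sum] at e'
    simp only [CGExt.slice_mul_tmul_one] at e'
    refine e'.trans ?_
    rw [CGExt.slice_tmul, LinearMap.comp_apply, LinearMap.mulLeft_apply]
    change CGExt.topCoeff hq hp (cgX n q p m * CGExt.deriv hq hp k _) • _ = _
    rw [h]
    split_ifs <;> simp [CGExt.topCoeff_cgTop]
  -- The other side results from applying the coaction to the formula for `x_i ∂_j top`.
  · have e := congrArg (fun z => CGExt.slice (CGExt.topCoeff hq hp) (CGExt.coact hq hp z)) (h i j)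
    simp only [map_mul, CGExt.coact_cgX, Finset.sum_mul, map_sum, CGExt.slice_tmul_mul] at e
    refine e.trans ?_
    split_ifs <;> simp [CGExt.topCoeff_cgTop, CGExt.coact_cgTop]


/-! ### The quantum determinant is normal -/

section

open WithConv Coalgebra

variable {n : ℕ} {q p : ℂ}

/-- The representation of the comultiplication of the quantum determinant. -/
def reprDet (hq : q ≠ 0) (hp : p ≠ 0) : Coalgebra.Repr ℂ (cgDet n q p) Unit where
  index := Finset.univ
  left _ := cgDet n q p
  right _ := cgDet n q p
  eq := by simp [comul_cgDet hq hp]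

/-- As `det_q` is group-like and pairs diagonally with the generators, the commutation relation of
the pairing has one term on each side: `κ^(n-2i) det_q T_i^k = κ^(n-2k) T_i^k det_q`. -/
theorem cgT_mul_cgDet (hq : q ≠ 0) (hp : p ≠ 0) (i k : Fin n) :
    cgT n q p i k * cgDet n q p
      = ((q * (p ^ n)⁻¹) ^ 2) ^ ((k : ℤ) - i) • (cgDet n q p * cgT n q p i k) := by
  have h := (SkewPairing.commRel_iff _ (FRT.reprT i k) (reprDet hq hp)).1
    (FRT.pairing_commRel (YangBaxter_cremmerGervais hq hp) (cgT n q p i k) (cgDet n q p))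
  simp only [FRT.reprT, reprDet, Finset.univ_unique, Finset.sum_singleton, FRT.pairing_T_left,
    rep_cgDet hq hp, ite_smul, zero_smul, Finset.sum_ite_eq', Finset.sum_ite_eq, Finset.mem_univ,
    if_true] at h
  set κ := q * (p ^ n)⁻¹
  have hκ : κ ≠ 0 := mul_ne_zero hq (inv_ne_zero (pow_ne_zero _ hp))
  have h2 := congrArg (fun z => κ ^ (-((n : ℤ) - 2 * k)) • z) h
  simp only [smul_smul, ← zpow_add₀ hκ, neg_add_cancel, zpow_zero, one_smul] at h2
  rw [← h2, ← zpow_natCast, ← zpow_mul]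
  congr 2
  push_cast
  ring

/-- The automorphism `T_i^k ↦ t^{k-i} T_i^k` of `A(R)`. -/
def scaleHom (n : ℕ) (q p : ℂ) {t : ℂ} (ht : t ≠ 0) : CGA n q p →ₐ[ℂ] CGA n q p :=
  FRT.lift _ (fun i k => t ^ ((k : ℤ) - i) • cgT n q p i k) (by
    intro i j a b
    have h := congrArg (fun z => t ^ ((a : ℤ) + b - i - j) • z)
      (FRT.rel (cremmerGervais n q p) i j a b)
    simp only [Finset.smul_sum, smul_smul] at h
    refine Eq.trans ?_ (h.trans ?_)
    · refine Finset.sum_congr rfl fun u _ => Finset.sum_congr rfl fun v _ => ?_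
      by_cases huv : (j : ℕ) + i = u + v
      · rw [smul_mul_smul_comm, smul_smul, ← zpow_add₀ ht, mul_comm]
        congr 3
        omega
      · rw [cremmerGervais_of_ne huv, zero_smul, mul_zero, zero_smul]
    · refine Finset.sum_congr rfl fun u _ => Finset.sum_congr rfl fun v _ => ?_
      by_cases huv : (v : ℕ) + u = a + b
      · rw [smul_mul_smul_comm, smul_smul, ← zpow_add₀ ht, mul_comm]
        congr 3
        omega
      · rw [cremmerGervais_of_ne huv, zero_smul, mul_zero, zero_smul])

@[simp] theorem scaleHom_cgT {t : ℂ} (ht : t ≠ 0) (i k : Fin n) :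
    scaleHom n q p ht (cgT n q p i k) = t ^ ((k : ℤ) - i) • cgT n q p i k := FRT.lift_T _ _ _ _ _

theorem scaleHom_scaleHom {s t : ℂ} (hs : s ≠ 0) (ht : t ≠ 0) (a : CGA n q p) :
    scaleHom n q p hs (scaleHom n q p ht a) = scaleHom n q p (mul_ne_zero hs ht) a := by
  refine DFunLike.congr_fun (FRT.hom_ext (f := (scaleHom n q p hs).comp (scaleHom n q p ht))
    fun i j => ?_) a
  rw [AlgHom.comp_apply, scaleHom_cgT, map_smul, scaleHom_cgT, scaleHom_cgT, smul_smul, mul_zpow,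
    mul_comm]

theorem scaleHom_one (a : CGA n q p) : scaleHom n q p one_ne_zero a = a := by
  refine DFunLike.congr_fun (FRT.hom_ext (g := AlgHom.id ℂ _) fun i j => ?_) a
  rw [scaleHom_cgT, one_zpow, one_smul, AlgHom.id_apply]

theorem scaleHom_inv_scaleHom {t : ℂ} (ht : t ≠ 0) (a : CGA n q p) :
    scaleHom n q p (inv_ne_zero ht) (scaleHom n q p ht a) = a := by
  rw [scaleHom_scaleHom]
  simp only [inv_mul_cancel₀ ht]
  exact scaleHom_one a

theorem scaleHom_scaleHom_inv {t : ℂ} (ht : t ≠ 0) (a : CGA n q p) :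
    scaleHom n q p ht (scaleHom n q p (inv_ne_zero ht) a) = a := by
  rw [scaleHom_scaleHom]
  simp only [mul_inv_cancel₀ ht]
  exact scaleHom_one a

/-- Each monomial of `det_q` has weight `∑ (σ(i) - i) = 0`. -/
theorem scaleHom_cgDet {t : ℂ} (ht : t ≠ 0) : scaleHom n q p ht (cgDet n q p) = cgDet n q p := by
  rw [cgDet, map_sum]
  refine Finset.sum_congr rfl fun σ _ => ?_
  rw [map_smul, map_list_prod, List.map_ofFn]
  congr 1
  have h := (MultilinearMap.mkPiAlgebraFin ℂ n (CGA n q p)).map_smul_univ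
    (fun i => t ^ ((σ i : ℤ) - i)) (fun i => cgT n q p i (σ i))
  rw [MultilinearMap.mkPiAlgebraFin_apply, MultilinearMap.mkPiAlgebraFin_apply] at h
  have h0 : ∀ f : Fin n → ℤ, ∏ i, t ^ f i = t ^ ∑ i, f i := fun f => by
    induction (Finset.univ : Finset (Fin n)) using Finset.induction_on with
    | empty => simp
    | insert a s ha ih => rw [Finset.prod_insert ha, Finset.sum_insert ha, ih, zpow_add₀ ht]
  rw [h0, Finset.sum_sub_distrib, Equiv.sum_comp σ (fun i : Fin n => ((i : ℕ) : ℤ)), sub_self,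
    zpow_zero, one_smul] at h
  rw [← h]
  congr 2
  funext i
  exact scaleHom_cgT ht i (σ i)

theorem scale_ne_zero (hq : q ≠ 0) (hp : p ≠ 0) (m : ℕ) : ((q * (p ^ n)⁻¹) ^ 2) ^ m ≠ 0 :=
  pow_ne_zero _ (pow_ne_zero _ (mul_ne_zero hq (inv_ne_zero (pow_ne_zero _ hp))))

theorem mul_cgDet_pow (hq : q ≠ 0) (hp : p ≠ 0) (m : ℕ) (a : CGA n q p) :
    a * cgDet n q p ^ m = cgDet n q p ^ m * scaleHom n q p (scale_ne_zero (n := n) hq hp m) a := by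
  have h1 : ∀ a : CGA n q p, a * cgDet n q p
      = cgDet n q p * scaleHom n q p (scale_ne_zero (n := n) hq hp 1) a := by
    intro a
    induction a using FRT.induction with
    | algebraMap c => rw [AlgHom.commutes, Algebra.commutes]
    | T i j =>
      rw [scaleHom_cgT, mul_smul_comm, pow_one]
      exact cgT_mul_cgDet hq hp i j
    | mul a b ha hb => rw [map_mul, mul_assoc, hb, ← mul_assoc, ha, mul_assoc]
    | add a b ha hb => rw [map_add, add_mul, ha, hb, mul_add]
  induction m with
  | zero =>
    simp only [pow_zero, mul_one, one_mul]
    exact (scaleHom_one a).symm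
  | succ m ih =>
    rw [pow_succ, ← mul_assoc, ih, mul_assoc, h1, ← mul_assoc, scaleHom_scaleHom]
    congr 3
    ring

/-- Moving a power of `det_q` past an element applies an automorphism of `A(R)` that fixes `det_q`.
Both Ore conditions follow by applying its inverse. -/
theorem nonempty_oreSet (hq : q ≠ 0) (hp : p ≠ 0) :
    Nonempty (OreLocalization.OreSet (Submonoid.powers (cgDet n q p))) := by
  rw [OreLocalization.nonempty_oreSet_iff]
  have hg : ∀ {t : ℂ} (ht : t ≠ 0) (m : ℕ), scaleHom n q p ht (cgDet n q p ^ m) = cgDet n q p ^ m :=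
    fun ht m => by rw [map_pow, scaleHom_cgDet]
  constructor
  · rintro r₁ r₂ ⟨_, m, rfl⟩ h
    refine ⟨⟨_, m, rfl⟩, ?_⟩
    simp only [mul_cgDet_pow hq hp m] at h
    have h2 := congrArg (scaleHom n q p (inv_ne_zero (scale_ne_zero (n := n) hq hp m))) h
    rwa [map_mul, map_mul, scaleHom_inv_scaleHom, scaleHom_inv_scaleHom, hg] at h2
  · rintro r ⟨_, m, rfl⟩
    refine ⟨scaleHom n q p (inv_ne_zero (scale_ne_zero (n := n) hq hp m)) r, ⟨_, m, rfl⟩, ?_⟩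
    simp only [mul_cgDet_pow hq hp m, scaleHom_scaleHom_inv]

/-! ### Diagonal characters and the functionals defined by the quantum determinant. -/

/-- The character `T_i^k ↦ δ_{ik} s t^i`. -/
def diagChar (n : ℕ) (q p s : ℂ) {t : ℂ} (ht : t ≠ 0) : CGA n q p →ₐ[ℂ] ℂ :=
  FRT.lift _ (fun i k => if k = i then s * t ^ (i : ℤ) else 0) (by
    intro i j a b
    by_cases h : (j : ℕ) + i = a + b
    · simp only [smul_eq_mul, mul_ite, ite_mul, mul_zero, zero_mul,
        Finset.sum_ite_eq, Finset.sum_ite_eq', Finset.mem_univ, if_true]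
      have e : s * t ^ (a : ℤ) * (s * t ^ (b : ℤ)) = s * t ^ (i : ℤ) * (s * t ^ (j : ℤ)) := by
        rw [mul_mul_mul_comm, ← zpow_add₀ ht, mul_mul_mul_comm, ← zpow_add₀ ht]
        congr 2
        omega
      rw [e]
    · simp only [smul_eq_mul, mul_ite, ite_mul, mul_zero, zero_mul,
        Finset.sum_ite_eq, Finset.sum_ite_eq', Finset.mem_univ, if_true]
      rw [cremmerGervais_of_ne h, zero_mul, zero_mul])

@[simp] theorem diagChar_cgT (s : ℂ) {t : ℂ} (ht : t ≠ 0) (i k : Fin n) :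
    diagChar n q p s ht (cgT n q p i k) = if k = i then s * t ^ (i : ℤ) else 0 :=
  FRT.lift_T _ _ _ _ _

theorem diagChar_one : (toConv (diagChar n q p 1 one_ne_zero).toLinearMap :
    WithConv (CGA n q p →ₗ[ℂ] ℂ)) = 1 := by
  have h : diagChar n q p 1 one_ne_zero = Bialgebra.counitAlgHom ℂ (CGA n q p) :=
    FRT.hom_ext fun i j => by
      rw [diagChar_cgT, Bialgebra.counitAlgHom_apply, FRT.counit_T]
      simp [eq_comm]
  refine WithConv.ext (LinearMap.ext fun a => ?_)
  rw [h]
  rfl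

theorem diagChar_mul (s s' : ℂ) {t t' : ℂ} (ht : t ≠ 0) (ht' : t' ≠ 0) :
    (toConv (diagChar n q p s ht).toLinearMap * toConv (diagChar n q p s' ht').toLinearMap :
      WithConv (CGA n q p →ₗ[ℂ] ℂ))
      = toConv (diagChar n q p (s * s') (mul_ne_zero ht ht')).toLinearMap := by
  have h : (Algebra.TensorProduct.lift (diagChar n q p s ht) (diagChar n q p s' ht')
      (fun _ _ => show Commute _ _ from Commute.all _ _)).comp (Bialgebra.comulAlgHom ℂ (CGA n q p))
      = diagChar n q p (s * s') (mul_ne_zero ht ht') :=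
    FRT.hom_ext fun i j => by
      rw [AlgHom.comp_apply, Bialgebra.comulAlgHom_apply, FRT.comul_T, map_sum]
      simp only [Algebra.TensorProduct.lift_tmul, diagChar_cgT, ite_mul, zero_mul, mul_ite, mul_zero]
      rw [Finset.sum_eq_single i (fun u _ hu => by rw [if_neg hu, ite_self]) (by simp), if_pos rfl, mul_zpow]
      split_ifs
      · ring
      · rfl
  refine WithConv.ext (LinearMap.ext fun a => ?_)
  refine ((ℛ ℂ a).convMul_apply _ _).trans (Eq.trans ?_ (DFunLike.congr_fun h a))
  rw [AlgHom.comp_apply, Bialgebra.comulAlgHom_apply, ← (ℛ ℂ a).eq, map_sum]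
  rfl

theorem isUnit_diagChar {s t : ℂ} (hs : s ≠ 0) (ht : t ≠ 0) :
    IsUnit (toConv (diagChar n q p s ht).toLinearMap : WithConv (CGA n q p →ₗ[ℂ] ℂ)) := by
  refine ⟨⟨_, toConv (diagChar n q p s⁻¹ (inv_ne_zero ht)).toLinearMap, ?_, ?_⟩, rfl⟩
  · rw [diagChar_mul]
    simp only [mul_inv_cancel₀ hs, mul_inv_cancel₀ ht]
    exact diagChar_one
  · rw [diagChar_mul]
    simp only [inv_mul_cancel₀ hs, inv_mul_cancel₀ ht]
    exact diagChar_one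

/-- The pairing of `A(R)` with itself. -/
abbrev cgPairing (hq : q ≠ 0) (hp : p ≠ 0) : SkewPairing ℂ (CGA n q p) (CGA n q p) :=
  FRT.pairing (YangBaxter_cremmerGervais hq hp)

theorem kappa_ne_zero (hq : q ≠ 0) (hp : p ≠ 0) : q * (p ^ n)⁻¹ ≠ 0 :=
  mul_ne_zero hq (inv_ne_zero (pow_ne_zero _ hp))

/-- Pairing with a group-like element is multiplicative, so the functional is the character
determined by its values on generators. Such characters are convolution invertible, and for `κ = 1`
this one is the counit. -/
theorem rightHom_cgDet (hq : q ≠ 0) (hp : p ≠ 0) : (cgPairing hq hp).rightHom (cgDet n q p)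
    = toConv (diagChar n q p ((q * (p ^ n)⁻¹) ^ (n : ℤ))
      (t := (q * (p ^ n)⁻¹) ^ (-2 : ℤ)) (zpow_ne_zero _ (kappa_ne_zero hq hp))).toLinearMap := by
  refine WithConv.ext (LinearMap.ext fun a => ?_)
  change (cgPairing hq hp).form a (cgDet n q p) = diagChar n q p _ _ a
  induction a using FRT.induction with
  | algebraMap c =>
    rw [AlgHom.commutes, Algebra.algebraMap_eq_smul_one, map_smul, LinearMap.smul_apply,
      SkewPairing.one_left_apply, counit_cgDet hq hp, Algebra.algebraMap_eq_smul_one]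
  | T i j =>
    rw [FRT.pairing_T_left, rep_cgDet hq hp, diagChar_cgT, ← zpow_mul,
      ← zpow_add₀ (kappa_ne_zero hq hp), neg_mul, sub_eq_add_neg]
  | mul a b ha hb =>
    rw [SkewPairing.mul_left_apply _ _ _ _ (reprDet hq hp), map_mul, ← ha, ← hb]
    simp only [reprDet, Finset.univ_unique, Finset.sum_singleton, mul_comm]
  | add a b ha hb => rw [map_add, LinearMap.add_apply, ha, hb, map_add]

theorem leftHom_cgDet (hq : q ≠ 0) (hp : p ≠ 0) : (cgPairing hq hp).leftHom (cgDet n q p)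
    = MulOpposite.op (toConv (diagChar n q p ((q * (p ^ n)⁻¹) ^ (2 - n : ℤ))
      (t := (q * (p ^ n)⁻¹) ^ (2 : ℤ)) (zpow_ne_zero _ (kappa_ne_zero hq hp))).toLinearMap) := by
  refine MulOpposite.unop_injective (WithConv.ext (LinearMap.ext fun a => ?_))
  change (cgPairing hq hp).form (cgDet n q p) a = diagChar n q p _ _ a
  induction a using FRT.induction with
  | algebraMap c =>
    rw [AlgHom.commutes, Algebra.algebraMap_eq_smul_one, map_smul,
      SkewPairing.one_right_apply, counit_cgDet hq hp, Algebra.algebraMap_eq_smul_one]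
  | T i j =>
    have h := corep_cgDet hq hp j i
    rw [corep_apply] at h
    rw [h, diagChar_cgT, ← zpow_mul, ← zpow_add₀ (kappa_ne_zero hq hp)]
    congr 2
    ring
  | mul a b ha hb =>
    rw [SkewPairing.mul_right_apply _ _ _ _ (reprDet hq hp), map_mul, ← ha, ← hb]
    simp only [reprDet, Finset.univ_unique, Finset.sum_singleton]
  | add a b ha hb => rw [map_add, ha, hb, map_add]

theorem isUnit_rightHom_cgDet (hq : q ≠ 0) (hp : p ≠ 0) :
    IsUnit ((cgPairing hq hp).rightHom (cgDet n q p)) := by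
  rw [rightHom_cgDet]
  exact isUnit_diagChar (zpow_ne_zero _ (kappa_ne_zero hq hp)) _

theorem rightHom_cgDet_eq_one (hq : q ≠ 0) (hp : p ≠ 0) (h : p ^ n = q) :
    (cgPairing hq hp).rightHom (cgDet n q p) = 1 := by
  rw [rightHom_cgDet, ← diagChar_one]
  simp only [h, mul_inv_cancel₀ hq, one_zpow]

theorem leftHom_cgDet_eq_one (hq : q ≠ 0) (hp : p ≠ 0) (h : p ^ n = q) :
    (cgPairing hq hp).leftHom (cgDet n q p) = 1 := by
  rw [leftHom_cgDet, ← MulOpposite.op_one, ← diagChar_one]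
  simp only [h, mul_inv_cancel₀ hq, one_zpow]

end


/-! ### Algebra extensions of `A(R)` in which the quantum determinant is invertible -/

section antipode

open WithConv Coalgebra

variable {C X : Type*} [Ring C] [Bialgebra ℂ C] [Ring X] [Algebra ℂ X]

/-- The linear map underlying an anti-homomorphism. -/
def antiLin (S : C →ₐ[ℂ] Xᵐᵒᵖ) : C →ₗ[ℂ] X :=
  (MulOpposite.opLinearEquiv ℂ).symm.toLinearMap ∘ₗ S.toLinearMap

@[simp] theorem antiLin_apply (S : C →ₐ[ℂ] Xᵐᵒᵖ) (c : C) : antiLin S c = (S c).unop := rfl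

/-- `∑ S(c₁) f(c₂) = ε(c) = ∑ f(c₁) S(c₂)` -/
def AntipodeAt (S : C →ₐ[ℂ] Xᵐᵒᵖ) (f : C →ₐ[ℂ] X) (c : C) : Prop :=
  (toConv (antiLin S) * toConv f.toLinearMap) c = algebraMap ℂ X (counit c) ∧
  (toConv f.toLinearMap * toConv (antiLin S)) c = algebraMap ℂ X (counit c)

variable {S : C →ₐ[ℂ] Xᵐᵒᵖ} {f : C →ₐ[ℂ] X}

theorem antipodeAt_iff {c : C} {ι : Type*} (r : Coalgebra.Repr ℂ c ι) : AntipodeAt S f c ↔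
    ∑ i ∈ r.index, (S (r.left i)).unop * f (r.right i) = algebraMap ℂ X (counit c) ∧
    ∑ i ∈ r.index, f (r.left i) * (S (r.right i)).unop = algebraMap ℂ X (counit c) := by
  rw [AntipodeAt, r.convMul_apply, r.convMul_apply]
  rfl

theorem antipodeAt_algebraMap (x : ℂ) : AntipodeAt S f (algebraMap ℂ C x) := by
  have h : ∀ φ : WithConv (C →ₗ[ℂ] X), φ 1 = 1 → φ (algebraMap ℂ C x)
      = algebraMap ℂ X (counit (R := ℂ) (algebraMap ℂ C x)) := by
    intro φ h
    rw [Algebra.algebraMap_eq_smul_one, map_smul, map_smul, Bialgebra.counit_one, h,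
      smul_eq_mul, mul_one, Algebra.algebraMap_eq_smul_one]
  refine ⟨h _ ?_, h _ ?_⟩ <;> simp [Algebra.TensorProduct.one_def]

theorem AntipodeAt.add {c d : C} (hc : AntipodeAt S f c) (hd : AntipodeAt S f d) :
    AntipodeAt S f (c + d) :=
  ⟨by rw [map_add, hc.1, hd.1, map_add, map_add], by rw [map_add, hc.2, hd.2, map_add, map_add]⟩

/-- As `S` reverses products, the sum for one factor is nested inside the sum for the other. The
inner sum is a scalar, hence central, and can be moved out. -/
theorem AntipodeAt.mul {c d : C} (hc : AntipodeAt S f c) (hd : AntipodeAt S f d) :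
    AntipodeAt S f (c * d) := by
  have hc' := (antipodeAt_iff (ℛ ℂ c)).1 hc
  have hd' := (antipodeAt_iff (ℛ ℂ d)).1 hd
  rw [antipodeAt_iff ((ℛ ℂ c).mul (ℛ ℂ d))]
  have hi : ((ℛ ℂ c).mul (ℛ ℂ d)).index = (ℛ ℂ c).index ×ˢ (ℛ ℂ d).index := rfl
  have hl : ∀ i j, ((ℛ ℂ c).mul (ℛ ℂ d)).left (i, j) = (ℛ ℂ c).left i * (ℛ ℂ d).left j :=
    fun _ _ => rfl
  have hr : ∀ i j, ((ℛ ℂ c).mul (ℛ ℂ d)).right (i, j) = (ℛ ℂ c).right i * (ℛ ℂ d).right j :=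
    fun _ _ => rfl
  rw [hi, Finset.sum_product, Finset.sum_product]
  simp only [hl, hr, map_mul, MulOpposite.unop_mul, Bialgebra.counit_mul]
  constructor
  · rw [Finset.sum_comm, ← hd'.1, Finset.mul_sum]
    refine Finset.sum_congr rfl fun j _ => ?_
    rw [← mul_assoc, Algebra.commutes, ← hc'.1, Finset.mul_sum, Finset.sum_mul]
    exact Finset.sum_congr rfl fun i _ => by simp only [mul_assoc]
  · rw [← hc'.2, Finset.sum_mul]
    refine Finset.sum_congr rfl fun i _ => ?_
    rw [mul_assoc, ← Algebra.commutes, ← hd'.2, Finset.sum_mul, Finset.mul_sum]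
    exact Finset.sum_congr rfl fun j _ => by simp only [mul_assoc]

end antipode

section extension

open WithConv Coalgebra

variable {n : ℕ} {q p : ℂ} {b : Prop}

/-- The algebra map `f` is a localization of `A(R)` at the powers of the quantum determinant, or,
if `b` holds, a quotient of `A(R)` in which the quantum determinant becomes `1`. -/
structure DetExtension (b : Prop) {X : Type} [Ring X] [Algebra ℂ X] (f : CGA n q p →ₐ[ℂ] X) :
    Prop where
  isUnit : IsUnit (f (cgDet n q p))
  eq_one : b → f (cgDet n q p) = 1
  exists_mul : ∀ x, ∃ (m : ℕ) (a : CGA n q p), f (cgDet n q p) ^ m * x = f a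
  exists_lift : ∀ {Y : Type} [Ring Y] [Algebra ℂ Y] (φ : CGA n q p →ₐ[ℂ] Y),
    IsUnit (φ (cgDet n q p)) → (b → φ (cgDet n q p) = 1) → ∃ ψ : X →ₐ[ℂ] Y, ψ.comp f = φ

namespace DetExtension

section

variable {X : Type} [Ring X] [Algebra ℂ X] {f : CGA n q p →ₐ[ℂ] X} (h : DetExtension b f)
include h

/-- Every element has the form `g^(-m) f(a)` with `g` the image of `det_q`, so closure under sums is
not needed. -/
theorem induction {P : X → Prop} (map : ∀ a, P (f a))
    (inv : ∀ d, f (cgDet n q p) * d = 1 → d * f (cgDet n q p) = 1 → P d)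
    (mul : ∀ x y, P x → P y → P (x * y)) (x : X) : P x := by
  obtain ⟨u, hu⟩ := h.isUnit
  obtain ⟨m, a, ha⟩ := h.exists_mul x
  have hx : x = (↑u⁻¹ : X) ^ m * f a := by
    rw [← ha, ← hu, ← mul_assoc, ← Units.val_pow_eq_pow_val, ← Units.val_pow_eq_pow_val,
      ← Units.val_mul, inv_pow, inv_mul_cancel, Units.val_one, one_mul]
  have hinv : P (↑u⁻¹ : X) := inv _ (by rw [← hu, Units.mul_inv]) (by rw [← hu, Units.inv_mul])
  have hpow : ∀ m : ℕ, P ((↑u⁻¹ : X) ^ m) := by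
    intro m
    induction m with
    | zero => rw [pow_zero, ← map_one f]; exact map 1
    | succ m ih => rw [pow_succ]; exact mul _ _ ih hinv
  rw [hx]
  exact mul _ _ (hpow m) (map a)

theorem hom_ext {Y : Type*} [Ring Y] [Algebra ℂ Y] {φ ψ : X →ₐ[ℂ] Y}
    (he : ∀ a, φ (f a) = ψ (f a)) : φ = ψ := by
  refine AlgHom.ext fun x => ?_
  induction x using h.induction with
  | map a => exact he a
  | inv d h1 h2 =>
    have e1 : φ d * φ (f (cgDet n q p)) = 1 := by rw [← map_mul, h2, map_one]
    have e2 : φ (f (cgDet n q p)) * ψ d = 1 := by rw [he, ← map_mul, h1, map_one]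
    exact left_inv_eq_right_inv e1 e2
  | mul x y hx hy => rw [map_mul, map_mul, hx, hy]

theorem hom_ext_gen {Y : Type*} [Ring Y] [Algebra ℂ Y] {φ ψ : X →ₐ[ℂ] Y}
    (he : ∀ i j, φ (f (cgT n q p i j)) = ψ (f (cgT n q p i j))) : φ = ψ :=
  h.hom_ext fun a => DFunLike.congr_fun (FRT.hom_ext (f := φ.comp f) (g := ψ.comp f) he) a

/-- Dividing the cofactor matrix by `det_q` on the left gives a left inverse, and dividing on the
right gives a right inverse; the two coincide, although `det_q` need not be central. -/
theorem exists_inverse (hq : q ≠ 0) (hp : p ≠ 0) : ∃ U : Matrix (Fin n) (Fin n) X,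
    U * (FRT.genMatrix (cremmerGervais n q p)).map f = 1 ∧
    (FRT.genMatrix (cremmerGervais n q p)).map f * U = 1 := by
  obtain ⟨N, d, hd, h1, h2⟩ := exists_cofactor (n := n) hq hp
  obtain ⟨u, hu⟩ := h.isUnit
  set M := (FRT.genMatrix (cremmerGervais n q p)).map f with hM
  have e1 : (Matrix.of fun m i => (d m)⁻¹ • ((↑u⁻¹ : X) * f (N m i))) * M = 1 := by
    ext m k
    have e := congrArg f (h1 m k)
    simp only [map_sum, map_mul] at e
    simp only [Matrix.mul_apply, Matrix.of_apply, hM, Matrix.map_apply, FRT.genMatrix_apply,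
      smul_mul_assoc, mul_assoc, ← Finset.smul_sum, ← Finset.mul_sum, e]
    rw [Matrix.one_apply]
    split_ifs with h3 h4 h4
    · rw [map_smul, mul_smul_comm, ← hu, Units.inv_mul, smul_smul, inv_mul_cancel₀ (hd m), one_smul]
    · exact absurd h3.symm h4
    · exact absurd h4.symm h3
    · rw [map_zero, mul_zero, smul_zero]
  have e2 : M * (Matrix.of fun m i => (d i)⁻¹ • (f (N m i) * (↑u⁻¹ : X))) = 1 := by
    ext m k
    have e := congrArg f (h2 m k)
    simp only [map_sum, map_mul] at e
    simp only [Matrix.mul_apply, Matrix.of_apply, hM, Matrix.map_apply, FRT.genMatrix_apply,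
      mul_smul_comm, ← mul_assoc, ← Finset.smul_sum, ← Finset.sum_mul, e]
    rw [Matrix.one_apply]
    split_ifs with h3 h4 h4
    · rw [map_smul, smul_mul_assoc, ← hu, Units.mul_inv, smul_smul, h3, inv_mul_cancel₀ (hd m),
        one_smul]
    · exact absurd h3.symm h4
    · exact absurd h4.symm h3
    · rw [map_zero, zero_mul, smul_zero]
  exact ⟨_, e1, by rwa [left_inv_eq_right_inv e1 e2]⟩

/-- The extension of an algebra map. -/
def lift {Y : Type} [Ring Y] [Algebra ℂ Y] (φ : CGA n q p →ₐ[ℂ] Y)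
    (hu : IsUnit (φ (cgDet n q p))) (h1 : b → φ (cgDet n q p) = 1) : X →ₐ[ℂ] Y :=
  (h.exists_lift φ hu h1).choose

@[simp] theorem lift_map {Y : Type} [Ring Y] [Algebra ℂ Y] (φ : CGA n q p →ₐ[ℂ] Y)
    (hu : IsUnit (φ (cgDet n q p))) (h1 : b → φ (cgDet n q p) = 1) (a : CGA n q p) :
    h.lift φ hu h1 (f a) = φ a :=
  DFunLike.congr_fun (h.exists_lift φ hu h1).choose_spec a

/-- The comultiplication of the extension. -/
def comulHom (hq : q ≠ 0) (hp : p ≠ 0) : X →ₐ[ℂ] X ⊗[ℂ] X :=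
  h.lift ((Algebra.TensorProduct.map f f).comp (Bialgebra.comulAlgHom ℂ (CGA n q p)))
    (by
      rw [AlgHom.comp_apply, Bialgebra.comulAlgHom_apply, comul_cgDet hq hp,
        Algebra.TensorProduct.map_tmul]
      obtain ⟨u, hu⟩ := h.isUnit
      refine ⟨⟨f (cgDet n q p) ⊗ₜ f (cgDet n q p), (↑u⁻¹ : X) ⊗ₜ (↑u⁻¹ : X), ?_, ?_⟩, rfl⟩ <;>
      simp [← hu, Algebra.TensorProduct.one_def])
    (fun hb => by
      rw [AlgHom.comp_apply, Bialgebra.comulAlgHom_apply, comul_cgDet hq hp,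
        Algebra.TensorProduct.map_tmul, h.eq_one hb, Algebra.TensorProduct.one_def])

/-- The counit of the extension. -/
def counitHom (hq : q ≠ 0) (hp : p ≠ 0) : X →ₐ[ℂ] ℂ :=
  h.lift (Bialgebra.counitAlgHom ℂ (CGA n q p))
    (by rw [Bialgebra.counitAlgHom_apply, counit_cgDet hq hp]; exact isUnit_one)
    (fun _ => (Bialgebra.counitAlgHom_apply ℂ (CGA n q p) _).trans (counit_cgDet hq hp))

theorem comulHom_gen (hq : q ≠ 0) (hp : p ≠ 0) (i j : Fin n) :
    h.comulHom hq hp (f (cgT n q p i j)) = ∑ u, f (cgT n q p i u) ⊗ₜ f (cgT n q p u j) := by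
  rw [comulHom, lift_map, AlgHom.comp_apply, Bialgebra.comulAlgHom_apply, FRT.comul_T, map_sum]
  simp only [Algebra.TensorProduct.map_tmul]

theorem counitHom_gen (hq : q ≠ 0) (hp : p ≠ 0) (i j : Fin n) :
    h.counitHom hq hp (f (cgT n q p i j)) = if i = j then 1 else 0 := by
  rw [counitHom, lift_map, Bialgebra.counitAlgHom_apply, FRT.counit_T]

/-- The bialgebra structure of the extension. -/
@[reducible] def bialgebra (hq : q ≠ 0) (hp : p ≠ 0) : Bialgebra ℂ X :=
  Bialgebra.ofAlgHom (h.comulHom hq hp) (h.counitHom hq hp)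
    (by
      refine h.hom_ext_gen fun i j => ?_
      simp only [AlgHom.comp_apply, comulHom_gen, map_sum, Algebra.TensorProduct.map_tmul,
        TensorProduct.sum_tmul, TensorProduct.tmul_sum, AlgHom.id_apply]
      exact Finset.sum_comm)
    (by
      refine h.hom_ext_gen fun i j => ?_
      simp [comulHom_gen, counitHom_gen, TensorProduct.ite_tmul, Finset.sum_ite_eq])
    (by
      refine h.hom_ext_gen fun i j => ?_
      simp [comulHom_gen, counitHom_gen, TensorProduct.tmul_ite])

/-- The map to the extension as a bialgebra map. -/
def bialgHom (hq : q ≠ 0) (hp : p ≠ 0) :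
    letI := h.bialgebra hq hp
    CGA n q p →ₐc[ℂ] X :=
  letI := h.bialgebra hq hp
  BialgHom.ofAlgHom f
    (AlgHom.ext fun a => h.lift_map _ _ _ a)
    (AlgHom.ext fun a => (h.lift_map _ _ _ a).symm)

end

end DetExtension

end extension


/-! ### The antipode and the braiding of an extension -/

open WithConv Coalgebra

namespace DetExtension

section

variable {n : ℕ} {q p : ℂ} {b : Prop} {X : Type} [Ring X] [Bialgebra ℂ X]
  {f : CGA n q p →ₐc[ℂ] X} (h : DetExtension b (f : CGA n q p →ₐ[ℂ] X))
include h

/-- The antipode sends the matrix `T` to its inverse. The required relations are those of `A(R)`,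
read for the inverse of the tensor square of `T`. -/
theorem exists_anti (hq : q ≠ 0) (hp : p ≠ 0) : ∃ S : CGA n q p →ₐ[ℂ] Xᵐᵒᵖ,
    ∀ a, AntipodeAt S (f : CGA n q p →ₐ[ℂ] X) a := by
  obtain ⟨U, hUM, hMU⟩ := h.exists_inverse hq hp
  set M := (FRT.genMatrix (cremmerGervais n q p)).map (f : CGA n q p →ₐ[ℂ] X) with hM
  have hMa : ∀ i j, M i j = f (cgT n q p i j) := fun _ _ => rfl
  have eUM : ∀ i j, ∑ u, U i u * M u j = if i = j then 1 else 0 := fun i j => by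
    rw [← Matrix.mul_apply, hUM, Matrix.one_apply]
  have eMU : ∀ i j, ∑ u, M i u * U u j = if i = j then 1 else 0 := fun i j => by
    rw [← Matrix.mul_apply, hMU, Matrix.one_apply]
  set TT : Matrix (Fin n × Fin n) (Fin n × Fin n) X :=
    Matrix.of fun x y => M x.1 y.1 * M x.2 y.2 with hTT
  -- The factors are in the opposite order because the entries do not commute; this order makes `UU`
  -- inverse to `TT`.
  set UU : Matrix (Fin n × Fin n) (Fin n × Fin n) X :=
    Matrix.of fun x y => U x.2 y.2 * U x.1 y.1 with hUU
  set RR : Matrix (Fin n × Fin n) (Fin n × Fin n) X :=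
    Matrix.of fun x y => algebraMap ℂ X (cremmerGervais n q p x.2 x.1 y.1 y.2) with hRR
  have e1 : TT * UU = 1 := by
    ext ⟨i, j⟩ ⟨c, d⟩
    simp only [Matrix.mul_apply, Fintype.sum_prod_type, hTT, hUU, Matrix.of_apply]
    have e : ∀ a, ∑ b, M i a * M j b * (U b d * U a c)
        = M i a * (∑ b, M j b * U b d) * U a c := fun a => by
      simp only [Finset.mul_sum, Finset.sum_mul, mul_assoc]
    simp only [e, eMU, Matrix.one_apply, Prod.mk.injEq]
    by_cases hjd : j = d
    · simp only [hjd, if_true, mul_one, and_true, eMU]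
    · simp [hjd]
  have e2 : UU * TT = 1 := by
    ext ⟨i, j⟩ ⟨c, d⟩
    simp only [Matrix.mul_apply, Fintype.sum_prod_type, hTT, hUU, Matrix.of_apply]
    rw [Finset.sum_comm]
    have e : ∀ b, ∑ a, U j b * U i a * (M a c * M b d)
        = U j b * (∑ a, U i a * M a c) * M b d := fun a => by
      simp only [Finset.mul_sum, Finset.sum_mul, mul_assoc]
    simp only [e, eUM, Matrix.one_apply, Prod.mk.injEq]
    by_cases hic : i = c
    · simp only [hic, if_true, mul_one, true_and, eUM]
    · simp [hic]
  have e3 : RR * TT = TT * RR := by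
    ext ⟨i, j⟩ ⟨c, d⟩
    simp only [Matrix.mul_apply, Fintype.sum_prod_type, hTT, hRR, Matrix.of_apply]
    have e := congrArg f (FRT.rel (cremmerGervais n q p) i j c d)
    simp only [map_sum, map_smul, map_mul] at e
    simp only [← Algebra.smul_def, ← Algebra.commutes, hMa]
    exact e
  have e4 : RR * UU = UU * RR := by
    calc RR * UU = UU * TT * RR * UU := by rw [e2, one_mul]
      _ = UU * (TT * RR) * UU := by rw [mul_assoc UU]
      _ = UU * RR * (TT * UU) := by rw [← e3, ← mul_assoc, mul_assoc (UU * RR)]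
      _ = UU * RR := by rw [e1, mul_one]
  refine ⟨FRT.lift _ (fun i j => MulOpposite.op (U i j)) (fun i j c d => ?_), fun a => ?_⟩
  · refine MulOpposite.unop_injective ?_
    have e := congrFun (congrFun e4 (i, j)) (c, d)
    simp only [Matrix.mul_apply, Fintype.sum_prod_type, hUU, hRR, Matrix.of_apply,
      ← Algebra.commutes, ← Algebra.smul_def] at e
    simpa only [Finset.unop_sum, MulOpposite.unop_smul, MulOpposite.unop_mul, MulOpposite.unop_op]
      using e
  · induction a using FRT.induction with
    | algebraMap c => exact antipodeAt_algebraMap c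
    | add x y hx hy => exact hx.add hy
    | mul x y hx hy => exact hx.mul hy
    | T i j =>
      rw [antipodeAt_iff (FRT.reprT i j), FRT.counit_T]
      simp only [FRT.reprT, FRT.lift_T, MulOpposite.unop_op]
      refine ⟨(eUM i j).trans ?_, (eMU i j).trans ?_⟩ <;> split_ifs <;> simp

/-- The antipode identity at the group-like `det_q` makes its image under `S` invertible, so `S`
extends to `X`. The inverse of `det_q` is again group-like and its image under `S` is `det_q`, so
the identities hold there too. -/
theorem exists_antipode (hq : q ≠ 0) (hp : p ≠ 0) : ∃ S : X →ₐ[ℂ] Xᵐᵒᵖ,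
    ∀ x, AntipodeAt S (AlgHom.id ℂ X) x := by
  obtain ⟨S, hS⟩ := h.exists_anti hq hp
  have hg := (antipodeAt_iff (reprDet hq hp)).1 (hS (cgDet n q p))
  simp only [reprDet, Finset.univ_unique, Finset.sum_singleton, counit_cgDet hq hp, map_one] at hg
  have hu : IsUnit (S (cgDet n q p)) :=
    ⟨⟨S (cgDet n q p), MulOpposite.op (f (cgDet n q p)), MulOpposite.unop_injective hg.2,
      MulOpposite.unop_injective hg.1⟩, rfl⟩
  have h1 : b → S (cgDet n q p) = 1 := fun hb => by
    have e := h.eq_one hb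
    rw [e, mul_one] at hg
    exact MulOpposite.unop_injective hg.1
  refine ⟨h.lift S hu h1, fun x => ?_⟩
  have hmap : ∀ a, h.lift S hu h1 (f a) = S a := fun a => h.lift_map S hu h1 a
  induction x using h.induction with
  | map a =>
    change AntipodeAt _ _ (f a)
    rw [antipodeAt_iff ((ℛ ℂ a).induced f)]
    have := (antipodeAt_iff (ℛ ℂ a)).1 (hS a)
    simp only [Coalgebra.Repr.induced, Function.comp_apply, hmap, CoalgHomClass.counit_comp_apply]
    exact this
  | inv d hd1 hd2 =>
    have hc : comul (R := ℂ) (f (cgDet n q p)) = f (cgDet n q p) ⊗ₜ[ℂ] f (cgDet n q p) := by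
      rw [← CoalgHomClass.map_comp_comul_apply, comul_cgDet hq hp]
      rfl
    have hd : comul (R := ℂ) d = d ⊗ₜ[ℂ] d := by
      refine left_inv_eq_right_inv (a := comul (R := ℂ) (f (cgDet n q p))) ?_ ?_
      · rw [← Bialgebra.comul_mul]
        refine (congrArg _ hd2).trans Bialgebra.comul_one
      · rw [hc, Algebra.TensorProduct.tmul_mul_tmul]
        change (_ * d) ⊗ₜ[ℂ] (_ * d) = 1
        erw [hd1]
        rfl
    have hε : counit (R := ℂ) d = 1 := by
      have e := congrArg (counit (R := ℂ)) hd1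
      rw [Bialgebra.counit_mul, Bialgebra.counit_one] at e
      change counit (R := ℂ) (f (cgDet n q p)) * _ = 1 at e
      rwa [CoalgHomClass.counit_comp_apply, counit_cgDet hq hp, one_mul] at e
    have hSd : (h.lift S hu h1 d).unop = f (cgDet n q p) := by
      refine left_inv_eq_right_inv (a := (S (cgDet n q p)).unop) ?_ hg.1
      rw [← hmap, ← MulOpposite.unop_mul, ← map_mul]
      change (h.lift S hu h1 ((f : CGA n q p →ₐ[ℂ] X) (cgDet n q p) * d)).unop = 1
      rw [hd1, map_one, MulOpposite.unop_one]
    let r : Coalgebra.Repr ℂ d Unit :=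
      { index := Finset.univ, left := fun _ => d, right := fun _ => d, eq := by simp [hd] }
    rw [antipodeAt_iff r]
    simp only [r, Finset.univ_unique, Finset.sum_singleton, hSd, AlgHom.id_apply, hε, map_one]
    exact ⟨hd1, hd2⟩
  | mul x y hx hy => exact hx.mul hy

end

theorem exists_hopfAlgebra {n : ℕ} {q p : ℂ} {b : Prop} {X : Type} [Ring X]
    {φ : CGA n q p →+* X} (h : ∃ (_ : Algebra ℂ X) (f : CGA n q p →ₐ[ℂ] X), (∀ a, f a = φ a) ∧
      DetExtension b f) (hq : q ≠ 0) (hp : p ≠ 0) :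
    ∃ (_ : HopfAlgebra ℂ X) (ι : CGA n q p →ₐc[ℂ] X), (∀ a, ι a = φ a) ∧
      DetExtension b (ι : CGA n q p →ₐ[ℂ] X) := by
  obtain ⟨_, f, hf, h⟩ := h
  let := h.bialgebra hq hp
  have h' : DetExtension b ((h.bialgHom hq hp : CGA n q p →ₐc[ℂ] X) : CGA n q p →ₐ[ℂ] X) := h
  obtain ⟨S, hS⟩ := h'.exists_antipode hq hp
  exact ⟨HopfAlgebra.ofConvInverse (antiLin S)
    (WithConv.ext (LinearMap.ext fun x => (hS x).1))
    (WithConv.ext (LinearMap.ext fun x => (hS x).2)), h.bialgHom hq hp, hf, h'⟩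

/-- Bialgebra maps extend to bialgebra maps. -/
theorem exists_bialgHom {n : ℕ} {q p : ℂ} {b : Prop} {X : Type} [Ring X] [Bialgebra ℂ X]
    {f : CGA n q p →ₐc[ℂ] X} (h : DetExtension b (f : CGA n q p →ₐ[ℂ] X))
    {Y : Type} [Ring Y] [Bialgebra ℂ Y] (φ : CGA n q p →ₐc[ℂ] Y) (hu : IsUnit (φ (cgDet n q p)))
    (h1 : b → φ (cgDet n q p) = 1) : ∃ θ : X →ₐc[ℂ] Y, ∀ a, θ (f a) = φ a := by
  have hmap : ∀ a, h.lift (φ : CGA n q p →ₐ[ℂ] Y) hu h1 (f a) = φ a :=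
    fun a => h.lift_map _ hu h1 a
  refine ⟨BialgHom.ofAlgHom (h.lift (φ : CGA n q p →ₐ[ℂ] Y) hu h1) (h.hom_ext fun a => ?_)
    (h.hom_ext fun a => ?_), hmap⟩
  · change counit (R := ℂ) (h.lift (φ : CGA n q p →ₐ[ℂ] Y) hu h1 (f a)) = counit (R := ℂ) (f a)
    rw [hmap, CoalgHomClass.counit_comp_apply, CoalgHomClass.counit_comp_apply]
  · change Algebra.TensorProduct.map (h.lift (φ : CGA n q p →ₐ[ℂ] Y) hu h1)
      (h.lift (φ : CGA n q p →ₐ[ℂ] Y) hu h1) (comul (R := ℂ) (f a))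
      = comul (R := ℂ) (h.lift (φ : CGA n q p →ₐ[ℂ] Y) hu h1 (f a))
    rw [hmap, ← ((ℛ ℂ a).induced f).eq, ← ((ℛ ℂ a).induced φ).eq, map_sum]
    simp only [Coalgebra.Repr.induced, Function.comp_apply, Algebra.TensorProduct.map_tmul, hmap]

end DetExtension

/-! ### Braidings from skew pairings -/

namespace SkewPairing

/-- Multiplicativity in the second variable turns both sums into `⟨a | ε(c) 1⟩`, so `⟨a | S(c)⟩` is
the convolution inverse of the pairing. -/
theorem sum_form_mul_form_antipode {H : Type*} [Ring H] [HopfAlgebra ℂ H] (σ : SkewPairing ℂ H H)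
    {a c : H} {ι κ : Type*} (ra : Coalgebra.Repr ℂ a ι) (rc : Coalgebra.Repr ℂ c κ) :
    ∑ i ∈ ra.index, ∑ j ∈ rc.index, σ.form (ra.left i) (rc.left j)
        * σ.form (ra.right i) (HopfAlgebra.antipode ℂ (rc.right j))
      = counit (R := ℂ) a * counit (R := ℂ) c ∧
    ∑ i ∈ ra.index, ∑ j ∈ rc.index, σ.form (ra.left i) (HopfAlgebra.antipode ℂ (rc.left j))
        * σ.form (ra.right i) (rc.right j)
      = counit (R := ℂ) a * counit (R := ℂ) c := by
  have e : ∀ d : H, counit (R := ℂ) c • σ.form a d = σ.form a (counit (R := ℂ) c • d) :=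
    fun d => (map_smul _ _ _).symm
  rw [← σ.one_right_apply, mul_comm, ← smul_eq_mul, e]
  constructor
  · rw [← HopfAlgebra.sum_mul_antipode_eq_smul rc, map_sum, Finset.sum_comm]
    exact Finset.sum_congr rfl fun j _ => (σ.mul_right_apply _ _ _ ra).symm
  · rw [← HopfAlgebra.sum_antipode_mul_eq_smul rc, map_sum, Finset.sum_comm]
    exact Finset.sum_congr rfl fun j _ => (σ.mul_right_apply _ _ _ ra).symm

/-- A skew pairing with the commutation relation is a braiding if it extends to a Hopf algebra. -/
def braidingOfHom {A H : Type*} [Ring A] [Bialgebra ℂ A] [Ring H] [HopfAlgebra ℂ H]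
    (σ : SkewPairing ℂ A A) (hσ : ∀ a c, σ.CommRel a c) (f : A →ₐc[ℂ] H) (τ : SkewPairing ℂ H H)
    (hτ : ∀ a c, τ.form (f a) (f c) = σ.form a c) : Braiding ℂ A where
  pair := σ.form
  comm a c ra rc := (σ.commRel_iff ra rc).1 (hσ a c)
  invertible := ⟨(τ.form.compl₂ (HopfAlgebra.antipode ℂ)).compl₁₂ (f : A →ₗ[ℂ] H) (f : A →ₗ[ℂ] H),
    fun a c ra rc => by
      have e := τ.sum_form_mul_form_antipode (ra.induced f) (rc.induced f)
      simp only [Coalgebra.Repr.induced, Function.comp_apply, hτ,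
        CoalgHomClass.counit_comp_apply] at e
      exact e⟩
  pair_mul a c d ra := σ.mul_right_apply a c d ra
  mul_pair a c d rd := σ.mul_left_apply a c d rd

end SkewPairing

/-! ### The pairing of an extension -/

namespace DetExtension

section

variable {n : ℕ} {q p : ℂ} {b : Prop} {X : Type} [Ring X] [HopfAlgebra ℂ X]
  {f : CGA n q p →ₐc[ℂ] X} (h : DetExtension b (f : CGA n q p →ₐ[ℂ] X))
include h

/-- The extension of the pairing in the second variable. -/
theorem exists_pairing_right (hq : q ≠ 0) (hp : p ≠ 0) (hb : b → p ^ n = q) :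
    ∃ σ : SkewPairing ℂ (CGA n q p) X, ∀ a c, σ.form a (f c) = (cgPairing hq hp).form a c := by
  set Φ := h.lift (cgPairing hq hp).rightHom (isUnit_rightHom_cgDet hq hp)
    -- Only a quotient imposing `det_q = 1` needs `p^n = q`; the localization needs just
    -- invertibility.
    (fun hh => rightHom_cgDet_eq_one hq hp (hb hh)) with hΦ
  have hmap : ∀ c, Φ (f c) = (cgPairing hq hp).rightHom c := fun c => h.lift_map _ _ _ c
  refine ⟨SkewPairing.ofRight Φ (h.hom_ext fun c => ?_) (h.hom_ext fun c => ?_), fun a c => ?_⟩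
  · change rightMulHom Φ (f c) = rightComulHom Φ (f c)
    refine WithConv.ext (TensorProduct.ext' fun x y => ?_)
    have e := DFunLike.congr_fun (SkewPairing.rightMulHom_rightHom (cgPairing (n := n) hq hp)) c
    have e' := congrArg (fun φ : WithConv (_ →ₗ[ℂ] ℂ) => φ (x ⊗ₜ[ℂ] y)) e
    simp only [rightMulHom_apply, rightComulHom_apply _ _ _ _ (ℛ ℂ c)] at e'
    rw [rightMulHom_apply, rightComulHom_apply _ _ _ _ ((ℛ ℂ c).induced f), hmap]
    simp only [Coalgebra.Repr.induced, Function.comp_apply, hmap]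
    exact e'
  · change Φ (f c) 1 = counit (R := ℂ) (f c)
    rw [hmap, CoalgHomClass.counit_comp_apply]
    exact (cgPairing hq hp).one_left_apply c
  · rw [SkewPairing.ofRight_form, hmap, SkewPairing.rightHom_apply]

/-- The extension of the pairing in both variables. -/
theorem exists_pairing (hq : q ≠ 0) (hp : p ≠ 0) (hb : b → p ^ n = q) :
    ∃ σ : SkewPairing ℂ X X, ∀ a c, σ.form (f a) (f c) = (cgPairing hq hp).form a c := by
  obtain ⟨σ, hσ⟩ := h.exists_pairing_right hq hp hb
  have hmul : ∀ x y, σ.form (cgDet n q p) (x * y)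
      = σ.form (cgDet n q p) x * σ.form (cgDet n q p) y := fun x y => by
    rw [σ.mul_right_apply _ _ _ (reprDet hq hp)]
    simp [reprDet]
  have hone : σ.form (cgDet n q p) 1 = 1 := by rw [σ.one_right_apply, counit_cgDet hq hp]
  -- As `det_q` is group-like, `⟨det_q | ·⟩` is a character of `X`, and composing it with the
  -- antipode of `X` gives its convolution inverse.
  have hu : IsUnit (σ.leftHom (cgDet n q p)) := by
    refine ⟨⟨σ.leftHom (cgDet n q p),
      MulOpposite.op (toConv (σ.form (cgDet n q p) ∘ₗ HopfAlgebra.antipode ℂ)), ?_, ?_⟩, rfl⟩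
    · refine MulOpposite.unop_injective (WithConv.ext (LinearMap.ext fun x => ?_))
      refine ((ℛ ℂ x).convMul_apply _ _).trans ?_
      have e := congrArg (σ.form (cgDet n q p)) (HopfAlgebra.sum_antipode_mul_eq_smul (ℛ ℂ x))
      simp only [map_sum, hmul, map_smul, hone] at e
      exact e.trans (mul_one _)
    · refine MulOpposite.unop_injective (WithConv.ext (LinearMap.ext fun x => ?_))
      refine ((ℛ ℂ x).convMul_apply _ _).trans ?_
      have e := congrArg (σ.form (cgDet n q p)) (HopfAlgebra.sum_mul_antipode_eq_smul (ℛ ℂ x))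
      simp only [map_sum, hmul, map_smul, hone] at e
      exact e.trans (mul_one _)
  -- The character `⟨det_q | ·⟩` agrees with the counit on the image of `A(R)` when `p^n = q`, hence
  -- on all of `X`.
  have h1 : b → σ.leftHom (cgDet n q p) = 1 := fun hh => by
    have e : AlgHom.ofLinearMap (σ.form (cgDet n q p)) hone hmul = Bialgebra.counitAlgHom ℂ X :=
      h.hom_ext fun c => by
        change σ.form (cgDet n q p) (f c) = counit (R := ℂ) (f c)
        rw [hσ, CoalgHomClass.counit_comp_apply]
        have e := congrArg (fun φ => (MulOpposite.unop φ) c) (leftHom_cgDet_eq_one (n := n) hq hp (hb hh))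
        exact e
    exact MulOpposite.unop_injective (WithConv.ext (LinearMap.ext fun x => DFunLike.congr_fun e x))
  set Ψ := h.lift σ.leftHom hu h1 with hΨ
  have hmap : ∀ c, Ψ (f c) = σ.leftHom c := fun c => h.lift_map _ _ _ c
  refine ⟨SkewPairing.ofLeft Ψ (h.hom_ext fun c => ?_) (h.hom_ext fun c => ?_), fun a c => ?_⟩
  · change leftMulHom Ψ (f c) = leftComulHom Ψ (f c)
    refine MulOpposite.unop_injective (WithConv.ext (TensorProduct.ext' fun x y => ?_))
    have e := DFunLike.congr_fun (SkewPairing.leftMulHom_leftHom σ) c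
    have e' := congrArg (fun φ : (WithConv (_ →ₗ[ℂ] ℂ))ᵐᵒᵖ => φ.unop (x ⊗ₜ[ℂ] y)) e
    simp only [leftMulHom_apply, leftComulHom_apply _ _ _ _ (ℛ ℂ c)] at e'
    rw [leftMulHom_apply, leftComulHom_apply _ _ _ _ ((ℛ ℂ c).induced f), hmap]
    simp only [Coalgebra.Repr.induced, Function.comp_apply, hmap]
    exact e'
  · change (Ψ (f c)).unop 1 = counit (R := ℂ) (f c)
    rw [hmap, CoalgHomClass.counit_comp_apply]
    exact σ.one_right_apply c
  · rw [SkewPairing.ofLeft_form, hmap, SkewPairing.leftHom_apply, hσ]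

/-- The relation holds on the image of `A(R)` and is closed under products and inverses. It is
extended first in the second variable and then in the first. -/
theorem commRel {hq : q ≠ 0} {hp : p ≠ 0} {σ : SkewPairing ℂ X X}
    (hσ : ∀ a c, σ.form (f a) (f c) = (cgPairing hq hp).form a c) (x y : X) : σ.CommRel x y := by
  have hgen : ∀ a c, σ.CommRel (f a) (f c) := by
    intro a c
    rw [σ.commRel_iff ((ℛ ℂ a).induced f) ((ℛ ℂ c).induced f)]
    have e := congrArg f (((cgPairing hq hp).commRel_iff (ℛ ℂ a) (ℛ ℂ c)).1
      (FRT.pairing_commRel (YangBaxter_cremmerGervais hq hp) a c))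
    simp only [map_sum, map_smul, map_mul] at e
    simp only [Coalgebra.Repr.induced, Function.comp_apply, hσ]
    exact e
  have h1 : ∀ y, ∀ a, σ.CommRel (f a) y := by
    intro y
    induction y using h.induction with
    | map c => exact fun a => hgen a c
    | inv d hd1 hd2 =>
      refine SkewPairing.commRel_right_inv (u := (f : CGA n q p →ₗc[ℂ] X)) (fun a => ?_) hd1 hd2
      exact hgen a (cgDet n q p)
    | mul y z hy hz => exact SkewPairing.commRel_right_mul (u := (f : CGA n q p →ₗc[ℂ] X)) hy hz
  revert y
  induction x using h.induction with
  | map a => exact fun y => h1 y a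
  | inv d hd1 hd2 => exact SkewPairing.commRel_left_inv (fun y => h1 y (cgDet n q p)) hd1 hd2
  | mul x z hx hz => exact SkewPairing.commRel_left_mul hx hz

/-- Bialgebra maps between extensions preserve the pairings. -/
theorem form_map {hq : q ≠ 0} {hp : p ≠ 0} {σ : SkewPairing ℂ X X}
    (hσ : ∀ a c, σ.form (f a) (f c) = (cgPairing hq hp).form a c) {Y : Type} [Ring Y]
    [HopfAlgebra ℂ Y] {τ : SkewPairing ℂ Y Y} (θ : X →ₐc[ℂ] Y)
    (hτ : ∀ a c, τ.form (θ (f a)) (θ (f c)) = (cgPairing hq hp).form a c) (x y : X) :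
    τ.form (θ x) (θ y) = σ.form x y := by
  have h1 : ∀ a y, τ.form (θ (f a)) (θ y) = σ.form (f a) y := by
    intro a y
    have e : (pullback ℂ ((θ.comp f : CGA n q p →ₐc[ℂ] Y) : CGA n q p →ₗc[ℂ] Y)).comp
        (τ.rightHom.comp (θ : X →ₐ[ℂ] Y))
        = (pullback ℂ (f : CGA n q p →ₗc[ℂ] X)).comp σ.rightHom :=
      h.hom_ext fun c => WithConv.ext (LinearMap.ext fun a => (hτ a c).trans (hσ a c).symm)
    exact congrArg (fun φ : WithConv (_ →ₗ[ℂ] ℂ) => φ a) (DFunLike.congr_fun e y)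
  have e : (AlgHom.op (pullback ℂ (θ : X →ₗc[ℂ] Y))).comp (τ.leftHom.comp (θ : X →ₐ[ℂ] Y))
      = σ.leftHom :=
    h.hom_ext fun a => MulOpposite.unop_injective (WithConv.ext (LinearMap.ext fun y => h1 a y))
  exact congrArg (fun φ : (WithConv (_ →ₗ[ℂ] ℂ))ᵐᵒᵖ => φ.unop y) (DFunLike.congr_fun e x)

end

end DetExtension


open WithConv Coalgebra

/-! ### The quantum groups -/

section

variable {n : ℕ} {q p : ℂ}

/-- The algebra structure of the localization. -/
abbrev algebraCGGL (n : ℕ) (q p : ℂ) [OreLocalization.OreSet (Submonoid.powers (cgDet n q p))] :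
    Algebra ℂ (CGGL n q p) :=
  inferInstanceAs (Algebra ℂ (OreLocalization (Submonoid.powers (cgDet n q p)) (CGA n q p)))

/-- The algebra structure of the quotient. -/
abbrev algebraCGSL (n : ℕ) (q p : ℂ) : Algebra ℂ (CGSL n q p) :=
  inferInstanceAs (Algebra ℂ (CGA n q p ⧸ (TwoSidedIdeal.span {cgDet n q p - 1}).asIdeal))

theorem exists_detExtension_cgToGL [OreLocalization.OreSet (Submonoid.powers (cgDet n q p))] :
    ∃ (_ : Algebra ℂ (CGGL n q p)) (f : CGA n q p →ₐ[ℂ] CGGL n q p),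
      (∀ a, f a = cgToGL n q p a) ∧ DetExtension False f := by
  let S := Submonoid.powers (cgDet n q p)
  let alg := algebraCGGL n q p
  let f : CGA n q p →ₐ[ℂ] CGGL n q p := { cgToGL n q p with commutes' := fun _ => rfl }
  refine ⟨alg, f, fun _ => rfl,
    { isUnit := OreLocalization.numerator_isUnit (⟨cgDet n q p, Submonoid.mem_powers _⟩ : S)
      eq_one := False.elim
      exists_mul := fun x => ?_
      exists_lift := fun {Y} _ _ φ hu _ => ?_ }⟩
  · change OreLocalization S (CGA n q p) at x
    induction x using OreLocalization.ind with
    | _ r s =>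
      obtain ⟨m, hm⟩ := s.2
      refine ⟨m, r, ?_⟩
      have e : f (cgDet n q p) ^ m = cgToGL n q p s := by
        rw [← map_pow]
        exact congrArg (cgToGL n q p) hm
      rw [e]
      exact OreLocalization.mul_cancel
  · have hS : ∀ s : S, IsUnit ((φ : CGA n q p →* Y).comp S.subtype s) := by
      rintro ⟨_, m, rfl⟩
      change IsUnit (φ (cgDet n q p ^ m))
      rw [map_pow]
      exact hu.pow m
    let u := OreLocalization.universalHom (φ : CGA n q p →+* Y) (IsUnit.liftRight _ hS)
      fun s => (IsUnit.coe_liftRight _ hS s).symm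
    have hu : ∀ a, u (f a) = φ a := fun a => OreLocalization.universalHom_commutes _ _ _ (r := a)
    exact ⟨{ u with commutes' := fun c => (hu (algebraMap ℂ _ c)).trans (φ.commutes c) },
      AlgHom.ext hu⟩

theorem exists_detExtension_cgToSL :
    ∃ (_ : Algebra ℂ (CGSL n q p)) (f : CGA n q p →ₐ[ℂ] CGSL n q p),
      (∀ a, f a = cgToSL n q p a) ∧ DetExtension True f := by
  let I := TwoSidedIdeal.span {cgDet n q p - 1}
  let alg := algebraCGSL n q p
  let f : CGA n q p →ₐ[ℂ] CGSL n q p := { cgToSL n q p with commutes' := fun _ => rfl }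
  have h1 : f (cgDet n q p) = 1 :=
    (Ideal.Quotient.mk_eq_mk_iff_sub_mem _ _).2
      (TwoSidedIdeal.subset_span (Set.mem_singleton (cgDet n q p - 1)))
  refine ⟨alg, f, fun _ => rfl,
    { isUnit := ?_
      eq_one := fun _ => h1
      exists_mul := fun x => ?_
      exists_lift := fun {Y} _ _ φ _ hg => ?_ }⟩
  · exact h1 ▸ isUnit_one
  · obtain ⟨a, rfl⟩ := Ideal.Quotient.mk_surjective x
    refine ⟨0, a, ?_⟩
    rw [pow_zero]
    exact one_mul _
  · have hle : I ≤ TwoSidedIdeal.ker φ := TwoSidedIdeal.span_le.2 (by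
      simp [TwoSidedIdeal.mem_ker, hg trivial])
    exact ⟨Ideal.Quotient.liftₐ I.asIdeal φ fun a ha => (TwoSidedIdeal.mem_ker φ).1 (hle ha),
      AlgHom.ext fun a => rfl⟩

theorem cgToSL_surjective : Function.Surjective (cgToSL n q p) := Ideal.Quotient.mk_surjective

theorem cgToSL_eq_zero_iff (a : CGA n q p) :
    cgToSL n q p a = 0 ↔ a ∈ TwoSidedIdeal.span {cgDet n q p - 1} :=
  Ideal.Quotient.eq_zero_iff_mem

theorem cgToSL_cgDet : cgToSL n q p (cgDet n q p) = 1 := by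
  rw [← sub_eq_zero, ← map_one (cgToSL n q p), ← map_sub, cgToSL_eq_zero_iff]
  exact TwoSidedIdeal.subset_span rfl

/-- The kernel of the map from the localization to the quotient. -/
theorem DetExtension.eq_zero_iff_mem_span {b : Prop} {X : Type} [Ring X] [Algebra ℂ X]
    {f : CGA n q p →ₐ[ℂ] X} (h : DetExtension b f) (θ : X →+* CGSL n q p)
    (hθ : ∀ a, θ (f a) = cgToSL n q p a) (x : X) :
    θ x = 0 ↔ x ∈ TwoSidedIdeal.span {f (cgDet n q p) - 1} := by
  constructor
  · intro hx
    obtain ⟨m, a, ha⟩ := h.exists_mul x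
    have hle : TwoSidedIdeal.span {cgDet n q p - 1}
        ≤ TwoSidedIdeal.comap f (TwoSidedIdeal.span {f (cgDet n q p) - 1}) :=
      TwoSidedIdeal.span_le.2 (Set.singleton_subset_iff.2 (by
        rw [SetLike.mem_coe, TwoSidedIdeal.mem_comap, map_sub, map_one]
        exact TwoSidedIdeal.subset_span rfl))
    have h0 : cgToSL n q p a = 0 := by rw [← hθ, ← ha, map_mul, hx, mul_zero]
    have hmem := hle ((cgToSL_eq_zero_iff a).1 h0)
    rw [TwoSidedIdeal.mem_comap, ← ha] at hmem
    obtain ⟨u, hu⟩ := h.isUnit.pow m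
    have e := TwoSidedIdeal.mul_mem_left _ (↑u⁻¹ : X) _ hmem
    rwa [← hu, Units.inv_mul_cancel_left] at e
  · intro hx
    have hle : TwoSidedIdeal.span {f (cgDet n q p) - 1} ≤ TwoSidedIdeal.ker θ :=
      TwoSidedIdeal.span_le.2 (Set.singleton_subset_iff.2 (by
        rw [SetLike.mem_coe, TwoSidedIdeal.mem_ker, map_sub, map_one, hθ, cgToSL_cgDet, sub_self]))
    exact (TwoSidedIdeal.mem_ker θ).1 (hle hx)

end

/-! ### Kernels of Hopf algebra maps. -/

section

variable {H K : Type*} [Ring H] [HopfAlgebra ℂ H] [Ring K] [HopfAlgebra ℂ K]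

/-- Both sides are convolution inverses of `θ`, one on the left and one on the right. -/
theorem BialgHom.map_antipode (θ : H →ₐc[ℂ] K) (x : H) :
    θ (HopfAlgebra.antipode ℂ x) = HopfAlgebra.antipode ℂ (θ x) := by
  let t : WithConv (H →ₗ[ℂ] K) := toConv (θ : H →ₗ[ℂ] K)
  let r : WithConv (H →ₗ[ℂ] K) := toConv ((θ : H →ₗ[ℂ] K) ∘ₗ HopfAlgebra.antipode ℂ)
  let l : WithConv (H →ₗ[ℂ] K) := toConv (HopfAlgebra.antipode ℂ ∘ₗ (θ : H →ₗ[ℂ] K))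
  have hl : l * t = 1 := by
    refine WithConv.ext (LinearMap.ext fun x => ?_)
    refine ((ℛ ℂ x).convMul_apply _ _).trans ?_
    have e := HopfAlgebra.sum_antipode_mul_eq_algebraMap_counit ((ℛ ℂ x).induced θ)
    rw [CoalgHomClass.counit_comp_apply] at e
    exact e
  have hr : t * r = 1 := by
    refine WithConv.ext (LinearMap.ext fun x => ?_)
    refine ((ℛ ℂ x).convMul_apply _ _).trans ?_
    have e := congrArg θ (HopfAlgebra.sum_mul_antipode_eq_algebraMap_counit (ℛ ℂ x))
    simp only [map_sum, map_mul] at e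
    exact e.trans (AlgHomClass.commutes θ _)
  exact (congrArg (fun φ : WithConv (H →ₗ[ℂ] K) => φ.ofConv x) (left_inv_eq_right_inv hl hr)).symm

/-- The kernel of a surjective map of Hopf algebras is a Hopf ideal. -/
theorem isHopfIdeal_of_surjective (θ : H →ₐc[ℂ] K) (hs : Function.Surjective θ)
    (I : TwoSidedIdeal H) (hI : ∀ x, θ x = 0 ↔ x ∈ I) : I.asIdeal.IsHopfIdeal ℂ where
  counit_eq_zero x hx := by
    have h0 : θ x = 0 := (hI x).2 hx
    rw [← CoalgHomClass.counit_comp_apply θ, h0, map_zero]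
  map_mkQ_comul_eq_zero x hx := by
    have h0 : θ x = 0 := (hI x).2 hx
    let J := I.asIdeal.restrictScalars ℂ
    have hker : LinearMap.ker (θ : H →ₗ[ℂ] K) ≤ J := fun y hy => (hI y).1 hy
    -- The projection modulo the ideal factors through `θ`, so `Δ(x)` modulo the ideal is computed
    -- from `Δ(θ x) = 0`.
    obtain ⟨e, he⟩ : ∃ e : K →ₗ[ℂ] H ⧸ J, ∀ y, e (θ y) = J.mkQ y := by
      let E := (θ : H →ₗ[ℂ] K).quotKerEquivOfSurjective hs
      refine ⟨Submodule.mapQ _ J LinearMap.id hker ∘ₗ E.symm.toLinearMap, fun y => ?_⟩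
      have : E.symm (θ y) = Submodule.Quotient.mk y := by
        rw [LinearEquiv.symm_apply_eq]
        rfl
      rw [LinearMap.comp_apply, LinearEquiv.coe_coe, this]
      rfl
    have h1 : TensorProduct.map J.mkQ J.mkQ (comul x)
        = TensorProduct.map e e (comul (R := ℂ) (θ x)) := by
      rw [← ((ℛ ℂ x).induced θ).eq, ← (ℛ ℂ x).eq, map_sum, map_sum]
      simp only [Coalgebra.Repr.induced, Function.comp_apply, TensorProduct.map_tmul, he]
    rw [h0, map_zero, map_zero] at h1
    exact h1
  antipode_mem x hx := by
    have h0 : θ x = 0 := (hI x).2 hx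
    exact (hI _).1 (by rw [BialgHom.map_antipode, h0, map_zero])

end

end

/-! ### Assembly of the theorem. -/

open scoped TensorProduct

theorem mainTheorem9 (n : ℕ) (q p : ℂ) (hq : q ≠ 0) (hp : p ≠ 0) :
    -- `det_q` is the coefficient of the coaction of `A(R)` on the top form of `Λ(R)`
    (cgTop n q p ≠ 0 ∧
      ∃ ρ : CGExt n q p →ₐ[ℂ] CGA n q p ⊗[ℂ] CGExt n q p,
        (∀ i, ρ (cgX n q p i) = ∑ j, cgT n q p i j ⊗ₜ[ℂ] cgX n q p j) ∧
        ρ (cgTop n q p) = cgDet n q p ⊗ₜ[ℂ] cgTop n q p) ∧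
    -- the braiding of `A(R)`
    ∃ β : Braiding ℂ (CGA n q p),
      (∀ i k j l, β.pair (cgT n q p i k) (cgT n q p j l) = cremmerGervais n q p j i l k) ∧
    -- `ℂ_R[GL(n)]` exists, and is a braided Hopf algebra
    ∃ _ : OreLocalization.OreSet (Submonoid.powers (cgDet n q p)),
    ∃ (_ : HopfAlgebra ℂ (CGGL n q p)) (γ : Braiding ℂ (CGGL n q p))
      (ι : CGA n q p →ₐc[ℂ] CGGL n q p),
      (∀ a, ι a = cgToGL n q p a) ∧ IsBraidedHom β γ ι ∧
    -- the case `p ^ n = q`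
    (p ^ n = q →
      IsBraidedHopfIdeal γ (TwoSidedIdeal.span {cgToGL n q p (cgDet n q p) - 1}) ∧
      ∃ (_ : HopfAlgebra ℂ (CGSL n q p)) (δ : Braiding ℂ (CGSL n q p))
        (π : CGA n q p →ₐc[ℂ] CGSL n q p) (θ : CGGL n q p →ₐc[ℂ] CGSL n q p),
        (∀ a, π a = cgToSL n q p a) ∧ IsBraidedHom β δ π ∧
        (∀ a, θ (cgToGL n q p a) = cgToSL n q p a) ∧ IsBraidedHom γ δ θ ∧
        Function.Surjective θ ∧
        (∀ x, θ x = 0 ↔ x ∈ TwoSidedIdeal.span {cgToGL n q p (cgDet n q p) - 1})) := by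
  refine ⟨⟨CGExt.cgTop_ne_zero hq hp, CGExt.coact hq hp, CGExt.coact_cgX hq hp,
    CGExt.coact_cgTop hq hp⟩, ?_⟩
  obtain ⟨instOre⟩ := nonempty_oreSet (n := n) hq hp
  obtain ⟨instGL, ι, hι, hGL⟩ := DetExtension.exists_hopfAlgebra
    (exists_detExtension_cgToGL (n := n) (q := q) (p := p)) hq hp
  obtain ⟨σ, hσ⟩ := hGL.exists_pairing hq hp False.elim
  -- The convolution inverse of the pairing on `A(R)` is pulled back from the localization, whose
  -- antipode provides it.
  refine ⟨(cgPairing hq hp).braidingOfHom (FRT.pairing_commRel _) ι σ hσ,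
    fun i k j l => FRT.pairing_T_T _ i k j l, instOre, instGL,
    σ.braidingOfHom (hGL.commRel hσ) (BialgHom.id ℂ _) σ fun _ _ => rfl, ι, hι, hσ, fun h => ?_⟩
  obtain ⟨instSL, π, hπ, hSL⟩ := DetExtension.exists_hopfAlgebra
    (exists_detExtension_cgToSL (n := n) (q := q) (p := p)) hq hp
  obtain ⟨τ, hτ⟩ := hSL.exists_pairing hq hp fun _ => h
  have hπg : π (cgDet n q p) = 1 := hSL.eq_one trivial
  obtain ⟨θ, hθ⟩ := hGL.exists_bialgHom π (hπg ▸ isUnit_one) False.elim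
  have hθ' : ∀ a, θ (cgToGL n q p a) = cgToSL n q p a := fun a => by rw [← hι, hθ, hπ]
  have hsurj : Function.Surjective θ := fun y => by
    obtain ⟨a, rfl⟩ := cgToSL_surjective y
    exact ⟨_, hθ' a⟩
  have hker : ∀ x, θ x = 0 ↔ x ∈ TwoSidedIdeal.span {cgToGL n q p (cgDet n q p) - 1} := fun x => by
    rw [← hι]
    exact hGL.eq_zero_iff_mem_span (θ : CGGL n q p →+* CGSL n q p) (fun a => (hθ a).trans (hπ a)) x
  have hform : ∀ x y, τ.form (θ x) (θ y) = σ.form x y :=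
    hGL.form_map hσ θ fun a c => by rw [hθ, hθ, hτ]
  refine ⟨⟨isHopfIdeal_of_surjective θ hsurj _ hker, fun x hx y => ?_⟩, instSL,
    τ.braidingOfHom (hSL.commRel hτ) (BialgHom.id ℂ _) τ fun _ _ => rfl, π, θ, hπ, hτ, hθ', hform,
    hsurj, hker⟩
  -- The form on the localization is pulled back along `θ`, so the kernel of `θ` lies in both
  -- radicals.
  change σ.form x y = 0 ∧ σ.form y x = 0
  rw [← hform, ← hform, (hker x).2 hx, map_zero, map_zero, LinearMap.zero_apply]
  exact ⟨rfl, rfl⟩
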